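/- Let $n\ge 2$, let $\Gamma_n\cong\mathbb Z/n$ act on $\mathbb C^n=\mathbb R^{2n}$ by $z\mapsto e^{2\pi i k/n}z$, and let $X$ be the total space of $\mathcal O(-n)\to\mathbb P^{n-1}$, so that $X$ minus the zero section is $(\mathbb C^n\setminus\{0\})/\Gamma_n$. Write $r=|x|$, $\theta=-J(dr/r)$, and $g_{euc}=dr^2+r^2(g_{FS}+\theta^2)$. The Calabi metric on $X$ is $$g_{cal}=A^2dr^2+B\,g_{FS}+C^2\theta^2,\quad A=\frac{r^{n-1}}{(1+r^{2n})^{\frac{n-1}{2n}}},\quad B=(1+r^{2n})^{\frac1n},\quad C=(1+r^{2n})^{\frac{1-n}{2n}}r^n,$$ and its infinitesimal Einstein deformation is $o=\frac{1}{1+r^{2n}}\big(-B\,g_{FS}+(n-1)A^2dr^2+(n-1)C^2\theta^2\big)$. For a symmetric $2$-tensor $h$ put $P_g h=\frac12\nabla^*\nabla h-\mathring R(h)$, where $\mathring R(h)_{ij}=g^{kp}g^{lq}R_{ikjl}h_{pq}$, and $(B_g h)_i=-g^{jk}\nabla_jh_{ki}+\frac12\partial_i(\mathrm{tr}_g h)$.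 The sign convention for the curvature is that $R_{ijij}>0$ on the round sphere. Let $g_0$ be a smooth $\Gamma_n$-invariant Einstein metric, $Ric(g_0)=\Lambda g_0$, on a neighbourhood of $0$ in $\mathbb R^{2n}$ (an orbifold chart at $p_0$), with $g_0(0)=g_{euc}$. Let $R_{ijkl}$ and $R(p_0)$ be its curvature tensor and scalar curvature at $0$, let $\omega$ be the standard Kähler form at $0$, and put $\langle\mathcal R(\omega),\omega\rangle=\sum R_{ijkl}\omega_{ij}\omega_{kl}$. Let $H=H_{ijkl}x^ix^jdx^k\otimes dx^l$ with $$H_{ijkl}=-\tfrac13R_{ikjl}-\tfrac{\Lambda}{3(n+1)}(\delta_{ij}\delta_{kl}+2\delta_{ik}\delta_{jl}).$$ Then $-\frac12\Delta_{euc}H=\Lambda g_{euc}$, $B_{euc}H=0$ and $0<\|o\|^2_{L^2(g_{cal})}$. Moreover, the obstruction constant $$\lambda:=-\frac{1}{\|o\|^2_{L^2(g_{cal})}}\lim_{r\to\infty}\int_{S_r/\Gamma_n}\frac{n+1}{r}\langle H,o\rangle\,dS$$ (inner product and area element with respect to $g_{cal}$) exists and, with $\omega_{2n-1}$ the area of the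 unit sphere $S^{2n-1}$, is given by $$\lambda=-\frac{\omega_{2n-1}}{n\,\|o\|^2_{L^2}}\Big(\frac{2-n}{2}\Lambda-\frac18\langle\mathcal R(\omega),\omega\rangle\Big).$$ Whenever $0<\varepsilon<1$, $h$ is a smooth symmetric $2$-tensor on $X$ and $\lambda'\in\mathbb R$ satisfy $$P_{g_{cal}}h=\Lambda g_{cal}+\lambda' o,\qquad h=H+O(r^{-2n+2+\varepsilon})\ (r\to\infty),\qquad B_{g_{cal}}h=0,$$ one has $\lambda'=\lambda$. Finally, $\lambda$ is a positive multiple, depending only on $n$, of $n\langle\mathcal R(\omega),\omega\rangle+2(n-2)R(p_0)$: $$\lambda=\frac{\omega_{2n-1}}{8n^2\|o\|^2_{L^2}}\Big(n\langle\mathcal R(\omega),\omega\rangle+2(n-2)R(p_0)\Big).$$ -/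

import Mathlib

open MeasureTheory Filter Topology
open scoped ContDiff

noncomputable section

namespace CalabiObstruction

/-! ### Riemannian geometry in global coordinates

Two-tensor fields on (open subsets of) `ℝ^ι` are given by their component functions. -/

section Calculus

variable {ι : Type} [Fintype ι] [DecidableEq ι]

/-- A field of (covariant) two-tensors on `ℝ^ι`, in components. -/
abbrev TwoTensor (ι : Type) [Fintype ι] : Type := EuclideanSpace ℝ ι → ι → ι → ℝ

/-- Kronecker delta. -/
def kron (i j : ι) : ℝ := if i = j then 1 else 0

/-- The partial derivative `∂_i f`. -/
def pd (i : ι) (f : EuclideanSpace ℝ ι → ℝ) (x : EuclideanSpace ℝ ι) : ℝ :=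
  fderiv ℝ f x (EuclideanSpace.single i 1)

/-- The Euclidean metric. -/
def euclMetric : TwoTensor ι := fun _ i j => kron i j

/-- The components `g^{ij}` of the inverse metric. -/
def invMetric (g : TwoTensor ι) (x : EuclideanSpace ℝ ι) (i j : ι) : ℝ :=
  (Matrix.of (g x))⁻¹ i j

/-- `√(det g)`, the density of the Riemannian volume with respect to Lebesgue measure. -/
def volDensity (g : TwoTensor ι) (x : EuclideanSpace ℝ ι) : ℝ :=
  Real.sqrt (Matrix.of (g x)).det

/-- The inner product of two-tensors, `g^{ik} g^{jl} a_{ij} b_{kl}`. -/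
def tensorInner (g a b : TwoTensor ι) (x : EuclideanSpace ℝ ι) : ℝ :=
  ∑ i, ∑ j, ∑ k, ∑ l, invMetric g x i k * invMetric g x j l * a x i j * b x k l

/-- The Christoffel symbol `Γ^k_{ij}` of `g`. -/
def christoffel (g : TwoTensor ι) (k i j : ι) (x : EuclideanSpace ℝ ι) : ℝ :=
  (1 / 2) * ∑ l, invMetric g x k l *
    (pd i (fun y => g y j l) x + pd j (fun y => g y i l) x - pd l (fun y => g y i j) x)

/-- The curvature tensor `R_{ijkl} = g(R(e_i, e_j) e_l, e_k)`; in this convention `R_{ijij} > 0`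
on the round sphere. -/
def riemann (g : TwoTensor ι) (x : EuclideanSpace ℝ ι) (i j k l : ι) : ℝ :=
  ∑ m, g x k m *
    (pd i (christoffel g m j l) x - pd j (christoffel g m i l) x +
      ∑ p, (christoffel g m i p x * christoffel g p j l x -
        christoffel g m j p x * christoffel g p i l x))

/-- The Ricci tensor `R_{ij} = g^{kl} R_{ikjl}`. -/
def ricci (g : TwoTensor ι) : TwoTensor ι := fun x i j =>
  ∑ k, ∑ l, invMetric g x k l * riemann g x i k j l

/-- The scalar curvature. -/
def scalarCurv (g : TwoTensor ι) (x : EuclideanSpace ℝ ι) : ℝ :=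
  ∑ i, ∑ j, invMetric g x i j * ricci g x i j

/-- The covariant derivative `∇_k h_{ij}` of a two-tensor. -/
def covDeriv (g h : TwoTensor ι) (k i j : ι) (x : EuclideanSpace ℝ ι) : ℝ :=
  pd k (fun y => h y i j) x -
    ∑ p, (christoffel g p k i x * h x p j + christoffel g p k j x * h x i p)

/-- The second covariant derivative `∇_l ∇_k h_{ij}` of a two-tensor. -/
def covDeriv2 (g h : TwoTensor ι) (l k i j : ι) (x : EuclideanSpace ℝ ι) : ℝ :=
  pd l (covDeriv g h k i j) x -
    ∑ p, (christoffel g p l k x * covDeriv g h p i j x +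
      christoffel g p l i x * covDeriv g h k p j x +
      christoffel g p l j x * covDeriv g h k i p x)

/-- The rough Laplacian `Δh = g^{lk} ∇_l ∇_k h = - ∇^* ∇ h`. -/
def roughLaplacian (g h : TwoTensor ι) : TwoTensor ι := fun x i j =>
  ∑ l, ∑ k, invMetric g x l k * covDeriv2 g h l k i j x

/-- The action of the curvature on two-tensors, `g^{kp} g^{lq} R_{ikjl} h_{pq}`. -/
def curvAction (g h : TwoTensor ι) : TwoTensor ι := fun x i j =>
  ∑ k, ∑ l, ∑ p, ∑ q, invMetric g x k p * invMetric g x l q * riemann g x i k j l * h x p q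

/-- `P_g h = ½ ∇^* ∇ h - R̊(h)`. -/
def opP (g h : TwoTensor ι) : TwoTensor ι := fun x i j =>
  -(1 / 2) * roughLaplacian g h x i j - curvAction g h x i j

/-- The trace `tr_g h`. -/
def trace (g h : TwoTensor ι) (x : EuclideanSpace ℝ ι) : ℝ :=
  ∑ j, ∑ k, invMetric g x j k * h x j k

/-- The Bianchi operator `B_g h = δ_g h + ½ d (tr_g h)`, with `(δ_g h)_i = - g^{jk} ∇_j h_{ki}`. -/
def opB (g h : TwoTensor ι) (x : EuclideanSpace ℝ ι) (i : ι) : ℝ :=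
  -(∑ j, ∑ k, invMetric g x j k * covDeriv g h j k i x) + (1 / 2) * pd i (trace g h) x

/-- The pull-back `φ^* k` of a two-tensor. -/
def pullback (φ : EuclideanSpace ℝ ι → EuclideanSpace ℝ ι) (k : TwoTensor ι) : TwoTensor ι :=
  fun x i j => ∑ p, ∑ q, pd i (fun y => φ y p) x * pd j (fun y => φ y q) x * k (φ x) p q

/-- `g` is a smooth Riemannian metric on the set `U` (meant for open `U`). -/
structure IsRiemannianMetricOn (U : Set (EuclideanSpace ℝ ι)) (g : TwoTensor ι) : Prop where
  smooth : ∀ i j, ContDiffOn ℝ ∞ (fun x => g x i j) U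
  symm : ∀ x ∈ U, ∀ i j, g x i j = g x j i
  pos : ∀ x ∈ U, ∀ v : ι → ℝ, v ≠ 0 → 0 < ∑ i, ∑ j, g x i j * v i * v j

/-- `g` is an Einstein metric on `U` with `Ric(g) = Λ g`. -/
structure IsEinsteinOn (U : Set (EuclideanSpace ℝ ι)) (g : TwoTensor ι) (Λ : ℝ) : Prop
    extends IsRiemannianMetricOn U g where
  einstein : ∀ x ∈ U, ∀ i j, ricci g x i j = Λ * g x i j

end Calculus

/-! ### The space `ℂⁿ = ℝ²ⁿ` and the group `Γ_n` -/

/-- The real coordinates on `ℂⁿ`: `(a, 0)` is the real part and `(a, 1)` the imaginary part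
of `z^a`. -/
abbrev Idx (n : ℕ) : Type := Fin n × Fin 2

/-- `ℂⁿ` as the Euclidean space `ℝ²ⁿ`. -/
abbrev Cn (n : ℕ) : Type := EuclideanSpace ℝ (Idx n)

/-- The complex coordinate `z^a` of a point. -/
def zc {n : ℕ} (x : Cn n) (a : Fin n) : ℂ := ⟨x (a, 0), x (a, 1)⟩

/-- The point with given complex coordinates. -/
def ofZ {n : ℕ} (z : Fin n → ℂ) : Cn n :=
  WithLp.toLp 2 fun p => if p.2 = 0 then (z p.1).re else (z p.1).im

/-- The standard complex structure. -/
def cstr {n : ℕ} (x : Cn n) : Cn n := ofZ fun a => Complex.I * zc x a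

/-- The standard Kähler form `ω_{ij} = g_euc(J e_i, e_j)`. -/
def kahler {n : ℕ} (i j : Idx n) : ℝ := cstr (EuclideanSpace.single i (1 : ℝ)) j

/-- The action on `ℂⁿ` of the generator `e^{2πi/n}` of `Γ_n`. -/
def gammaGen (n : ℕ) (x : Cn n) : Cn n :=
  ofZ fun a => Complex.exp (2 * Real.pi * Complex.I / n) * zc x a

/-- `g` is a `Γ_n`-invariant tensor on the `Γ_n`-invariant set `U`. -/
def IsGammaInvariantOn {n : ℕ} (U : Set (Cn n)) (g : TwoTensor (Idx n)) : Prop :=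
  ∀ x ∈ U, gammaGen n x ∈ U ∧ pullback (gammaGen n) g x = g x

/-- The area `ω_{2n-1}` of the unit sphere `S^{2n-1}`. -/
def sphereArea (n : ℕ) : ℝ := (volume : Measure (Cn n)).toSphere.real Set.univ

/-! ### The Calabi metric

`X`, the total space of `𝒪(-n) → ℙ^{n-1}`, is `(ℂⁿ \ {0}) / Γ_n` together with the zero section.
Tensors on the complement of the zero section are `Γ_n`-invariant tensors on `ℂⁿ \ {0}`.
The values at `0` of the functions below have no meaning and are never used. -/

/-- The one-form `dr`. -/
def drForm {n : ℕ} (x : Cn n) (i : Idx n) : ℝ := x i / ‖x‖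

/-- The one-form `θ = - J (dr / r)`, dual to the Hopf field `J (r ∂_r)`. -/
def thetaForm {n : ℕ} (x : Cn n) (i : Idx n) : ℝ := cstr x i / ‖x‖ ^ 2

/-- The Fubini–Study metric pulled back to `ℂⁿ \ {0}`, from
`g_euc = dr² + r² (g_FS + θ²)`. -/
def fubiniStudy (n : ℕ) : TwoTensor (Idx n) := fun x i j =>
  (kron i j - drForm x i * drForm x j - ‖x‖ ^ 2 * (thetaForm x i * thetaForm x j)) / ‖x‖ ^ 2

/-- `A(r) = r^{n-1} / (1 + r^{2n})^{(n-1)/(2n)}`. -/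
def coefA (n : ℕ) (r : ℝ) : ℝ :=
  r ^ (n - 1) / (1 + r ^ (2 * n)) ^ (((n : ℝ) - 1) / (2 * n))

/-- `B(r) = (1 + r^{2n})^{1/n}`. -/
def coefB (n : ℕ) (r : ℝ) : ℝ := (1 + r ^ (2 * n)) ^ ((1 : ℝ) / n)

/-- `C(r) = (1 + r^{2n})^{(1-n)/(2n)} r^n`. -/
def coefC (n : ℕ) (r : ℝ) : ℝ := (1 + r ^ (2 * n)) ^ ((1 - (n : ℝ)) / (2 * n)) * r ^ n

/-- The Calabi metric `g_cal = A² dr² + B g_FS + C² θ²`. -/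
def calabi (n : ℕ) : TwoTensor (Idx n) := fun x i j =>
  coefA n ‖x‖ ^ 2 * (drForm x i * drForm x j) + coefB n ‖x‖ * fubiniStudy n x i j +
    coefC n ‖x‖ ^ 2 * (thetaForm x i * thetaForm x j)

/-- The infinitesimal Einstein deformation
`o = (1 + r^{2n})⁻¹ (- B g_FS + (n-1) A² dr² + (n-1) C² θ²)` of the Calabi metric. -/
def oTensor (n : ℕ) : TwoTensor (Idx n) := fun x i j =>
  (1 / (1 + ‖x‖ ^ (2 * n))) *
    (-(coefB n ‖x‖ * fubiniStudy n x i j) +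
      ((n : ℝ) - 1) * (coefA n ‖x‖ ^ 2 * (drForm x i * drForm x j)) +
      ((n : ℝ) - 1) * (coefC n ‖x‖ ^ 2 * (thetaForm x i * thetaForm x j)))

/-- The squared norm `‖o‖²` in `L²(X, g_cal)`; the zero section has measure zero, and
`ℂⁿ \ {0} → X` is `n`-to-one onto its complement. -/
def oNormSq (n : ℕ) : ℝ :=
  (1 / n) * ∫ x : Cn n, tensorInner (calabi n) (oTensor n) (oTensor n) x * volDensity (calabi n) x

/-- The integral over `S_r / Γ_n` of (the function induced by the `Γ_n`-invariant function) `f`,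
with respect to the area measure of the hypersurface `S_r / Γ_n ⊂ (X, g_cal)`. The Riemannian
area element of `S_r` is `√(det g) |dr|_g` times the Euclidean one. -/
def sphereIntegral (n : ℕ) (f : Cn n → ℝ) (r : ℝ) : ℝ :=
  (1 / n) * ∫ u : Metric.sphere (0 : Cn n) 1,
    f (r • (u : Cn n)) *
      (volDensity (calabi n) (r • (u : Cn n)) *
        Real.sqrt (∑ i, ∑ j, invMetric (calabi n) (r • (u : Cn n)) i j *
          drForm (r • (u : Cn n)) i * drForm (r • (u : Cn n)) j) * r ^ (2 * n - 1))
    ∂(volume : Measure (Cn n)).toSphere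

/-! ### The manifold `X` and the gauged linearized problem -/

/-- Over `{z^a ≠ 0} ⊂ ℙ^{n-1}` the space `X` has the global holomorphic coordinates
`w^b = z^b / z^a` for `b ≠ a`, and the fibre coordinate `ξ = (z^a)^n`, which is put in place `a`.
This is the quotient map `{z^a ≠ 0} → X` in these coordinates. -/
def chart {n : ℕ} (a : Fin n) (x : Cn n) : Cn n :=
  ofZ fun b => if b = a then zc x a ^ n else zc x b / zc x a

/-- `h` is (the lift to `ℂⁿ \ {0}` of) a smooth symmetric two-tensor on the whole of `X`,
the zero section included. -/
structure IsSmoothSymmetricOnX (n : ℕ) (h : TwoTensor (Idx n)) : Prop where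
  symm : ∀ x, x ≠ 0 → ∀ i j, h x i j = h x j i
  smooth : ∀ a : Fin n, ∃ k : TwoTensor (Idx n),
    (∀ i j, ContDiff ℝ ∞ fun y => k y i j) ∧
      ∀ x, zc x a ≠ 0 → h x = pullback (chart a) k x

/-- `(h, lam)` solves `P h = Λ g_cal + lam • o`, `h = H + O(r^{-2n+2+ε})`, `B h = 0` on
`(X, g_cal)`. By continuity it is enough to require the equations off the zero section. -/
structure IsSolution (n : ℕ) (H : TwoTensor (Idx n)) (Λ ε : ℝ) (h : TwoTensor (Idx n))
    (lam : ℝ) : Prop where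
  smooth : IsSmoothSymmetricOnX n h
  eqn : ∀ x, x ≠ 0 → ∀ i j,
    opP (calabi n) h x i j = Λ * calabi n x i j + lam * oTensor n x i j
  asymp : ∀ i j, (fun x => h x i j - H x i j) =O[Bornology.cobounded (Cn n)]
    fun x => ‖x‖ ^ (-2 * (n : ℝ) + 2 + ε)
  gauge : ∀ x, x ≠ 0 → ∀ i, opB (calabi n) h x i = 0

/-! ### The quadratic tensor of an Einstein metric -/

/-- `H_{ijkl} = - ⅓ R_{ikjl} - Λ / (3(n+1)) (δ_{ij} δ_{kl} + 2 δ_{ik} δ_{jl})`, with the curvature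
of `g₀` at the origin. -/
def hCoeff {n : ℕ} (g₀ : TwoTensor (Idx n)) (Λ : ℝ) (i j k l : Idx n) : ℝ :=
  -(1 / 3) * riemann g₀ 0 i k j l -
    Λ / (3 * ((n : ℝ) + 1)) * (kron i j * kron k l + 2 * (kron i k * kron j l))

/-- The quadratic tensor `H = H_{ijkl} x^i x^j dx^k ⊗ dx^l`. -/
def hTensor {n : ℕ} (g₀ : TwoTensor (Idx n)) (Λ : ℝ) : TwoTensor (Idx n) := fun x k l =>
  ∑ i, ∑ j, hCoeff g₀ Λ i j k l * x i * x j

/-- `⟨R(ω), ω⟩ = ∑ R_{ijkl} ω_{ij} ω_{kl}` at the origin. -/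
def curvOmega {n : ℕ} (g₀ : TwoTensor (Idx n)) : ℝ :=
  ∑ i, ∑ j, ∑ k, ∑ l, riemann g₀ 0 i j k l * kahler i j * kahler k l

end CalabiObstruction

end

open CalabiObstruction

noncomputable section

set_option linter.unusedSectionVars false

/-! Put `f = 1/(1+r^{2n})` and `a = (1+r^{2n})^{1/n}/r²`. In Cartesian coordinates the Calabi metric
is `a (1 - f π/r²)`, where `π = x xᵀ + (Jx)(Jx)ᵀ`. Everything below is algebra in `1` and `π` with
coefficients in `f`, `a`, `r²`. In particular the determinant is `1` (`det_calabi`), so the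
Riemannian divergence of a vector field is its coordinate divergence, and Green's formula can be
used on flat space.

The tensor `o` lies in the kernel of `P`. Indeed the Euler derivative of the components of `g_cal`
is `2 o` (`eul_calabi`), which is a Lie derivative of the metric minus twice the metric.
Diffeomorphisms and scalings preserve Ricci-flatness (`ricci_calabi`), and `o` is trace free and
divergence free, so the linearised Ricci equation reduces to `P o = 0` (`opP_eq_zero_of_dilation`,
`opP_oTensor`).

Let `P h = Λ g + λ' o` and let `W` be the Green field of `h` and `o`. As `⟨g, o⟩ = 0`, one gets `div
W = -2 λ' |o|²`, with `|o|² = 2n(n-1) f²`. Thus `λ' ‖o‖²` is a flux at infinity. The flux contains a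
radial derivative of `h`, on which the decay hypothesis says nothing. Hence the identity is tested
against a radial cut-off and the radial derivative of `⟨h, o⟩` is integrated by parts onto it
(`div_testField`, `weak_flux_polar`). Only spherical means of `⟨h, o⟩` remain (`fluxProfile`). With
the cut-off `χ(log r / M)` and `M → ∞`, dominated convergence gives `(n-1) ω λ' = -(n+1) K`, where
`ω` is the area of the sphere and `K` the limit of `fluxProfile` (`lam_eq_of_tendsto_fluxProfile`).
The cut-off also acts near the zero section. There the profile only has to be bounded, which follows
from smoothness of `h` in the holomorphic charts (`bounded_tensorInner_near_zeroSection`).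

Because `h - H` decays, `K` can be computed from `H` (`tendsto_fluxProfile`). The pairing of `H`
with `o` involves only `tr H`, `H(x,x)` and `H(Jx,Jx)`. The first two are multiples of powers of
`r`, and the third contains the quartic form `R(x,Jx,x,Jx)`. Its spherical mean follows from the
fourth moments of the sphere, the Einstein equation and the first Bianchi identity
(`integral_holSect`). The same computation yields the limit of the flux integrals (`tendsto_flux`),
and `R(p₀) = 2nΛ` puts the constant in its final form. -/

namespace CalabiObstruction

/-! ### Coordinate partial derivatives and the Kronecker delta -/

section PartialDerivatives

variable {ι : Type} [Fintype ι] [DecidableEq ι]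
variable {S : Set (EuclideanSpace ℝ ι)} {x : EuclideanSpace ℝ ι} {f g : EuclideanSpace ℝ ι → ℝ}

lemma pd_add (i : ι) (hf : DifferentiableAt ℝ f x) (hg : DifferentiableAt ℝ g x) :
    pd i (fun y => f y + g y) x = pd i f x + pd i g x := by
  simp only [pd]; rw [fderiv_fun_add hf hg]; rfl

lemma pd_sub (i : ι) (hf : DifferentiableAt ℝ f x) (hg : DifferentiableAt ℝ g x) :
    pd i (fun y => f y - g y) x = pd i f x - pd i g x := by
  simp only [pd]; rw [fderiv_fun_sub hf hg]; rfl

lemma pd_neg (i : ι) : pd i (fun y => -f y) x = -pd i f x := by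
  simp only [pd]; rw [fderiv_fun_neg]; rfl

lemma pd_mul (i : ι) (hf : DifferentiableAt ℝ f x) (hg : DifferentiableAt ℝ g x) :
    pd i (fun y => f y * g y) x = pd i f x * g x + f x * pd i g x := by
  simp only [pd]; rw [fderiv_fun_mul hf hg]; simp; ring

lemma pd_const (i : ι) (c : ℝ) : pd i (fun _ => c) x = 0 := by
  simp [pd]

lemma pd_const_mul (i : ι) (c : ℝ) (hf : DifferentiableAt ℝ f x) :
    pd i (fun y => c * f y) x = c * pd i f x := by
  rw [pd_mul i (differentiableAt_const c) hf, pd_const]; ring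

lemma pd_sum {κ : Type*} (i : ι) (u : Finset κ) {F : κ → EuclideanSpace ℝ ι → ℝ}
    (hF : ∀ k ∈ u, DifferentiableAt ℝ (F k) x) :
    pd i (fun y => ∑ k ∈ u, F k y) x = ∑ k ∈ u, pd i (F k) x := by
  simp only [pd]; rw [fderiv_fun_sum hF]; simp

lemma pd_congr (i : ι) (h : f =ᶠ[𝓝 x] g) : pd i f x = pd i g x := by
  simp only [pd]; rw [h.fderiv_eq]

lemma pd_congr_on (i : ι) (hS : IsOpen S) (hx : x ∈ S) (h : Set.EqOn f g S) :
    pd i f x = pd i g x :=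
  pd_congr i (h.eventuallyEq_of_mem (hS.mem_nhds hx))

lemma kron_comm (i j : ι) : kron i j = kron j i := by
  simp [kron, eq_comm]

@[simp] lemma kron_self (i : ι) : kron i i = 1 := by simp [kron]

@[simp] lemma sum_kron_mul (i : ι) (F : ι → ℝ) : ∑ k, kron i k * F k = F i := by
  simp [kron]

@[simp] lemma sum_kron_mul' (i : ι) (F : ι → ℝ) : ∑ k, kron k i * F k = F i := by
  simp [kron]

@[simp] lemma sum_mul_kron (i : ι) (F : ι → ℝ) : ∑ k, F k * kron i k = F i := by
  simp [kron]

@[simp] lemma sum_mul_kron' (i : ι) (F : ι → ℝ) : ∑ k, F k * kron k i = F i := by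
  simp [kron]

lemma differentiable_coord (j : ι) : Differentiable ℝ fun y : EuclideanSpace ℝ ι => y j :=
  (EuclideanSpace.proj j : EuclideanSpace ℝ ι →L[ℝ] ℝ).differentiable

lemma contDiff_coord (j : ι) : ContDiff ℝ ∞ fun y : EuclideanSpace ℝ ι => y j :=
  (EuclideanSpace.proj j : EuclideanSpace ℝ ι →L[ℝ] ℝ).contDiff

lemma pd_coord (i j : ι) : pd i (fun y : EuclideanSpace ℝ ι => y j) x = kron i j := by
  have h : (fun y : EuclideanSpace ℝ ι => y j) =
      (EuclideanSpace.proj j : EuclideanSpace ℝ ι →L[ℝ] ℝ) := rfl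
  simp only [pd]
  rw [h, ContinuousLinearMap.fderiv]
  simp [kron, eq_comm]

lemma fderiv_eq_sum_pd (v : EuclideanSpace ℝ ι) :
    fderiv ℝ f x v = ∑ i, v i * pd i f x := by
  have hv : v = ∑ i, v i • EuclideanSpace.single i (1 : ℝ) := by
    ext j; simp [Pi.single_apply]
  conv_lhs => rw [hv]
  simp [pd]

lemma contDiffOn_pd (i : ι) (hS : IsOpen S) (hf : ContDiffOn ℝ ∞ f S) :
    ContDiffOn ℝ ∞ (pd i f) S :=
  (hf.fderiv_of_isOpen hS (by simp)).clm_apply contDiffOn_const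

lemma diffAt_of_contDiffOn (hS : IsOpen S) (hf : ContDiffOn ℝ ∞ f S) (hx : x ∈ S) :
    DifferentiableAt ℝ f x :=
  (hf.contDiffAt (hS.mem_nhds hx)).differentiableAt (by simp)

lemma pd_comm (i j : ι) (hS : IsOpen S) (hf : ContDiffOn ℝ ∞ f S) (hx : x ∈ S) :
    pd i (pd j f) x = pd j (pd i f) x := by
  have hd : DifferentiableAt ℝ (fderiv ℝ f) x :=
    ((hf.fderiv_of_isOpen hS (m := ∞) (by simp)).contDiffAt (hS.mem_nhds hx)).differentiableAt
      (by simp)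
  have key : ∀ a b : ι, pd a (pd b f) x =
      fderiv ℝ (fderiv ℝ f) x (EuclideanSpace.single a 1) (EuclideanSpace.single b 1) := by
    intro a b
    have : pd b f = fun y => fderiv ℝ f y (EuclideanSpace.single b 1) := rfl
    rw [this]
    simp only [pd]
    rw [fderiv_clm_apply hd (differentiableAt_const _)]
    simp
  have hs : IsSymmSndFDerivAt ℝ f x :=
    (hf.contDiffAt (hS.mem_nhds hx)).isSymmSndFDerivAt (by
      rw [minSmoothness_of_isRCLikeNormedField]; exact WithTop.coe_le_coe.2 le_top)
  rw [key, key]; exact hs _ _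

end PartialDerivatives

/-! ### Matrix notation for two-tensor fields -/

section MatrixFields

variable {ι : Type} [Fintype ι] [DecidableEq ι]
variable {S : Set (EuclideanSpace ℝ ι)} {x : EuclideanSpace ℝ ι}

/-- A field of matrices with smooth entries. -/
def SmoothMatOn (S : Set (EuclideanSpace ℝ ι)) (M : EuclideanSpace ℝ ι → Matrix ι ι ℝ) : Prop :=
  ∀ i j, ContDiffOn ℝ ∞ (fun x => M x i j) S

/-- The entrywise partial derivative of a field of matrices. -/
def pdMat (k : ι) (M : EuclideanSpace ℝ ι → Matrix ι ι ℝ) (x : EuclideanSpace ℝ ι) :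
    Matrix ι ι ℝ :=
  Matrix.of fun i j => pd k (fun y => M y i j) x

lemma pdMat_apply (k : ι) (M : EuclideanSpace ℝ ι → Matrix ι ι ℝ) (i j : ι) :
    pdMat k M x i j = pd k (fun y => M y i j) x := rfl

variable {M N : EuclideanSpace ℝ ι → Matrix ι ι ℝ}

lemma SmoothMatOn.mul (hM : SmoothMatOn S M) (hN : SmoothMatOn S N) :
    SmoothMatOn S fun x => M x * N x := by
  intro i j
  simp only [Matrix.mul_apply]
  exact ContDiffOn.sum fun k _ => (hM i k).mul (hN k j)

lemma SmoothMatOn.add (hM : SmoothMatOn S M) (hN : SmoothMatOn S N) :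
    SmoothMatOn S fun x => M x + N x := fun i j => (hM i j).add (hN i j)

lemma SmoothMatOn.sub (hM : SmoothMatOn S M) (hN : SmoothMatOn S N) :
    SmoothMatOn S fun x => M x - N x := fun i j => (hM i j).sub (hN i j)

lemma SmoothMatOn.transpose (hM : SmoothMatOn S M) :
    SmoothMatOn S fun x => (M x).transpose := fun i j => hM j i

lemma SmoothMatOn.pdMat (hS : IsOpen S) (hM : SmoothMatOn S M) (k : ι) :
    SmoothMatOn S (pdMat k M) := fun i j => contDiffOn_pd k hS (hM i j)

lemma pdMat_mul (k : ι) (hS : IsOpen S) (hx : x ∈ S) (hM : SmoothMatOn S M)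
    (hN : SmoothMatOn S N) :
    pdMat k (fun y => M y * N y) x = pdMat k M x * N x + M x * pdMat k N x := by
  ext i j
  simp only [pdMat_apply, Matrix.mul_apply, Matrix.add_apply]
  rw [pd_sum k _ fun p _ => (diffAt_of_contDiffOn hS (hM i p) hx).fun_mul
    (diffAt_of_contDiffOn hS (hN p j) hx),
    ← Finset.sum_add_distrib]
  exact Finset.sum_congr rfl fun p _ =>
    pd_mul k (diffAt_of_contDiffOn hS (hM i p) hx) (diffAt_of_contDiffOn hS (hN p j) hx)

lemma pdMat_add (k : ι) (hS : IsOpen S) (hx : x ∈ S) (hM : SmoothMatOn S M)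
    (hN : SmoothMatOn S N) :
    pdMat k (fun y => M y + N y) x = pdMat k M x + pdMat k N x := by
  ext i j
  exact pd_add k (diffAt_of_contDiffOn hS (hM i j) hx) (diffAt_of_contDiffOn hS (hN i j) hx)

lemma pdMat_sub (k : ι) (hS : IsOpen S) (hx : x ∈ S) (hM : SmoothMatOn S M)
    (hN : SmoothMatOn S N) :
    pdMat k (fun y => M y - N y) x = pdMat k M x - pdMat k N x := by
  ext i j
  exact pd_sub k (diffAt_of_contDiffOn hS (hM i j) hx) (diffAt_of_contDiffOn hS (hN i j) hx)

lemma pdMat_transpose (k : ι) :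
    pdMat k (fun y => (M y).transpose) x = (pdMat k M x).transpose := rfl

lemma pdMat_congr (k : ι) (hS : IsOpen S) (hx : x ∈ S) (h : Set.EqOn M N S) :
    pdMat k M x = pdMat k N x := by
  ext i j
  exact pd_congr_on k hS hx fun y hy => by simp only [h hy]

lemma pdMat_comm (k l : ι) (hS : IsOpen S) (hx : x ∈ S) (hM : SmoothMatOn S M) :
    pdMat k (pdMat l M) x = pdMat l (pdMat k M) x := by
  ext i j
  exact pd_comm k l hS (hM i j) hx

end MatrixFields


/-! ### Riemannian geometry in matrix notation -/

section Riemannian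

variable {ι : Type} [Fintype ι] [DecidableEq ι]
variable {S : Set (EuclideanSpace ℝ ι)} {x : EuclideanSpace ℝ ι}

open Matrix

/-- A two-tensor as a field of matrices. -/
def tMat (h : TwoTensor ι) (x : EuclideanSpace ℝ ι) : Matrix ι ι ℝ := Matrix.of (h x)

lemma tMat_apply (h : TwoTensor ι) (x : EuclideanSpace ℝ ι) (i j : ι) :
    tMat h x i j = h x i j := rfl

/-- The connection matrix `(Γ_i)^a_j`. -/
def chMat (g : TwoTensor ι) (i : ι) (x : EuclideanSpace ℝ ι) : Matrix ι ι ℝ :=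
  Matrix.of fun a j => christoffel g a i j x

/-- The Christoffel symbols of the first kind, as a matrix. -/
def firstKind (g : TwoTensor ι) (i : ι) (x : EuclideanSpace ℝ ι) : Matrix ι ι ℝ :=
  Matrix.of fun l j => (1 / 2) *
    (pd i (fun y => g y j l) x + pd j (fun y => g y i l) x - pd l (fun y => g y i j) x)

/-- The curvature endomorphism `R(e_i, e_j)`. -/
def curvMat (g : TwoTensor ι) (i j : ι) (x : EuclideanSpace ℝ ι) : Matrix ι ι ℝ :=
  pdMat i (chMat g j) x - pdMat j (chMat g i) x + chMat g i x * chMat g j x -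
    chMat g j x * chMat g i x

/-- The covariant derivative of a two-tensor field, acting on fields of matrices. -/
def covMat (g : TwoTensor ι) (k : ι) (h : EuclideanSpace ℝ ι → Matrix ι ι ℝ)
    (x : EuclideanSpace ℝ ι) : Matrix ι ι ℝ :=
  pdMat k h x - (chMat g k x)ᵀ * h x - h x * chMat g k x

/-- A smooth, symmetric and nondegenerate two-tensor. -/
structure IsNondegenerateOn (S : Set (EuclideanSpace ℝ ι)) (g : TwoTensor ι) : Prop where
  smooth : SmoothMatOn S (tMat g)
  symm : ∀ x ∈ S, ∀ i j, g x i j = g x j i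
  det : ∀ x ∈ S, IsUnit (tMat g x).det

lemma christoffel_eq (g : TwoTensor ι) (a i j : ι) :
    christoffel g a i j x = chMat g i x a j := rfl

lemma chMat_eq (g : TwoTensor ι) (i : ι) :
    chMat g i x = (tMat g x)⁻¹ * firstKind g i x := by
  ext a j
  simp only [chMat, Matrix.of_apply, christoffel, Matrix.mul_apply, firstKind, Finset.mul_sum,
    invMetric, tMat]
  exact Finset.sum_congr rfl fun _ _ => by ring

lemma riemann_eq (g : TwoTensor ι) (i j k l : ι) :
    riemann g x i j k l = (tMat g x * curvMat g i j x) k l := by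
  simp only [riemann, Matrix.mul_apply, tMat_apply, curvMat, Matrix.add_apply, Matrix.sub_apply,
    pdMat_apply, Finset.sum_sub_distrib]
  exact Finset.sum_congr rfl fun m _ => by
    simp only [chMat, Matrix.of_apply]; ring

lemma covDeriv_eq (g h : TwoTensor ι) (k i j : ι) :
    covDeriv g h k i j x = covMat g k (tMat h) x i j := by
  simp only [covDeriv, covMat, Matrix.sub_apply, pdMat_apply, Matrix.mul_apply, tMat_apply,
    Matrix.transpose_apply, chMat, Matrix.of_apply, Finset.sum_add_distrib]
  have : ∑ p, christoffel g p k j x * h x i p = ∑ p, h x i p * christoffel g p k j x :=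
    Finset.sum_congr rfl fun _ _ => mul_comm _ _
  rw [this]; ring

lemma covDeriv2_eq (g h : TwoTensor ι) (l k i j : ι) :
    covDeriv2 g h l k i j x = (covMat g l (covMat g k (tMat h)) x -
      ∑ p, chMat g l x p k • covMat g p (tMat h) x) i j := by
  have e : ∀ a b c, covDeriv g h a b c = fun y => covMat g a (tMat h) y b c := fun a b c => by
    funext y; exact covDeriv_eq g h a b c
  have u : covMat g l (covMat g k (tMat h)) x = pdMat l (covMat g k (tMat h)) x -
    (chMat g l x)ᵀ * covMat g k (tMat h) x - covMat g k (tMat h) x * chMat g l x := rfl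
  simp only [covDeriv2, e]
  rw [u]
  simp only [Matrix.sub_apply, pdMat_apply, Matrix.mul_apply, Matrix.sum_apply, Matrix.smul_apply,
    Matrix.transpose_apply, Finset.sum_add_distrib, christoffel_eq, smul_eq_mul]
  have : ∑ p, chMat g l x p j * covMat g k (tMat h) x i p =
      ∑ p, covMat g k (tMat h) x i p * chMat g l x p j :=
    Finset.sum_congr rfl fun _ _ => mul_comm _ _
  rw [this]; ring

lemma tensorInner_eq (g a b : TwoTensor ι) :
    tensorInner g a b x =
      ((tMat a x)ᵀ * ((tMat g x)⁻¹ * tMat b x * ((tMat g x)⁻¹)ᵀ)).trace := by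
  simp only [tensorInner, Matrix.trace, Matrix.diag, Matrix.mul_apply, Matrix.transpose_apply,
    invMetric, Finset.mul_sum, Finset.sum_mul]
  rw [Finset.sum_comm]
  refine Finset.sum_congr rfl fun j _ => Finset.sum_congr rfl fun i _ => ?_
  rw [Finset.sum_comm]
  refine Finset.sum_congr rfl fun l _ => Finset.sum_congr rfl fun k _ => ?_
  simp only [tMat, Matrix.of_apply]; ring

namespace IsNondegenerateOn

variable {g : TwoTensor ι} (hg : IsNondegenerateOn S g) (hS : IsOpen S) (hx : x ∈ S)
include hg hx

lemma transpose_eq : (tMat g x)ᵀ = tMat g x := by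
  ext i j; exact hg.symm x hx j i

lemma inv_transpose : ((tMat g x)⁻¹)ᵀ = (tMat g x)⁻¹ := by
  rw [Matrix.transpose_nonsing_inv, hg.transpose_eq hx]

lemma mul_inv : tMat g x * (tMat g x)⁻¹ = 1 := Matrix.mul_nonsing_inv _ (hg.det x hx)

lemma inv_mul : (tMat g x)⁻¹ * tMat g x = 1 := Matrix.nonsing_inv_mul _ (hg.det x hx)

lemma mul_chMat (i : ι) : tMat g x * chMat g i x = firstKind g i x := by
  rw [chMat_eq, ← Matrix.mul_assoc, hg.mul_inv hx, Matrix.one_mul]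

include hS

lemma pd_symm (k i j : ι) : pd k (fun y => g y i j) x = pd k (fun y => g y j i) x :=
  pd_congr_on k hS hx fun y hy => hg.symm y hy i j

lemma chMat_symm (a i j : ι) : chMat g i x a j = chMat g j x a i := by
  have : ∀ l, firstKind g i x l j = firstKind g j x l i := fun l => by
    simp only [firstKind, Matrix.of_apply]
    rw [hg.pd_symm hS hx l i j]; ring
  rw [chMat_eq, chMat_eq, Matrix.mul_apply, Matrix.mul_apply]
  exact Finset.sum_congr rfl fun l _ => by rw [this]

/-- Metric compatibility of the Levi-Civita connection: after lowering an index, `Γᵀ g + g Γ`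
symmetrises the first-kind symbols, and two of their three terms cancel. -/
lemma pdMat_metric (k : ι) :
    pdMat k (tMat g) x = (chMat g k x)ᵀ * tMat g x + tMat g x * chMat g k x := by
  have h1 : (chMat g k x)ᵀ * tMat g x = (firstKind g k x)ᵀ := by
    rw [← hg.mul_chMat hx, Matrix.transpose_mul, hg.transpose_eq hx]
  rw [h1, hg.mul_chMat hx]
  ext i j
  simp only [firstKind, Matrix.add_apply, Matrix.transpose_apply, Matrix.of_apply, pdMat_apply,
    tMat]
  rw [hg.pd_symm hS hx k j i, hg.pd_symm hS hx j k i, hg.pd_symm hS hx i k j]; ring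

end IsNondegenerateOn

namespace IsNondegenerateOn

variable {g : TwoTensor ι} (hg : IsNondegenerateOn S g)
include hg

lemma smooth_det : ContDiffOn ℝ ∞ (fun x => (tMat g x).det) S := by
  simp only [Matrix.det_apply']
  exact ContDiffOn.sum fun σ _ => contDiffOn_const.mul
    (contDiffOn_prod fun i _ => hg.smooth (σ i) i)

lemma smooth_inv : SmoothMatOn S fun x => (tMat g x)⁻¹ := by
  intro i j
  have h1 : ContDiffOn ℝ ∞ (fun x => (tMat g x).adjugate i j) S := by
    simp only [Matrix.adjugate_apply, Matrix.det_apply']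
    refine ContDiffOn.sum fun σ _ => contDiffOn_const.mul (contDiffOn_prod fun k _ => ?_)
    simp only [Matrix.updateRow_apply]
    split_ifs
    · exact contDiffOn_const
    · exact hg.smooth _ _
  have h2 : ContDiffOn ℝ ∞ (fun x => ((tMat g x).det)⁻¹) S :=
    hg.smooth_det.inv fun x hx => (hg.det x hx).ne_zero
  refine (h2.mul h1).congr fun x _ => ?_
  simp [Matrix.inv_def]

variable (hS : IsOpen S)
include hS

lemma smooth_chMat (i : ι) : SmoothMatOn S (chMat g i) := by
  have h1 : SmoothMatOn S (firstKind g i) := fun l j =>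
    contDiffOn_const.mul (((contDiffOn_pd i hS (hg.smooth j l)).add
      (contDiffOn_pd j hS (hg.smooth i l))).sub (contDiffOn_pd l hS (hg.smooth i j)))
  have : chMat g i = fun x => (tMat g x)⁻¹ * firstKind g i x := by
    funext x; exact chMat_eq g i
  rw [this]
  exact hg.smooth_inv.mul h1

lemma smooth_covMat (k : ι) {h : EuclideanSpace ℝ ι → Matrix ι ι ℝ} (hh : SmoothMatOn S h) :
    SmoothMatOn S (covMat g k h) :=
  ((hh.pdMat hS k).sub ((hg.smooth_chMat hS k).transpose.mul hh)).sub
    (hh.mul (hg.smooth_chMat hS k))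

variable (hx : x ∈ S)
include hx

/-- Obtained by differentiating `g g⁻¹ = 1` and inserting metric compatibility, so that `Γ` replaces
all derivatives of `g`. -/
lemma pdMat_inv (k : ι) :
    pdMat k (fun y => (tMat g y)⁻¹) x =
      -(chMat g k x * (tMat g x)⁻¹) - (tMat g x)⁻¹ * (chMat g k x)ᵀ := by
  have h0 : pdMat k (fun y => tMat g y * (tMat g y)⁻¹) x = 0 := by
    rw [pdMat_congr k hS hx (N := fun _ => 1) fun y hy => hg.mul_inv hy]
    ext i j; exact pd_const _ _
  rw [pdMat_mul k hS hx hg.smooth hg.smooth_inv, hg.pdMat_metric hS hx] at h0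
  have h1 := congrArg ((tMat g x)⁻¹ * ·) h0
  simp only [Matrix.mul_zero, Matrix.mul_add, Matrix.add_mul, ← Matrix.mul_assoc, hg.inv_mul hx,
    Matrix.one_mul] at h1
  rw [Matrix.mul_assoc _ (tMat g x), hg.mul_inv hx, Matrix.mul_one] at h1
  rw [eq_sub_iff_add_eq, eq_neg_iff_add_eq_zero, ← h1]; abel

/-- Commuting `∂_i ∂_j g`, with each derivative of `g` rewritten through `Γ`, leaves exactly the
symmetric part of `g R(e_i, e_j)`, which must therefore vanish. -/
lemma curv_antisymm (i j : ι) :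
    (tMat g x * curvMat g i j x)ᵀ = -(tMat g x * curvMat g i j x) := by
  have hT := hg.transpose_eq hx
  have h2 : ∀ a b, pdMat a (pdMat b (tMat g)) x =
      (pdMat a (chMat g b) x)ᵀ * tMat g x + (chMat g b x)ᵀ * pdMat a (tMat g) x +
        (pdMat a (tMat g) x * chMat g b x + tMat g x * pdMat a (chMat g b) x) := by
    intro a b
    rw [pdMat_congr a hS hx (N := fun y => (chMat g b y)ᵀ * tMat g y + tMat g y * chMat g b y)
      fun y hy => hg.pdMat_metric hS hy b,
      pdMat_add a hS hx ((hg.smooth_chMat hS b).transpose.mul hg.smooth)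
        (hg.smooth.mul (hg.smooth_chMat hS b)),
      pdMat_mul a hS hx (hg.smooth_chMat hS b).transpose hg.smooth,
      pdMat_mul a hS hx hg.smooth (hg.smooth_chMat hS b), pdMat_transpose]
  have h3 := pdMat_comm i j hS hx hg.smooth
  rw [h2, h2, hg.pdMat_metric hS hx, hg.pdMat_metric hS hx] at h3
  rw [Matrix.transpose_mul, hT, curvMat]
  simp only [Matrix.transpose_add, Matrix.transpose_sub, Matrix.transpose_mul]
  have h4 := sub_eq_zero.2 h3
  rw [eq_neg_iff_add_eq_zero, ← h4]
  noncomm_ring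

lemma riemann_swap_right (i j k l : ι) : riemann g x i j k l = -riemann g x i j l k := by
  rw [riemann_eq, riemann_eq]
  have := congrFun (congrFun (hg.curv_antisymm hS hx i j) l) k
  simpa using this

omit hg hS hx in
lemma _root_.CalabiObstruction.curvMat_swap (i j : ι) : curvMat g i j x = -curvMat g j i x := by
  simp only [curvMat]; abel

omit hg hS hx in
lemma _root_.CalabiObstruction.riemann_swap_left (i j k l : ι) :
    riemann g x i j k l = -riemann g x j i k l := by
  rw [riemann_eq, riemann_eq, curvMat_swap]; simp

/-- The first Bianchi identity. Since `Γ` is symmetric in its lower indices, the derivative terms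
and the quadratic terms cancel separately in the cyclic sum. -/
lemma curvMat_bianchi (i j l m : ι) :
    curvMat g i j x m l + curvMat g j l x m i + curvMat g l i x m j = 0 := by
  have hs : ∀ a b c d, pdMat d (chMat g b) x a c = pdMat d (chMat g c) x a b := fun a b c d =>
    pd_congr_on d hS hx fun y hy => hg.chMat_symm hS hy a b c
  have hp : ∀ a b c, (chMat g a x * chMat g b x) m c = (chMat g a x * chMat g c x) m b := by
    intro a b c
    simp only [Matrix.mul_apply]
    exact Finset.sum_congr rfl fun p _ => by rw [hg.chMat_symm hS hx p b c]
  simp only [curvMat, Matrix.add_apply, Matrix.sub_apply]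
  rw [hs m j l i, hs m l i j, hs m i j l, hp i j l, hp j l i, hp l i j]; ring

lemma riemann_bianchi (i j k l : ι) :
    riemann g x i j k l + riemann g x j l k i + riemann g x l i k j = 0 := by
  simp only [riemann_eq, Matrix.mul_apply, ← Finset.sum_add_distrib, ← mul_add,
    hg.curvMat_bianchi hS hx, mul_zero, Finset.sum_const_zero]

/-- The classical octahedron argument: a combination of four Bianchi identities and the two
antisymmetries. -/
lemma riemann_pair (i j k l : ι) : riemann g x i j k l = riemann g x k l i j := by
  have a1 := hg.riemann_bianchi hS hx i j k l
  have a2 := hg.riemann_bianchi hS hx j k l i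
  have a3 := hg.riemann_bianchi hS hx k l i j
  have a4 := hg.riemann_bianchi hS hx l i j k
  have s1 := hg.riemann_swap_right hS hx
  have s2 := fun i j k l => riemann_swap_left (g := g) (x := x) i j k l
  linarith [s1 i j k l, s1 j l k i, s1 l i k j, s1 j k l i, s1 k i l j, s1 i j l k, s1 k l i j,
    s1 l j i k, s1 j k i l, s1 l i j k, s1 i k j l, s1 k l j i, s2 i j k l, s2 j l k i, s2 l i k j,
    s2 j k l i, s2 k i l j, s2 k l i j, s2 l j i k, s2 i k j l, s2 i k l j, s2 j l i k]

/-- The Ricci identity. -/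
lemma covMat_comm {h : EuclideanSpace ℝ ι → Matrix ι ι ℝ} (hh : SmoothMatOn S h) (k l : ι) :
    covMat g l (covMat g k h) x - covMat g k (covMat g l h) x =
      -((curvMat g l k x)ᵀ * h x) - h x * curvMat g l k x := by
  have e : ∀ a b, pdMat a (covMat g b h) x = pdMat a (pdMat b h) x -
      ((pdMat a (chMat g b) x)ᵀ * h x + (chMat g b x)ᵀ * pdMat a h x) -
      (pdMat a h x * chMat g b x + h x * pdMat a (chMat g b) x) := by
    intro a b
    have hΓ := hg.smooth_chMat hS b
    unfold covMat
    rw [pdMat_sub a hS hx ((hh.pdMat hS b).sub (hΓ.transpose.mul hh)) (hh.mul hΓ),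
      pdMat_sub a hS hx (hh.pdMat hS b) (hΓ.transpose.mul hh),
      pdMat_mul a hS hx hΓ.transpose hh, pdMat_mul a hS hx hh hΓ, pdMat_transpose]
  have u : ∀ a b, covMat g a (covMat g b h) x = pdMat a (covMat g b h) x -
    (chMat g a x)ᵀ * (pdMat b h x - (chMat g b x)ᵀ * h x - h x * chMat g b x) -
    (pdMat b h x - (chMat g b x)ᵀ * h x - h x * chMat g b x) * chMat g a x := fun a b => rfl
  rw [u, u, e, e, pdMat_comm l k hS hx hh, curvMat]
  simp only [Matrix.transpose_add, Matrix.transpose_sub, Matrix.transpose_mul]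
  noncomm_ring

end IsNondegenerateOn

end Riemannian


/-! ### Green's formula for two-tensors -/

section Green

variable {ι : Type} [Fintype ι] [DecidableEq ι]
variable {S : Set (EuclideanSpace ℝ ι)} {x : EuclideanSpace ℝ ι}

open Matrix

/-- The two-tensor `M` with both indices raised. -/
def raise (g : TwoTensor ι) (x : EuclideanSpace ℝ ι) (M : Matrix ι ι ℝ) : Matrix ι ι ℝ :=
  (tMat g x)⁻¹ * M * ((tMat g x)⁻¹)ᵀ

/-- The inner product of two-tensors at a point. -/
def matInner (g : TwoTensor ι) (x : EuclideanSpace ℝ ι) (M N : Matrix ι ι ℝ) : ℝ :=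
  (Mᵀ * raise g x N).trace

lemma tensorInner_eq_matInner (g a b : TwoTensor ι) :
    tensorInner g a b x = matInner g x (tMat a x) (tMat b x) := tensorInner_eq g a b

lemma matInner_eq_sum (g : TwoTensor ι) (M N : Matrix ι ι ℝ) :
    matInner g x M N = ∑ i, ∑ j, M i j * raise g x N i j := by
  simp only [matInner, Matrix.trace, Matrix.diag, Matrix.mul_apply, Matrix.transpose_apply]
  exact Finset.sum_comm

lemma matInner_sum_left {κ : Type*} (g : TwoTensor ι) (u : Finset κ) (M : κ → Matrix ι ι ℝ)
    (N : Matrix ι ι ℝ) : matInner g x (∑ k ∈ u, M k) N = ∑ k ∈ u, matInner g x (M k) N := by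
  simp only [matInner, Matrix.transpose_sum, Matrix.sum_mul, Matrix.trace_sum]

lemma matInner_sub_left (g : TwoTensor ι) (M M' N : Matrix ι ι ℝ) :
    matInner g x (M - M') N = matInner g x M N - matInner g x M' N := by
  simp only [matInner, Matrix.transpose_sub, Matrix.sub_mul, Matrix.trace_sub]

lemma matInner_add_left (g : TwoTensor ι) (M M' N : Matrix ι ι ℝ) :
    matInner g x (M + M') N = matInner g x M N + matInner g x M' N := by
  simp only [matInner, Matrix.transpose_add, Matrix.add_mul, Matrix.trace_add]

lemma matInner_smul_left (g : TwoTensor ι) (c : ℝ) (M N : Matrix ι ι ℝ) :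
    matInner g x (c • M) N = c * matInner g x M N := by
  simp only [matInner, Matrix.transpose_smul, Matrix.smul_mul, Matrix.trace_smul, smul_eq_mul]

lemma curvAction_eq (g h : TwoTensor ι) (i j : ι) :
    curvAction g h x i j = ∑ k, ∑ l, riemann g x i k j l * raise g x (tMat h x) k l := by
  simp only [curvAction, raise, Matrix.mul_apply, Matrix.transpose_apply, Finset.sum_mul,
    Finset.mul_sum]
  refine Finset.sum_congr rfl fun k _ => Finset.sum_congr rfl fun l _ => ?_
  rw [Finset.sum_comm]
  refine Finset.sum_congr rfl fun q _ => Finset.sum_congr rfl fun p _ => ?_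
  simp only [invMetric, tMat, Matrix.of_apply]; ring

lemma tMat_roughLaplacian (g h : TwoTensor ι) :
    tMat (roughLaplacian g h) x = ∑ l, ∑ k, (tMat g x)⁻¹ l k •
      (covMat g l (covMat g k (tMat h)) x - ∑ p, chMat g l x p k • covMat g p (tMat h) x) := by
  ext i j
  simp only [tMat_apply, roughLaplacian, covDeriv2_eq, Matrix.sum_apply, Matrix.smul_apply,
    smul_eq_mul]
  rfl

/-- The vector field `g^{ij} (⟨∇_j h, o⟩ - ⟨h, ∇_j o⟩)`. -/
def greenField (g h o : TwoTensor ι) (i : ι) (x : EuclideanSpace ℝ ι) : ℝ :=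
  ∑ j, (tMat g x)⁻¹ i j * (matInner g x (covMat g j (tMat h) x) (tMat o x) -
    matInner g x (covMat g j (tMat o) x) (tMat h x))

namespace IsNondegenerateOn

variable {g : TwoTensor ι} (hg : IsNondegenerateOn S g) (hS : IsOpen S)
include hg

lemma matInner_comm (hx : x ∈ S) (M N : Matrix ι ι ℝ) :
    matInner g x M N = matInner g x N M := by
  simp only [matInner, raise, hg.inv_transpose hx]
  rw [← Matrix.trace_transpose]
  simp only [Matrix.transpose_mul, Matrix.transpose_transpose, hg.inv_transpose hx]
  rw [Matrix.trace_mul_comm ((tMat g x)⁻¹ * _)]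
  simp only [Matrix.mul_assoc]
  rw [Matrix.trace_mul_comm]
  simp only [Matrix.mul_assoc]
  rw [Matrix.trace_mul_comm]
  simp only [Matrix.mul_assoc]

lemma smooth_raise {M : EuclideanSpace ℝ ι → Matrix ι ι ℝ} (hM : SmoothMatOn S M) :
    SmoothMatOn S fun y => raise g y (M y) :=
  (hg.smooth_inv.mul hM).mul hg.smooth_inv.transpose

lemma smooth_matInner {M N : EuclideanSpace ℝ ι → Matrix ι ι ℝ} (hM : SmoothMatOn S M)
    (hN : SmoothMatOn S N) : ContDiffOn ℝ ∞ (fun y => matInner g y (M y) (N y)) S := by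
  simp only [matInner_eq_sum]
  exact ContDiffOn.sum fun i _ => ContDiffOn.sum fun j _ =>
    (hM i j).mul (hg.smooth_raise hN i j)

include hS

lemma smooth_greenField {h o : TwoTensor ι} (hh : SmoothMatOn S (tMat h))
    (ho : SmoothMatOn S (tMat o)) (i : ι) : ContDiffOn ℝ ∞ (greenField g h o i) S :=
  ContDiffOn.sum fun j _ => (hg.smooth_inv i j).mul
    ((hg.smooth_matInner (hg.smooth_covMat hS j hh) ho).sub
      (hg.smooth_matInner (hg.smooth_covMat hS j ho) hh))

variable (hx : x ∈ S)
include hx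

/-- Metric compatibility. -/
lemma pd_matInner {M N : EuclideanSpace ℝ ι → Matrix ι ι ℝ} (hM : SmoothMatOn S M)
    (hN : SmoothMatOn S N) (k : ι) :
    pd k (fun y => matInner g y (M y) (N y)) x =
      matInner g x (covMat g k M x) (N x) + matInner g x (covMat g k N x) (M x) := by
  have hI := hg.smooth_inv
  have e : pd k (fun y => matInner g y (M y) (N y)) x =
      (pdMat k (fun y => (M y)ᵀ * ((tMat g y)⁻¹ * N y * ((tMat g y)⁻¹)ᵀ)) x).trace := by
    have hs := hM.transpose.mul ((hI.mul hN).mul hI.transpose)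
    simp only [matInner, raise, Matrix.trace, Matrix.diag, pdMat_apply]
    exact pd_sum k _ fun i _ => diffAt_of_contDiffOn hS (hs i i) hx
  rw [e, pdMat_mul k hS hx hM.transpose ((hI.mul hN).mul hI.transpose),
    pdMat_mul k hS hx (hI.mul hN) hI.transpose, pdMat_mul k hS hx hI hN, pdMat_transpose,
    pdMat_transpose, hg.pdMat_inv hS hx, hg.matInner_comm hx _ (M x)]
  simp only [matInner, raise, covMat, Matrix.transpose_sub, Matrix.transpose_neg,
    Matrix.transpose_mul, Matrix.transpose_transpose, hg.inv_transpose hx]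
  have hc : ((M x)ᵀ * ((tMat g x)⁻¹ * N x * ((tMat g x)⁻¹ * (chMat g k x)ᵀ))).trace =
      ((chMat g k x)ᵀ * (M x)ᵀ * ((tMat g x)⁻¹ * N x * (tMat g x)⁻¹)).trace := by
    rw [Matrix.mul_assoc (chMat g k x)ᵀ, Matrix.trace_mul_comm (chMat g k x)ᵀ]
    simp only [Matrix.mul_assoc]
  rw [← Matrix.trace_add, ← sub_eq_zero, ← Matrix.trace_sub]
  have hc' := sub_eq_zero.2 hc
  rw [← Matrix.trace_sub] at hc'
  rw [← neg_eq_zero, ← hc', ← Matrix.trace_neg]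
  congr 1
  noncomm_ring

/-- Swapping both antisymmetric pairs gives `R_{ikjl} = R_{kilj}`. This exchanges the indices
contracted with `h` and those contracted with `o`. -/
lemma curvAction_selfAdjoint (h o : TwoTensor ι) :
    tensorInner g (curvAction g h) o x = tensorInner g (curvAction g o) h x := by
  simp only [tensorInner_eq_matInner, matInner_eq_sum, tMat_apply, curvAction_eq, Finset.sum_mul]
  have h1 : ∀ i j k l, riemann g x i k j l = riemann g x k i l j := fun i j k l => by
    rw [riemann_swap_left, hg.riemann_swap_right hS hx, neg_neg]
  calc _ = ∑ i, ∑ k, ∑ j, ∑ l, riemann g x i k j l * raise g x (tMat h x) k l *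
        raise g x (tMat o x) i j := Finset.sum_congr rfl fun i _ => Finset.sum_comm
    _ = ∑ k, ∑ i, ∑ j, ∑ l, riemann g x i k j l * raise g x (tMat h x) k l *
        raise g x (tMat o x) i j := Finset.sum_comm
    _ = ∑ k, ∑ i, ∑ l, ∑ j, riemann g x i k j l * raise g x (tMat h x) k l *
        raise g x (tMat o x) i j :=
      Finset.sum_congr rfl fun k _ => Finset.sum_congr rfl fun i _ => Finset.sum_comm
    _ = ∑ k, ∑ l, ∑ i, ∑ j, riemann g x i k j l * raise g x (tMat h x) k l *
        raise g x (tMat o x) i j := Finset.sum_congr rfl fun k _ => Finset.sum_comm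
    _ = _ := by
      refine Finset.sum_congr rfl fun k _ => Finset.sum_congr rfl fun l _ =>
        Finset.sum_congr rfl fun i _ => Finset.sum_congr rfl fun j _ => ?_
      rw [h1]; ring

/-- If the volume density is constant, the divergence of the Green field is
`⟨Δh, o⟩ - ⟨h, Δo⟩`. -/
lemma div_greenField {h o : TwoTensor ι} (hh : SmoothMatOn S (tMat h))
    (ho : SmoothMatOn S (tMat o)) (htr : ∀ j, ∑ i, chMat g i x i j = 0) :
    ∑ i, pd i (greenField g h o i) x =
      tensorInner g (roughLaplacian g h) o x - tensorInner g (roughLaplacian g o) h x := by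
  set w : ι → EuclideanSpace ℝ ι → ℝ := fun j y =>
    matInner g y (covMat g j (tMat h) y) (tMat o y) -
      matInner g y (covMat g j (tMat o) y) (tMat h y) with hw
  have hDh := fun j => hg.smooth_covMat hS j hh
  have hDo := fun j => hg.smooth_covMat hS j ho
  have sw : ∀ j, ContDiffOn ℝ ∞ (w j) S := fun j =>
    (hg.smooth_matInner (hDh j) ho).sub (hg.smooth_matInner (hDo j) hh)
  set I := (tMat g x)⁻¹ with hI
  have hIs : ∀ i j, I i j = I j i := fun i j => congrFun (congrFun (hg.inv_transpose hx) j) i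
  set P : ι → ι → ℝ := fun i j => matInner g x (covMat g i (covMat g j (tMat h)) x) (tMat o x) -
    matInner g x (covMat g i (covMat g j (tMat o)) x) (tMat h x) with hP
  set X : ι → ι → ℝ := fun i j =>
    matInner g x (covMat g i (tMat h) x) (covMat g j (tMat o) x) with hX
  -- `P` collects the second derivatives. `X` collects the products of first derivatives, which
  -- appear antisymmetrised.
  have dw : ∀ i j, pd i (w j) x = P i j + (X j i - X i j) := by
    intro i j
    rw [pd_sub i (diffAt_of_contDiffOn hS (hg.smooth_matInner (hDh j) ho) hx)
      (diffAt_of_contDiffOn hS (hg.smooth_matInner (hDo j) hh) hx),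
      hg.pd_matInner hS hx (hDh j) ho, hg.pd_matInner hS hx (hDo j) hh,
      hg.matInner_comm hx (covMat g i (tMat o) x)]
    simp only [hP, hX]; ring
  have dI : ∀ i j, pd i (fun y => (tMat g y)⁻¹ i j) x =
      -(∑ p, chMat g i x i p * I p j) - ∑ p, I i p * chMat g i x j p := by
    intro i j
    have := congrFun (congrFun (hg.pdMat_inv hS hx i) i) j
    simpa [pdMat_apply, Matrix.mul_apply] using this
  have L : ∑ i, pd i (greenField g h o i) x =
      ∑ i, ∑ j, ((-(∑ p, chMat g i x i p * I p j) - ∑ p, I i p * chMat g i x j p) * w j x +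
        I i j * (P i j + (X j i - X i j))) := by
    refine Finset.sum_congr rfl fun i _ => ?_
    unfold greenField
    rw [pd_sum i _ fun j _ => (diffAt_of_contDiffOn hS (hg.smooth_inv i j) hx).fun_mul
      (diffAt_of_contDiffOn hS (sw j) hx)]
    refine Finset.sum_congr rfl fun j _ => ?_
    rw [pd_mul i (diffAt_of_contDiffOn hS (hg.smooth_inv i j) hx)
      (diffAt_of_contDiffOn hS (sw j) hx), dI, ← dw]
  -- The contracted symbols `Γ^i_{ip}` are the logarithmic derivatives of the volume density. This
  -- is the only place where its constancy enters.
  have t1 : ∑ i, ∑ j, (∑ p, chMat g i x i p * I p j) * w j x = 0 := by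
    simp only [Finset.sum_mul]
    rw [Finset.sum_comm]
    refine Finset.sum_eq_zero fun j _ => ?_
    rw [Finset.sum_comm]
    refine Finset.sum_eq_zero fun p _ => ?_
    simp only [mul_assoc]
    rw [← Finset.sum_mul, htr, zero_mul]
  have t2 : ∑ i, ∑ j, I i j * (X j i - X i j) = 0 := by
    simp only [mul_sub, Finset.sum_sub_distrib]
    rw [sub_eq_zero, Finset.sum_comm]
    exact Finset.sum_congr rfl fun i _ => Finset.sum_congr rfl fun j _ => by rw [hIs]
  -- The remaining derivative of `g⁻¹` is the Christoffel correction on the differentiation index in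
  -- `∇_i ∇_j`.
  have t3 : ∑ i, ∑ j, (∑ p, I i p * chMat g i x j p) * w j x =
      ∑ i, ∑ j, I i j * ∑ p, chMat g i x p j * w p x := by
    simp only [Finset.sum_mul, Finset.mul_sum, mul_assoc]
    exact Finset.sum_congr rfl fun i _ => Finset.sum_comm
  have R : tensorInner g (roughLaplacian g h) o x - tensorInner g (roughLaplacian g o) h x =
      ∑ i, ∑ j, I i j * (P i j - ∑ p, chMat g i x p j * w p x) := by
    simp only [tensorInner_eq_matInner, tMat_roughLaplacian, matInner_sum_left,
      matInner_smul_left, matInner_sub_left, ← Finset.sum_sub_distrib]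
    refine Finset.sum_congr rfl fun i _ => Finset.sum_congr rfl fun j _ => ?_
    simp only [hw, hP, mul_sub, Finset.sum_sub_distrib, hI]; ring
  rw [L, R]
  simp only [mul_add, mul_sub, sub_mul, neg_mul, Finset.sum_add_distrib, Finset.sum_sub_distrib,
    Finset.sum_neg_distrib] at t1 t2 t3 ⊢
  linarith

end IsNondegenerateOn

end Green


/-! ### The variation of a Ricci-flat metric by dilations

The Euler field `E = x^k ∂_k` acts on the components of a metric `g`. If `g` is Ricci flat and
`E g = 2 o` with `o` trace free and divergence free, then `P_g o = 0`. -/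

section Dilation

variable {ι : Type} [Fintype ι] [DecidableEq ι]
variable {S : Set (EuclideanSpace ℝ ι)} {x : EuclideanSpace ℝ ι}

open Matrix

/-- The Euler derivative `x^k ∂_k f`. -/
def eul (f : EuclideanSpace ℝ ι → ℝ) (x : EuclideanSpace ℝ ι) : ℝ := ∑ k, x k * pd k f x

/-- The entrywise Euler derivative. -/
def eulMat (M : EuclideanSpace ℝ ι → Matrix ι ι ℝ) (x : EuclideanSpace ℝ ι) : Matrix ι ι ℝ :=
  ∑ k, x k • pdMat k M x

lemma eulMat_apply (M : EuclideanSpace ℝ ι → Matrix ι ι ℝ) (i j : ι) :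
    eulMat M x i j = eul (fun y => M y i j) x := by
  simp [eulMat, eul, Matrix.sum_apply, pdMat_apply]

/-- The commutator `[∂_i, E] = ∂_i`. Each derivative lowers the homogeneity by one, which produces
the extra terms `-Γ` and `-2 R` in the variation formulas. -/
lemma pd_eul (hS : IsOpen S) (hx : x ∈ S) {f : EuclideanSpace ℝ ι → ℝ}
    (hf : ContDiffOn ℝ ∞ f S) (i : ι) : pd i (eul f) x = pd i f x + eul (pd i f) x := by
  have hd : ∀ k, DifferentiableAt ℝ (pd k f) x := fun k =>
    diffAt_of_contDiffOn hS (contDiffOn_pd k hS hf) hx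
  unfold eul
  rw [pd_sum i _ fun k _ => (differentiable_coord k x).fun_mul (hd k)]
  simp only [pd_mul i (differentiable_coord _ x) (hd _), pd_coord, Finset.sum_add_distrib,
    sum_kron_mul]
  simp only [pd_comm i _ hS hf hx]

variable {M N : EuclideanSpace ℝ ι → Matrix ι ι ℝ}

lemma eulMat_mul (hS : IsOpen S) (hx : x ∈ S) (hM : SmoothMatOn S M) (hN : SmoothMatOn S N) :
    eulMat (fun y => M y * N y) x = eulMat M x * N x + M x * eulMat N x := by
  simp only [eulMat, pdMat_mul _ hS hx hM hN, smul_add, Finset.sum_add_distrib, Matrix.sum_mul,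
    Matrix.mul_sum, Matrix.smul_mul, Matrix.mul_smul]

lemma eulMat_congr (hS : IsOpen S) (hx : x ∈ S) (h : Set.EqOn M N S) :
    eulMat M x = eulMat N x := by
  simp only [eulMat, pdMat_congr _ hS hx h]

lemma eulMat_add (hS : IsOpen S) (hx : x ∈ S) (hM : SmoothMatOn S M) (hN : SmoothMatOn S N) :
    eulMat (fun y => M y + N y) x = eulMat M x + eulMat N x := by
  simp only [eulMat, pdMat_add _ hS hx hM hN, smul_add, Finset.sum_add_distrib]

lemma eulMat_sub (hS : IsOpen S) (hx : x ∈ S) (hM : SmoothMatOn S M) (hN : SmoothMatOn S N) :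
    eulMat (fun y => M y - N y) x = eulMat M x - eulMat N x := by
  simp only [eulMat, pdMat_sub _ hS hx hM hN, smul_sub, Finset.sum_sub_distrib]

lemma eulMat_pdMat (hS : IsOpen S) (hx : x ∈ S) (hM : SmoothMatOn S M) (k : ι) :
    eulMat (pdMat k M) x = pdMat k (eulMat M) x - pdMat k M x := by
  ext i j
  rw [Matrix.sub_apply, eulMat_apply, pdMat_apply, pdMat_apply]
  have : (fun y => eulMat M y i j) = eul fun y => M y i j := by
    funext y; exact eulMat_apply M i j
  rw [this, pd_eul hS hx (hM i j)]
  simp only [pdMat_apply]; ring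

/-- The Ricci tensor as a trace of curvature endomorphisms, free of the metric. In this form it can
be varied without differentiating `g⁻¹`. -/
lemma ricci_eq {g : TwoTensor ι} (hg : IsNondegenerateOn S g) (hS : IsOpen S) (hx : x ∈ S)
    (i j : ι) : ricci g x i j = ∑ k, curvMat g k i x k j := by
  have h : ∀ k l, riemann g x i k j l = (tMat g x * curvMat g k i x) l j := fun k l => by
    rw [hg.riemann_swap_right hS hx, ← riemann_swap_left, riemann_eq]
  simp only [ricci, h]
  refine Finset.sum_congr rfl fun k _ => ?_
  have := Matrix.mul_apply (M := (tMat g x)⁻¹) (N := tMat g x * curvMat g k i x) (i := k) (k := j)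
  rw [← Matrix.mul_assoc, hg.inv_mul hx, Matrix.one_mul] at this
  exact this.symm

/-- The second covariant derivative `∇_k ∇_a h`, as a matrix. -/
def cov2Mat (g : TwoTensor ι) (k a : ι) (h : EuclideanSpace ℝ ι → Matrix ι ι ℝ)
    (x : EuclideanSpace ℝ ι) : Matrix ι ι ℝ :=
  covMat g k (covMat g a h) x - ∑ p, chMat g k x p a • covMat g p h x

/-- The variation of the Christoffel symbols of the first kind. -/
def varFirst (g o : TwoTensor ι) (i : ι) (x : EuclideanSpace ℝ ι) : Matrix ι ι ℝ :=
  Matrix.of fun l j => covMat g i (tMat o) x j l + covMat g j (tMat o) x i l -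
    covMat g l (tMat o) x i j

/-- The variation of the Christoffel symbols. -/
def varCh (g o : TwoTensor ι) (i : ι) (x : EuclideanSpace ℝ ι) : Matrix ι ι ℝ :=
  (tMat g x)⁻¹ * varFirst g o i x

lemma cov2Mat_apply (g h : TwoTensor ι) (k a i j : ι) :
    cov2Mat g k a (tMat h) x i j = pd k (fun y => covMat g a (tMat h) y i j) x -
      ∑ p, chMat g k x p i * covMat g a (tMat h) x p j -
      ∑ p, covMat g a (tMat h) x i p * chMat g k x p j -
      ∑ p, chMat g k x p a * covMat g p (tMat h) x i j := by
  have u : covMat g k (covMat g a (tMat h)) x = pdMat k (covMat g a (tMat h)) x -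
    (chMat g k x)ᵀ * covMat g a (tMat h) x - covMat g a (tMat h) x * chMat g k x := rfl
  rw [cov2Mat, u]
  simp only [Matrix.sub_apply, Matrix.mul_apply, Matrix.sum_apply, Matrix.smul_apply,
    Matrix.transpose_apply, pdMat_apply, smul_eq_mul]

section

variable {g o : TwoTensor ι} (hg : IsNondegenerateOn S g) (hS : IsOpen S)
  (ho : SmoothMatOn S (tMat o)) (hos : ∀ y ∈ S, ∀ i j, o y i j = o y j i)
include hg hS ho

lemma smooth_varFirst (i : ι) : SmoothMatOn S (varFirst g o i) := fun l j =>
  ((hg.smooth_covMat hS i ho j l).add (hg.smooth_covMat hS j ho i l)).sub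
    (hg.smooth_covMat hS l ho i j)

lemma smooth_varCh (i : ι) : SmoothMatOn S (varCh g o i) :=
  hg.smooth_inv.mul (smooth_varFirst hg hS ho i)

include hos

lemma covMat_symm (hx : x ∈ S) (k i j : ι) :
    covMat g k (tMat o) x i j = covMat g k (tMat o) x j i := by
  have hT : (tMat o x)ᵀ = tMat o x := by ext a b; exact hos x hx b a
  have hp : (pdMat k (tMat o) x)ᵀ = pdMat k (tMat o) x := by
    ext a b
    exact pd_congr_on k hS hx fun y hy => hos y hy b a
  have : (covMat g k (tMat o) x)ᵀ = covMat g k (tMat o) x := by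
    simp only [covMat, Matrix.transpose_sub, Matrix.transpose_mul, Matrix.transpose_transpose, hT,
      hp]
    abel
  exact congrFun (congrFun this j) i

variable (hE : ∀ y ∈ S, ∀ i j, eul (fun z => g z i j) y = 2 * o y i j)
include hE

/-- Applying `E` to `g Γ = [first kind]` varies the symbols by the tensor `varCh`. As the metric
varies by `2 o`, the usual factor `½` in that tensor is absorbed. The term `-Γ` comes from the
commutator of `E` with one coordinate derivative. -/
lemma eulMat_chMat (hx : x ∈ S) (i : ι) :
    eulMat (chMat g i) x = varCh g o i x - chMat g i x := by
  have hΓ := hg.smooth_chMat hS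
  have sf : SmoothMatOn S (fun y => tMat g y * chMat g i y) := hg.smooth.mul (hΓ i)
  have e1 : eulMat (firstKind g i) x =
      eulMat (tMat g) x * chMat g i x + tMat g x * eulMat (chMat g i) x := by
    rw [← eulMat_mul hS hx hg.smooth (hΓ i)]
    exact eulMat_congr hS hx fun y hy => (hg.mul_chMat hy i).symm
  have e2 : eulMat (tMat g) x = (2 : ℝ) • tMat o x := by
    ext a b
    rw [eulMat_apply]; exact hE x hx a b
  have e3 : ∀ a b c, eul (pd a fun y => g y b c) x =
      2 * pd a (fun y => o y b c) x - pd a (fun y => g y b c) x := by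
    intro a b c
    have h1 := pd_eul hS hx (hg.smooth b c) a
    have h2 : pd a (eul fun y => g y b c) x = 2 * pd a (fun y => o y b c) x := by
      have hob : ContDiffOn ℝ ∞ (fun y => o y b c) S := ho b c
      rw [← pd_const_mul a 2 (diffAt_of_contDiffOn hS hob hx)]
      exact pd_congr_on a hS hx fun y hy => hE y hy b c
    have h3 : pd a (eul fun y => g y b c) x =
      pd a (fun y => g y b c) x + eul (pd a fun y => g y b c) x := h1
    linarith
  have e4 : eulMat (firstKind g i) x =
      varFirst g o i x + (2 : ℝ) • (tMat o x * chMat g i x) - firstKind g i x := by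
    ext l j
    have d : ∀ a b c, DifferentiableAt ℝ (pd a fun y => g y b c) x := fun a b c =>
      diffAt_of_contDiffOn hS (contDiffOn_pd a hS (hg.smooth b c)) hx
    have h1 : eulMat (firstKind g i) x l j = (1 / 2) * (eul (pd i fun y => g y j l) x +
        eul (pd j fun y => g y i l) x - eul (pd l fun y => g y i j) x) := by
      rw [eulMat_apply]
      simp only [eul, firstKind, Matrix.of_apply]
      rw [← Finset.sum_add_distrib, ← Finset.sum_sub_distrib, Finset.mul_sum]
      refine Finset.sum_congr rfl fun k _ => ?_
      rw [pd_const_mul k _ (((d i j l).fun_add (d j i l)).fun_sub (d l i j)),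
        pd_sub k ((d i j l).fun_add (d j i l)) (d l i j), pd_add k (d i j l) (d j i l)]
      ring
    rw [h1, e3, e3, e3]
    simp only [Matrix.sub_apply, Matrix.add_apply, Matrix.smul_apply, smul_eq_mul, varFirst,
      Matrix.of_apply, covMat, pdMat_apply, firstKind, Matrix.mul_apply, Matrix.transpose_apply,
      tMat_apply]
    have c1 : ∑ p, o x j p * chMat g i x p l = ∑ p, chMat g l x p i * o x p j :=
      Finset.sum_congr rfl fun p _ => by
        rw [hos x hx j p, hg.chMat_symm hS hx p i l]; ring
    have c2 : ∑ p, o x i p * chMat g j x p l = ∑ p, o x i p * chMat g l x p j :=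
      Finset.sum_congr rfl fun p _ => by rw [hg.chMat_symm hS hx p j l]
    have c3 : ∑ p, chMat g j x p i * o x p l = ∑ p, chMat g i x p j * o x p l :=
      Finset.sum_congr rfl fun p _ => by rw [hg.chMat_symm hS hx p j i]
    have c4 : ∑ p, o x l p * chMat g i x p j = ∑ p, chMat g i x p j * o x p l :=
      Finset.sum_congr rfl fun p _ => by rw [hos x hx l p]; ring
    rw [c1, c2, c3, c4]; ring
  have e5 : tMat g x * eulMat (chMat g i) x = varFirst g o i x - firstKind g i x := by
    rw [e2, e4, Matrix.smul_mul] at e1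
    rw [eq_sub_iff_add_eq, ← sub_eq_zero] at *
    rw [← neg_eq_zero, ← e1]; abel
  have e6 := congrArg ((tMat g x)⁻¹ * ·) e5
  simp only [← Matrix.mul_assoc, hg.inv_mul hx, Matrix.one_mul, Matrix.mul_sub] at e6
  rw [e6, ← chMat_eq]; rfl

/-- The variation of curvature is the antisymmetrised covariant derivative of the variation of the
connection. The curvature has weight two under dilation, hence the term `-2 R`. -/
lemma eulMat_curvMat (hx : x ∈ S) (k i : ι) :
    eulMat (curvMat g k i) x = -(2 : ℝ) • curvMat g k i x +
      (pdMat k (varCh g o i) x + chMat g k x * varCh g o i x - varCh g o i x * chMat g k x) -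
      (pdMat i (varCh g o k) x + chMat g i x * varCh g o k x - varCh g o k x * chMat g i x) := by
  have hΓ := hg.smooth_chMat hS
  have hC := smooth_varCh hg hS ho
  have hp : ∀ a b, eulMat (pdMat a (chMat g b)) x =
      pdMat a (varCh g o b) x - (2 : ℝ) • pdMat a (chMat g b) x := by
    intro a b
    rw [eulMat_pdMat hS hx (hΓ b), pdMat_congr a hS hx
      (N := fun y => varCh g o b y - chMat g b y) fun y hy =>
        eulMat_chMat hg hS ho hos hE hy b, pdMat_sub a hS hx (hC b) (hΓ b), two_smul]
    abel
  have e : eulMat (curvMat g k i) x = eulMat (pdMat k (chMat g i)) x -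
      eulMat (pdMat i (chMat g k)) x + (eulMat (chMat g k) x * chMat g i x +
      chMat g k x * eulMat (chMat g i) x) - (eulMat (chMat g i) x * chMat g k x +
      chMat g i x * eulMat (chMat g k) x) := by
    have s1 := (hΓ i).pdMat hS k
    have s2 := (hΓ k).pdMat hS i
    have s3 := (hΓ k).mul (hΓ i)
    have s4 := (hΓ i).mul (hΓ k)
    unfold curvMat
    rw [eulMat_sub hS hx ((s1.sub s2).add s3) s4, eulMat_add hS hx (s1.sub s2) s3,
      eulMat_sub hS hx s1 s2, eulMat_mul hS hx (hΓ k) (hΓ i), eulMat_mul hS hx (hΓ i) (hΓ k)]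
  rw [e, hp, hp, eulMat_chMat hg hS ho hos hE hx, eulMat_chMat hg hS ho hos hE hx, curvMat,
    neg_smul, two_smul, two_smul, two_smul]
  noncomm_ring

variable (hRic : ∀ y ∈ S, ∀ i j, ricci g y i j = 0)
  (htr : ∀ y ∈ S, ((tMat g y)⁻¹ * tMat o y).trace = 0)

include htr in
omit hE in
-- This contraction is the derivative of `tr_g o`: two of the three terms cancel because `∇o` is
-- symmetric in the tensor indices.
lemma trace_varCh (hx : x ∈ S) (j : ι) : ∑ k, varCh g o k x k j = 0 := by
  have h1 : pd j (fun y => ((tMat g y)⁻¹ * tMat o y).trace) x = 0 := by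
    rw [pd_congr_on j hS hx (g := fun _ => 0) fun y hy => htr y hy, pd_const]
  have h2 : ((tMat g x)⁻¹ * covMat g j (tMat o) x).trace = 0 := by
    have : pd j (fun y => ((tMat g y)⁻¹ * tMat o y).trace) x =
        (pdMat j (fun y => (tMat g y)⁻¹ * tMat o y) x).trace := by
      simp only [Matrix.trace, Matrix.diag, pdMat_apply]
      exact pd_sum j _ fun i _ => diffAt_of_contDiffOn hS (hg.smooth_inv.mul ho i i) hx
    rw [← h1, this, pdMat_mul j hS hx hg.smooth_inv ho, hg.pdMat_inv hS hx, covMat]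
    simp only [Matrix.mul_sub, Matrix.sub_mul, Matrix.neg_mul, Matrix.trace_add, Matrix.trace_sub,
      Matrix.trace_neg, Matrix.mul_assoc]
    rw [Matrix.trace_mul_comm (chMat g j x)]
    simp only [Matrix.mul_assoc]
    ring
  have hI : ∀ k l, (tMat g x)⁻¹ k l = (tMat g x)⁻¹ l k := fun k l =>
    congrFun (congrFun (hg.inv_transpose hx) l) k
  simp only [varCh, Matrix.mul_apply, varFirst, Matrix.of_apply, mul_sub, mul_add,
    Finset.sum_sub_distrib, Finset.sum_add_distrib]
  have h3 : ∑ k, ∑ l, (tMat g x)⁻¹ k l * covMat g k (tMat o) x j l =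
      ∑ k, ∑ l, (tMat g x)⁻¹ k l * covMat g l (tMat o) x k j := by
    rw [Finset.sum_comm]
    refine Finset.sum_congr rfl fun l _ => Finset.sum_congr rfl fun k _ => ?_
    rw [hI, covMat_symm hg hS ho hos hx k j l]
  have h4 : ∑ k, ∑ l, (tMat g x)⁻¹ k l * covMat g j (tMat o) x k l = 0 := by
    rw [← h2]
    simp only [Matrix.trace, Matrix.diag, Matrix.mul_apply]
    exact Finset.sum_congr rfl fun k _ => Finset.sum_congr rfl fun l _ => by
      rw [covMat_symm hg hS ho hos hx j k l]
  rw [h3, h4]; ring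

include hRic htr in
-- The linearised Ricci equation. The trace of the varied curvature vanishes because `Ric = 0` on
-- the whole open set. Half of it drops out since the connection variation is trace free, and a
-- divergence remains.
lemma div_varCh (hx : x ∈ S) (i j : ι) :
    ∑ k, (pdMat k (varCh g o i) x + chMat g k x * varCh g o i x - varCh g o i x * chMat g k x -
      ∑ p, chMat g k x p i • varCh g o p x) k j = 0 := by
  have hΓ := hg.smooth_chMat hS
  have hC := smooth_varCh hg hS ho
  have h1 : ∑ k, eulMat (curvMat g k i) x k j = 0 := by
    have s : ∀ k, SmoothMatOn S (curvMat g k i) := fun k =>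
      (((((hΓ i).pdMat hS k).sub ((hΓ k).pdMat hS i)).add ((hΓ k).mul (hΓ i))).sub
        ((hΓ i).mul (hΓ k)))
    have h0 : ∀ y ∈ S, ∑ k, curvMat g k i y k j = 0 := fun y hy => by
      rw [← ricci_eq hg hS hy, hRic y hy]
    have : ∀ a, ∑ k, pd a (fun y => curvMat g k i y k j) x = 0 := fun a => by
      rw [← pd_sum a _ fun k _ => diffAt_of_contDiffOn hS (s k k j) hx,
        pd_congr_on a hS hx (g := fun _ => 0) fun y hy => h0 y hy, pd_const]
    simp only [eulMat_apply, eul]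
    rw [Finset.sum_comm]
    simp only [← Finset.mul_sum, this, mul_zero, Finset.sum_const_zero]
  have h2 : ∑ k, curvMat g k i x k j = 0 := by rw [← ricci_eq hg hS hx, hRic x hx]
  have h3 : ∑ k, pdMat i (varCh g o k) x k j = 0 := by
    simp only [pdMat_apply]
    rw [← pd_sum i _ fun k _ => diffAt_of_contDiffOn hS (hC k k j) hx,
      pd_congr_on i hS hx (g := fun _ => 0) fun y hy => trace_varCh hg hS ho hos htr hy j, pd_const]
  have h4 : ∑ k, (varCh g o k x * chMat g i x) k j = 0 := by
    simp only [Matrix.mul_apply]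
    rw [Finset.sum_comm]
    simp only [← Finset.sum_mul, trace_varCh hg hS ho hos htr hx, zero_mul, Finset.sum_const_zero]
  -- By symmetry of `Γ`, this leftover product is the Christoffel correction on the index `i` in the
  -- divergence.
  have h5 : ∑ k, (chMat g i x * varCh g o k x) k j = ∑ k, ∑ p, chMat g k x p i * varCh g o p x k j := by
    simp only [Matrix.mul_apply]
    rw [Finset.sum_comm]
    refine Finset.sum_congr rfl fun p _ => Finset.sum_congr rfl fun k _ => ?_
    rw [hg.chMat_symm hS hx k i p]
  simp only [eulMat_curvMat hg hS ho hos hE hx, Matrix.sub_apply, Matrix.add_apply,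
    Matrix.smul_apply, smul_eq_mul, Finset.sum_add_distrib, Finset.sum_sub_distrib,
    ← Finset.mul_sum, h2, h3, h4, h5] at h1
  simp only [Matrix.sub_apply, Matrix.add_apply, Matrix.sum_apply, Matrix.smul_apply, smul_eq_mul,
    Finset.sum_add_distrib, Finset.sum_sub_distrib]
  linarith

omit hE hos in
lemma covMat_varFirst (hx : x ∈ S) (k i l j : ι) :
    (covMat g k (varFirst g o i) x - ∑ p, chMat g k x p i • varFirst g o p x) l j =
      cov2Mat g k i (tMat o) x j l + cov2Mat g k j (tMat o) x i l -
        cov2Mat g k l (tMat o) x i j := by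
  have d : ∀ a b c, DifferentiableAt ℝ (fun y => covMat g a (tMat o) y b c) x := fun a b c =>
    diffAt_of_contDiffOn hS (hg.smooth_covMat hS a ho b c) hx
  have e : pd k (fun y => varFirst g o i y l j) x = pd k (fun y => covMat g i (tMat o) y j l) x +
      pd k (fun y => covMat g j (tMat o) y i l) x -
      pd k (fun y => covMat g l (tMat o) y i j) x := by
    simp only [varFirst, Matrix.of_apply]
    rw [pd_sub k ((d i j l).fun_add (d j i l)) (d l i j), pd_add k (d i j l) (d j i l)]
  have u : covMat g k (varFirst g o i) x = pdMat k (varFirst g o i) x -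
    (chMat g k x)ᵀ * varFirst g o i x - varFirst g o i x * chMat g k x := rfl
  rw [u, cov2Mat_apply, cov2Mat_apply, cov2Mat_apply]
  simp only [Matrix.sub_apply, Matrix.mul_apply, Matrix.sum_apply, Matrix.smul_apply,
    Matrix.transpose_apply, pdMat_apply, smul_eq_mul, e]
  simp only [varFirst, Matrix.of_apply, mul_add, mul_sub, add_mul, sub_mul,
    Finset.sum_add_distrib, Finset.sum_sub_distrib]
  simp only [mul_comm (covMat g _ (tMat o) x _ _)]
  ring

variable (hdiv : ∀ y ∈ S, ∀ j, ∑ k, ∑ l, (tMat g y)⁻¹ k l * covMat g k (tMat o) y j l = 0)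

include hdiv in
omit hE hos in
-- The covariant derivative of `div o = 0`. The derivative of `g⁻¹` supplies the corrections on the
-- two contracted indices.
lemma trace_cov2Mat_eq_zero (hx : x ∈ S) (i j : ι) :
    ∑ k, ∑ l, (tMat g x)⁻¹ k l * cov2Mat g i k (tMat o) x j l = 0 := by
  have hI : ∀ k l, (tMat g x)⁻¹ k l = (tMat g x)⁻¹ l k := fun k l =>
    congrFun (congrFun (hg.inv_transpose hx) l) k
  have dI : ∀ k l, DifferentiableAt ℝ (fun y => (tMat g y)⁻¹ k l) x := fun k l =>
    diffAt_of_contDiffOn hS (hg.smooth_inv k l) hx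
  have dD : ∀ k l, DifferentiableAt ℝ (fun y => covMat g k (tMat o) y j l) x := fun k l =>
    diffAt_of_contDiffOn hS (hg.smooth_covMat hS k ho j l) hx
  have h0 : pd i (fun y => ∑ k, ∑ l, (tMat g y)⁻¹ k l * covMat g k (tMat o) y j l) x = 0 := by
    rw [pd_congr_on i hS hx (g := fun _ => 0) fun y hy => hdiv y hy j, pd_const]
  rw [pd_sum i _ fun k _ => DifferentiableAt.fun_sum fun l _ => (dI k l).fun_mul (dD k l)] at h0
  have h1 : ∀ k, pd i (fun y => ∑ l, (tMat g y)⁻¹ k l * covMat g k (tMat o) y j l) x =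
      ∑ l, ((-(∑ p, chMat g i x k p * (tMat g x)⁻¹ p l) -
        ∑ p, (tMat g x)⁻¹ k p * chMat g i x l p) * covMat g k (tMat o) x j l +
        (tMat g x)⁻¹ k l * pd i (fun y => covMat g k (tMat o) y j l) x) := by
    intro k
    rw [pd_sum i _ fun l _ => (dI k l).fun_mul (dD k l)]
    refine Finset.sum_congr rfl fun l _ => ?_
    rw [pd_mul i (dI k l) (dD k l)]
    have := congrFun (congrFun (hg.pdMat_inv hS hx i) k) l
    simp only [pdMat_apply, Matrix.sub_apply, Matrix.neg_apply, Matrix.mul_apply,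
      Matrix.transpose_apply] at this
    rw [this]
  simp only [h1] at h0
  have t1 : ∑ k, ∑ l, (tMat g x)⁻¹ k l * ∑ p, chMat g i x p j * covMat g k (tMat o) x p l = 0 := by
    have : ∀ k l, (tMat g x)⁻¹ k l * ∑ p, chMat g i x p j * covMat g k (tMat o) x p l =
        ∑ p, chMat g i x p j * ((tMat g x)⁻¹ k l * covMat g k (tMat o) x p l) := fun k l => by
      rw [Finset.mul_sum]; exact Finset.sum_congr rfl fun p _ => by ring
    simp only [this]
    rw [Finset.sum_congr rfl fun k _ => Finset.sum_comm, Finset.sum_comm]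
    refine Finset.sum_eq_zero fun p _ => ?_
    simp only [← Finset.mul_sum]
    rw [hdiv x hx, mul_zero]
  have t2 : ∑ k, ∑ l, (tMat g x)⁻¹ k l * ∑ p, covMat g k (tMat o) x j p * chMat g i x p l =
      ∑ k, ∑ l, (∑ p, (tMat g x)⁻¹ k p * chMat g i x l p) * covMat g k (tMat o) x j l := by
    simp only [Finset.mul_sum, Finset.sum_mul]
    refine Finset.sum_congr rfl fun k _ => ?_
    rw [Finset.sum_comm]
    exact Finset.sum_congr rfl fun p _ => Finset.sum_congr rfl fun l _ => by ring
  have t3 : ∑ k, ∑ l, (tMat g x)⁻¹ k l * ∑ p, chMat g i x p k * covMat g p (tMat o) x j l =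
      ∑ k, ∑ l, (∑ p, chMat g i x k p * (tMat g x)⁻¹ p l) * covMat g k (tMat o) x j l := by
    simp only [Finset.mul_sum, Finset.sum_mul]
    rw [Finset.sum_congr rfl fun k _ => Finset.sum_comm, Finset.sum_comm]
    refine Finset.sum_congr rfl fun p _ => ?_
    rw [Finset.sum_comm]
    exact Finset.sum_congr rfl fun l _ => Finset.sum_congr rfl fun k _ => by ring
  simp only [cov2Mat_apply, mul_sub, Finset.sum_sub_distrib, t1, t2, t3]
  simp only [sub_mul, neg_mul, Finset.sum_add_distrib, Finset.sum_sub_distrib,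
    Finset.sum_neg_distrib] at h0
  linarith

omit hE in
include hRic hdiv in
-- Commute the derivatives by the Ricci identity. The reordered term is a derivative of `div o` and
-- vanishes. One curvature term contracts to `Ric = 0`, and the other is the curvature action.
lemma trace_cov2Mat (hx : x ∈ S) (i j : ι) :
    ∑ k, ∑ l, (tMat g x)⁻¹ k l * cov2Mat g k i (tMat o) x j l = -curvAction g o x i j := by
  have hT : (tMat o x)ᵀ = tMat o x := by ext a b; exact hos x hx b a
  have hI := hg.inv_transpose hx
  have hIs : ∀ k l, (tMat g x)⁻¹ k l = (tMat g x)⁻¹ l k := fun k l =>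
    congrFun (congrFun hI l) k
  have hc : ∀ k, cov2Mat g k i (tMat o) x = cov2Mat g i k (tMat o) x -
      (curvMat g k i x)ᵀ * tMat o x - tMat o x * curvMat g k i x := by
    intro k
    have := hg.covMat_comm hS hx ho i k
    have hs : ∑ p, chMat g k x p i • covMat g p (tMat o) x =
        ∑ p, chMat g i x p k • covMat g p (tMat o) x :=
      Finset.sum_congr rfl fun p _ => by rw [hg.chMat_symm hS hx p k i]
    rw [cov2Mat, cov2Mat, hs, sub_eq_iff_eq_add.1 this]
    abel
  simp only [hc, Matrix.sub_apply, mul_sub, Finset.sum_sub_distrib,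
    trace_cov2Mat_eq_zero hg hS ho hdiv hx]
  have a1 : ∑ k, ∑ l, (tMat g x)⁻¹ k l * (tMat o x * curvMat g k i x) j l = 0 := by
    have h1 : ∀ k p, ∑ l, (tMat g x)⁻¹ k l * curvMat g k i x p l =
        -∑ l, (tMat g x)⁻¹ p l * curvMat g k i x k l := by
      intro k p
      have h := hg.curv_antisymm hS hx k i
      have h' := congrArg (fun M => (tMat g x)⁻¹ * M * (tMat g x)⁻¹) h
      simp only [Matrix.transpose_mul, hg.transpose_eq hx, Matrix.mul_neg, Matrix.neg_mul] at h'
      rw [← Matrix.mul_assoc (tMat g x)⁻¹ (tMat g x), hg.inv_mul hx, Matrix.one_mul,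
        Matrix.mul_assoc, Matrix.mul_assoc, hg.mul_inv hx, Matrix.mul_one] at h'
      have h2 := congrFun (congrFun h' k) p
      simp only [Matrix.mul_apply, Matrix.neg_apply, Matrix.transpose_apply] at h2
      rw [h2]
      congr 1
      exact Finset.sum_congr rfl fun l _ => by rw [hIs p l]; ring
    have h3 : ∀ k, ∑ l, (tMat g x)⁻¹ k l * (tMat o x * curvMat g k i x) j l =
        -∑ p, ∑ l, tMat o x j p * (tMat g x)⁻¹ p l * curvMat g k i x k l := by
      intro k
      calc _ = ∑ p, tMat o x j p * ∑ l, (tMat g x)⁻¹ k l * curvMat g k i x p l := by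
            simp only [Matrix.mul_apply, Finset.mul_sum]
            rw [Finset.sum_comm]
            exact Finset.sum_congr rfl fun p _ => Finset.sum_congr rfl fun l _ => by ring
        _ = _ := by
            simp only [h1, mul_neg, Finset.sum_neg_distrib, Finset.mul_sum, mul_assoc]
    simp only [h3, Finset.sum_neg_distrib]
    rw [Finset.sum_comm, neg_eq_zero]
    refine Finset.sum_eq_zero fun p _ => ?_
    rw [Finset.sum_comm]
    refine Finset.sum_eq_zero fun l _ => ?_
    rw [← Finset.mul_sum, ← ricci_eq hg hS hx, hRic x hx, mul_zero]
  have a2 : ∑ k, ∑ l, (tMat g x)⁻¹ k l * ((curvMat g k i x)ᵀ * tMat o x) j l =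
      curvAction g o x i j := by
    rw [curvAction_eq]
    refine Finset.sum_congr rfl fun k _ => ?_
    have h1 : ∀ l, riemann g x i k j l = (tMat g x * curvMat g k i x) l j := fun l => by
      rw [hg.riemann_swap_right hS hx, ← riemann_swap_left, riemann_eq]
    have h2 : ∑ l, riemann g x i k j l * raise g x (tMat o x) k l =
        (raise g x (tMat o x) * (tMat g x * curvMat g k i x)) k j := by
      rw [Matrix.mul_apply]
      exact Finset.sum_congr rfl fun l _ => by rw [h1]; ring
    have h3 : ∑ l, (tMat g x)⁻¹ k l * ((curvMat g k i x)ᵀ * tMat o x) j l =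
        ((tMat g x)⁻¹ * ((curvMat g k i x)ᵀ * tMat o x)ᵀ) k j := by
      rw [Matrix.mul_apply]; rfl
    rw [h2, h3, raise, hI, Matrix.transpose_mul, Matrix.transpose_transpose, hT]
    simp only [Matrix.mul_assoc]
    rw [← Matrix.mul_assoc (tMat g x)⁻¹ (tMat g x), hg.inv_mul hx, Matrix.one_mul]
  rw [a1, a2]; ring

omit hE hos ho in
lemma curvAction_symm (hx : x ∈ S) (h : ∀ a b, o x a b = o x b a) (i j : ι) :
    curvAction g o x i j = curvAction g o x j i := by
  have hT : (tMat o x)ᵀ = tMat o x := by ext a b; exact h b a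
  have hr : ∀ k l, raise g x (tMat o x) k l = raise g x (tMat o x) l k := by
    intro k l
    have : (raise g x (tMat o x))ᵀ = raise g x (tMat o x) := by
      simp only [raise, hg.inv_transpose hx, Matrix.transpose_mul, hT, Matrix.mul_assoc]
    exact congrFun (congrFun this l) k
  rw [curvAction_eq, curvAction_eq, Finset.sum_comm]
  exact Finset.sum_congr rfl fun l _ => Finset.sum_congr rfl fun k _ => by
    rw [hg.riemann_pair hS hx i k j l, hr]

include hRic htr hdiv in
/-- `P_g o = 0`. -/
theorem opP_eq_zero_of_dilation (hx : x ∈ S) (i j : ι) : opP g o x i j = 0 := by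
  have h := div_varCh hg hS ho hos hE hRic htr hx i j
  have hC := smooth_varCh hg hS ho
  have e : ∀ k, (pdMat k (varCh g o i) x + chMat g k x * varCh g o i x -
      varCh g o i x * chMat g k x - ∑ p, chMat g k x p i • varCh g o p x) =
      (tMat g x)⁻¹ * (covMat g k (varFirst g o i) x - ∑ p, chMat g k x p i • varFirst g o p x) := by
    intro k
    have hGC : ∀ y ∈ S, ∀ a, tMat g y * varCh g o a y = varFirst g o a y := fun y hy a => by
      rw [varCh, ← Matrix.mul_assoc, hg.mul_inv hy, Matrix.one_mul]
    have h1 : pdMat k (varFirst g o i) x = (chMat g k x)ᵀ * varFirst g o i x +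
        tMat g x * chMat g k x * varCh g o i x + tMat g x * pdMat k (varCh g o i) x := by
      rw [pdMat_congr k hS hx (N := fun y => tMat g y * varCh g o i y) fun y hy =>
        (hGC y hy i).symm, pdMat_mul k hS hx hg.smooth (hC i), hg.pdMat_metric hS hx,
        ← hGC x hx i]
      noncomm_ring
    have h2 : covMat g k (varFirst g o i) x = tMat g x * (chMat g k x * varCh g o i x +
        pdMat k (varCh g o i) x - varCh g o i x * chMat g k x) := by
      rw [covMat, h1, ← hGC x hx i]; noncomm_ring
    rw [h2, Matrix.mul_sub, ← Matrix.mul_assoc, hg.inv_mul hx, Matrix.one_mul, Matrix.mul_sum]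
    simp only [Matrix.mul_smul]
    have : ∀ p, (tMat g x)⁻¹ * varFirst g o p x = varCh g o p x := fun p => rfl
    simp only [this]
    abel
  simp only [e, Matrix.mul_apply (M := (tMat g x)⁻¹), covMat_varFirst hg hS ho hx, mul_add,
    mul_sub, Finset.sum_add_distrib, Finset.sum_sub_distrib] at h
  -- Of the three second derivatives in the divergence of `varFirst`, two give `-R̊(o)` each and the
  -- third gives minus the rough Laplacian. Their sum is `2 P o`.
  rw [trace_cov2Mat hg hS ho hos hRic hdiv hx, trace_cov2Mat hg hS ho hos hRic hdiv hx,
    curvAction_symm hg hS hx (hos x hx) j i] at h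
  have hL : roughLaplacian g o x i j =
      ∑ k, ∑ l, (tMat g x)⁻¹ k l * cov2Mat g k l (tMat o) x i j := by
    have := congrFun (congrFun (tMat_roughLaplacian (x := x) g o) i) j
    simpa [tMat_apply, Matrix.sum_apply, cov2Mat] using this
  rw [opP, hL]
  linarith

end

end Dilation


/-! ### The quadratic tensor `H` and the Euclidean operators -/

section Euclidean

variable {ι : Type} [Fintype ι] [DecidableEq ι] {x : EuclideanSpace ℝ ι}

lemma kron_eq_one_apply (i j : ι) : kron i j = (1 : Matrix ι ι ℝ) i j := by
  simp [kron, Matrix.one_apply]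

lemma tMat_euclMetric : tMat (euclMetric : TwoTensor ι) x = 1 := by
  ext i j; exact kron_eq_one_apply i j

lemma invMetric_euclMetric (i j : ι) : invMetric (euclMetric : TwoTensor ι) x i j = kron i j := by
  change ((tMat (euclMetric : TwoTensor ι) x)⁻¹) i j = _
  rw [tMat_euclMetric, inv_one, kron_eq_one_apply]

lemma christoffel_euclMetric (k i j : ι) :
    christoffel (euclMetric : TwoTensor ι) k i j = fun _ => 0 := by
  funext y
  simp [christoffel, euclMetric, pd_const]

lemma roughLaplacian_euclMetric (h : TwoTensor ι) (i j : ι) :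
    roughLaplacian euclMetric h x i j = ∑ k, pd k (pd k fun y => h y i j) x := by
  have : ∀ k a b, covDeriv euclMetric h k a b = pd k fun y => h y a b := fun k a b => by
    funext y; simp [covDeriv, christoffel_euclMetric]
  simp [roughLaplacian, covDeriv2, christoffel_euclMetric, invMetric_euclMetric, this]

lemma opB_euclMetric (h : TwoTensor ι) (i : ι) :
    opB euclMetric h x i =
      -(∑ j, pd j (fun y => h y j i) x) + (1 / 2) * pd i (fun y => ∑ j, h y j j) x := by
  have : trace (euclMetric : TwoTensor ι) h = fun y => ∑ j, h y j j := by
    funext y; simp [trace, invMetric_euclMetric]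
  simp [opB, covDeriv, christoffel_euclMetric, invMetric_euclMetric, this]

/-- The coefficients need not be symmetric, which is the case for `hCoeff` in its first two indices.
-/
lemma pd_quadratic (c : ι → ι → ℝ) (k : ι) :
    pd k (fun y : EuclideanSpace ℝ ι => ∑ i, ∑ j, c i j * y i * y j) x =
      ∑ j, (c k j + c j k) * x j := by
  have d := fun i => differentiable_coord (ι := ι) i x
  have d2 : ∀ i j, DifferentiableAt ℝ (fun y : EuclideanSpace ℝ ι => c i j * y i * y j) x :=
    fun i j => ((d i).const_mul (c i j)).fun_mul (d j)
  rw [pd_sum k _ fun i _ => DifferentiableAt.fun_sum fun j _ => d2 i j]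
  simp only [pd_sum k _ fun j _ => d2 _ j, pd_mul k ((d _).const_mul _) (d _),
    pd_const_mul k _ (d _), pd_coord]
  simp only [Finset.sum_add_distrib, add_mul, mul_assoc]
  congr 1
  · rw [Finset.sum_comm]
    refine Finset.sum_congr rfl fun j _ => ?_
    simp only [mul_left_comm _ (kron k _), sum_kron_mul]
  · refine Finset.sum_congr rfl fun i _ => ?_
    have : ∀ j, c i j * (x i * kron k j) = kron k j * (c i j * x i) := fun j => by ring
    simp only [this, sum_kron_mul]

lemma pd_linear (c : ι → ℝ) (k : ι) :
    pd k (fun y : EuclideanSpace ℝ ι => ∑ j, c j * y j) x = c k := by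
  have d := fun i => differentiable_coord (ι := ι) i x
  rw [pd_sum k _ fun i _ => (d i).const_mul (c i)]
  simp only [pd_const_mul k _ (d _), pd_coord]
  simp only [mul_comm (c _), sum_kron_mul]

lemma IsRiemannianMetricOn.isNondegenerateOn {U : Set (EuclideanSpace ℝ ι)} {g : TwoTensor ι}
    (h : IsRiemannianMetricOn U g) : IsNondegenerateOn U g where
  smooth := h.smooth
  symm := h.symm
  det x hx := by
    rw [isUnit_iff_ne_zero]
    intro h0
    obtain ⟨v, hv, hv0⟩ := Matrix.exists_mulVec_eq_zero_iff.2 h0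
    refine (h.pos x hx v hv).ne' ?_
    refine Finset.sum_eq_zero fun i _ => ?_
    have := congrFun hv0 i
    simp only [Matrix.mulVec, dotProduct, Pi.zero_apply, tMat_apply] at this
    calc ∑ j, g x i j * v i * v j = v i * ∑ j, g x i j * v j := by
          rw [Finset.mul_sum]; exact Finset.sum_congr rfl fun j _ => by ring
      _ = 0 := by rw [this, mul_zero]

end Euclidean

/-! ### The equations satisfied by `H` -/

section QuadraticTensor

variable {n : ℕ} {Λ : ℝ} {U : Set (Cn n)} {g₀ : TwoTensor (Idx n)}

lemma card_Idx : (Fintype.card (Idx n) : ℝ) = 2 * n := by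
  simp [Idx, mul_comm]

variable (hU : IsOpen U) (h0U : (0 : Cn n) ∈ U) (hE : IsEinsteinOn U g₀ Λ)
  (hδ : g₀ 0 = euclMetric (0 : Cn n))
include hU h0U hE hδ

lemma invMetric_origin (i j : Idx n) : invMetric g₀ 0 i j = kron i j := by
  rw [invMetric, hδ]; exact invMetric_euclMetric (x := (0 : Cn n)) i j

lemma sum_riemann_origin (i j : Idx n) : ∑ k, riemann g₀ 0 i k j k = Λ * kron i j := by
  have h := hE.einstein 0 h0U i j
  simp only [ricci, invMetric_origin hU h0U hE hδ, sum_kron_mul, hδ] at h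
  exact h

lemma scalarCurv_origin : scalarCurv g₀ 0 = 2 * n * Λ := by
  have h := hE.einstein 0 h0U
  simp only [scalarCurv, h, hδ, invMetric_origin hU h0U hE hδ, euclMetric, sum_kron_mul]
  simp [mul_comm]

/-- The curvature contracts to `-Λ/3` by the Einstein equation. The delta terms contribute `-2Λ/3`,
as `2n + 2` cancels the denominator `n + 1`. This contraction is half the Laplacian of `H`. -/
lemma sum_hCoeff_diag_left (i j : Idx n) : ∑ k, hCoeff g₀ Λ k k i j = -Λ * kron i j := by
  have hg := hE.toIsRiemannianMetricOn.isNondegenerateOn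
  have h1 : ∀ k, riemann g₀ 0 k i k j = riemann g₀ 0 i k j k := fun k => by
    rw [riemann_swap_left, hg.riemann_swap_right hU h0U, neg_neg]
  simp only [hCoeff, Finset.sum_sub_distrib, ← Finset.mul_sum, h1,
    sum_riemann_origin hU h0U hE hδ, Finset.sum_add_distrib, sum_kron_mul', kron_self, one_mul,
    Finset.sum_const, Finset.card_univ, nsmul_eq_mul, card_Idx]
  have : (n : ℝ) + 1 ≠ 0 := by positivity
  field_simp
  ring

lemma sum_hCoeff_diag_right (i j : Idx n) : ∑ k, hCoeff g₀ Λ i j k k = -Λ * kron i j := by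
  simp only [hCoeff, Finset.sum_sub_distrib, ← Finset.mul_sum,
    sum_riemann_origin hU h0U hE hδ, Finset.sum_add_distrib, sum_mul_kron, kron_self, mul_one,
    Finset.sum_const, Finset.card_univ, nsmul_eq_mul, card_Idx]
  have : (n : ℝ) + 1 ≠ 0 := by positivity
  field_simp
  ring

/-- The divergence of `H` is `-Λ x`. This is also half the gradient of `tr H = -Λ r²`, which is the
Bianchi gauge. -/
lemma sum_hCoeff_mixed (b i : Idx n) :
    ∑ j, (hCoeff g₀ Λ j b j i + hCoeff g₀ Λ b j j i) = -Λ * kron b i := by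
  have hg := hE.toIsRiemannianMetricOn.isNondegenerateOn
  have h0 : ∀ j, riemann g₀ 0 j j b i = 0 := fun j => by
    have := riemann_swap_left (g := g₀) (x := 0) j j b i
    linarith
  have h1 : ∀ j, riemann g₀ 0 b j j i = -riemann g₀ 0 b j i j := fun j =>
    hg.riemann_swap_right hU h0U _ _ _ _
  simp only [hCoeff, Finset.sum_add_distrib, Finset.sum_sub_distrib, ← Finset.mul_sum, h0, h1,
    Finset.sum_neg_distrib, sum_riemann_origin hU h0U hE hδ, sum_kron_mul', sum_kron_mul,
    kron_self, one_mul, Finset.sum_const, Finset.card_univ, nsmul_eq_mul, card_Idx]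
  have : (n : ℝ) + 1 ≠ 0 := by positivity
  field_simp
  ring

theorem laplacian_hTensor (x : Cn n) (i j : Idx n) :
    -(1 / 2) * roughLaplacian euclMetric (hTensor g₀ Λ) x i j = Λ * euclMetric x i j := by
  have h1 : ∀ k, pd k (fun y => hTensor g₀ Λ y i j) =
      fun y : Cn n => ∑ b, (hCoeff g₀ Λ k b i j + hCoeff g₀ Λ b k i j) * y b := fun k => by
    funext y; exact pd_quadratic (fun a b => hCoeff g₀ Λ a b i j) k
  simp only [roughLaplacian_euclMetric, h1, pd_linear, Finset.sum_add_distrib,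
    sum_hCoeff_diag_left hU h0U hE hδ, euclMetric]
  ring

theorem opB_hTensor (x : Cn n) (i : Idx n) : opB euclMetric (hTensor g₀ Λ) x i = 0 := by
  have h1 : ∀ j, pd j (fun y => hTensor g₀ Λ y j i) x =
      ∑ b, (hCoeff g₀ Λ j b j i + hCoeff g₀ Λ b j j i) * x b := fun j =>
    pd_quadratic (fun a b => hCoeff g₀ Λ a b j i) j
  have h2 : (fun y : Cn n => ∑ j, hTensor g₀ Λ y j j) =
      fun y => ∑ a, ∑ b, (-Λ * kron a b) * y a * y b := by
    funext y
    simp only [hTensor, ← sum_hCoeff_diag_right hU h0U hE hδ, Finset.sum_mul]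
    rw [Finset.sum_comm]
    exact Finset.sum_congr rfl fun a _ => Finset.sum_comm
  rw [opB_euclMetric, h2, pd_quadratic]
  simp only [h1]
  rw [Finset.sum_comm]
  simp only [← Finset.sum_mul, sum_hCoeff_mixed hU h0U hE hδ]
  rw [Finset.mul_sum, ← Finset.sum_neg_distrib, ← Finset.sum_add_distrib]
  refine Finset.sum_eq_zero fun b _ => ?_
  rw [kron_comm b i]; ring

end QuadraticTensor


/-! ### The standard complex structure -/

section Complex

variable {n : ℕ}

lemma cstr_zero (x : Cn n) (a : Fin n) : cstr x (a, 0) = -x (a, 1) := by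
  simp [cstr, ofZ, zc]

lemma cstr_one (x : Cn n) (a : Fin n) : cstr x (a, 1) = x (a, 0) := by
  simp [cstr, ofZ, zc]

lemma sum_Idx (F : Idx n → ℝ) : ∑ i, F i = ∑ a, (F (a, 0) + F (a, 1)) := by
  rw [Fintype.sum_prod_type]
  exact Finset.sum_congr rfl fun a _ => Fin.sum_univ_two _

lemma kahler_zero (i : Idx n) (a : Fin n) : kahler i (a, 0) = -kron i (a, 1) := by
  simp [kahler, cstr_zero, kron, eq_comm]

lemma kahler_one (i : Idx n) (a : Fin n) : kahler i (a, 1) = kron i (a, 0) := by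
  simp [kahler, cstr_one, kron, eq_comm]

lemma cstr_eq_sum (x : Cn n) (j : Idx n) : cstr x j = ∑ i, kahler i j * x i := by
  obtain ⟨a, b⟩ := j
  fin_cases b
  · simp [kahler_zero, cstr_zero]
  · simp [kahler_one, cstr_one]

lemma kahler_antisymm (i j : Idx n) : kahler i j = -kahler j i := by
  obtain ⟨a, b⟩ := i
  obtain ⟨c, d⟩ := j
  fin_cases b <;> fin_cases d <;> simp [kahler_zero, kahler_one, kron, eq_comm]

@[simp] lemma kahler_self (i : Idx n) : kahler i i = 0 := by
  have := kahler_antisymm i i; linarith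

lemma sum_kahler_mul_kahler (k l : Idx n) : ∑ p, kahler p k * kahler p l = kron k l := by
  obtain ⟨a, b⟩ := k
  obtain ⟨c, d⟩ := l
  fin_cases b <;> fin_cases d <;> simp [kahler_zero, kahler_one, kron, eq_comm]

lemma sum_kahler_cstr (x : Cn n) (j : Idx n) : ∑ i, kahler i j * cstr x i = -x j := by
  obtain ⟨a, b⟩ := j
  fin_cases b
  · simp [kahler_zero, cstr_one]
  · simp [kahler_one, cstr_zero]

lemma sum_mul_self (x : Cn n) : ∑ i, x i * x i = ‖x‖ ^ 2 := by
  rw [EuclideanSpace.real_norm_sq_eq]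
  exact Finset.sum_congr rfl fun i _ => by ring

lemma sum_cstr_mul_self (x : Cn n) : ∑ i, cstr x i * cstr x i = ‖x‖ ^ 2 := by
  rw [← sum_mul_self, sum_Idx, sum_Idx]
  exact Finset.sum_congr rfl fun a _ => by rw [cstr_zero, cstr_one]; ring

lemma norm_cstr_sq (x : Cn n) : ‖cstr x‖ ^ 2 = ‖x‖ ^ 2 := by
  rw [← sum_mul_self, sum_cstr_mul_self]

lemma sum_mul_cstr (x : Cn n) : ∑ i, x i * cstr x i = 0 := by
  rw [sum_Idx]
  exact Finset.sum_eq_zero fun a _ => by rw [cstr_zero, cstr_one]; ring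

end Complex

/-! ### Contractions of the tensor `H` -/

section Contractions

variable {n : ℕ} {Λ : ℝ} {U : Set (Cn n)} {g₀ : TwoTensor (Idx n)}

/-- The quartic form `R(x, Jx, x, Jx)` of the curvature at the origin. -/
def holSect (g₀ : TwoTensor (Idx n)) (x : Cn n) : ℝ :=
  ∑ i, ∑ k, ∑ j, ∑ l, riemann g₀ 0 i k j l * (x i * cstr x k * x j * cstr x l)

variable (hU : IsOpen U) (h0U : (0 : Cn n) ∈ U) (hE : IsEinsteinOn U g₀ Λ)
  (hδ : g₀ 0 = euclMetric (0 : Cn n))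
include hU h0U hE

include hδ in
lemma trace_hTensor (x : Cn n) : ∑ k, hTensor g₀ Λ x k k = -Λ * ‖x‖ ^ 2 := by
  have : ∑ k, hTensor g₀ Λ x k k = ∑ i, ∑ j, (-Λ * kron i j) * x i * x j := by
    simp only [hTensor, ← sum_hCoeff_diag_right hU h0U hE hδ, Finset.sum_mul]
    rw [Finset.sum_comm]
    exact Finset.sum_congr rfl fun a _ => Finset.sum_comm
  rw [this, ← sum_mul_self, Finset.mul_sum]
  refine Finset.sum_congr rfl fun i _ => ?_
  have : ∀ j, -Λ * kron i j * x i * x j = kron i j * (-Λ * x i * x j) := fun j => by ring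
  simp only [this, sum_kron_mul]; ring

omit hU h0U hE in
-- Only the values `v = x` and `v = Jx` are needed: the pairing with `o` sees nothing else of `H`
-- besides its trace.
lemma hTensor_contract (x v : Cn n) : ∑ k, ∑ l, hTensor g₀ Λ x k l * v k * v l =
    -(1 / 3) * (∑ i, ∑ k, ∑ j, ∑ l, riemann g₀ 0 i k j l * (x i * v k * x j * v l)) -
      Λ / (3 * ((n : ℝ) + 1)) * (‖x‖ ^ 2 * ‖v‖ ^ 2 + 2 * (∑ i, x i * v i) ^ 2) := by
  have e1 : ∑ k, ∑ l, hTensor g₀ Λ x k l * v k * v l =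
      ∑ i, ∑ k, ∑ j, ∑ l, hCoeff g₀ Λ i j k l * (x i * v k * x j * v l) := by
    have : ∀ k l, hTensor g₀ Λ x k l * v k * v l =
        ∑ i, ∑ j, hCoeff g₀ Λ i j k l * (x i * v k * x j * v l) := fun k l => by
      simp only [hTensor, Finset.sum_mul]
      exact Finset.sum_congr rfl fun i _ => Finset.sum_congr rfl fun j _ => by ring
    simp only [this]
    calc _ = ∑ k, ∑ i, ∑ l, ∑ j, hCoeff g₀ Λ i j k l * (x i * v k * x j * v l) :=
          Finset.sum_congr rfl fun k _ => Finset.sum_comm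
      _ = ∑ i, ∑ k, ∑ l, ∑ j, hCoeff g₀ Λ i j k l * (x i * v k * x j * v l) := Finset.sum_comm
      _ = _ := Finset.sum_congr rfl fun i _ => Finset.sum_congr rfl fun k _ => Finset.sum_comm
  have e2 : ∑ i, ∑ k, ∑ j, ∑ l, (kron i j * kron k l) * (x i * v k * x j * v l) =
      ‖x‖ ^ 2 * ‖v‖ ^ 2 := by
    have h : ∀ i k j l, (kron i j * kron k l) * (x i * v k * x j * v l) =
      kron i j * (x i * x j * (kron k l * (v k * v l))) := fun _ _ _ _ => by ring
    simp only [h, ← Finset.mul_sum, sum_kron_mul]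
    rw [← sum_mul_self, ← sum_mul_self, Finset.sum_mul]
  have e3 : ∑ i, ∑ k, ∑ j, ∑ l, (kron i k * kron j l) * (x i * v k * x j * v l) =
      (∑ i, x i * v i) ^ 2 := by
    have h : ∀ i k j l, (kron i k * kron j l) * (x i * v k * x j * v l) =
      kron i k * (x i * v k * (kron j l * (x j * v l))) := fun _ _ _ _ => by ring
    simp only [h, ← Finset.mul_sum, sum_kron_mul]
    rw [sq, Finset.sum_mul]
  rw [e1, ← e2, ← e3]
  simp only [Finset.mul_sum, ← Finset.sum_add_distrib, ← Finset.sum_sub_distrib]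
  refine Finset.sum_congr rfl fun i _ => Finset.sum_congr rfl fun k _ =>
    Finset.sum_congr rfl fun j _ => Finset.sum_congr rfl fun l _ => ?_
  rw [hCoeff]; ring

omit hU h0U hE in
-- The curvature part `R(x,x,x,x)` vanishes by antisymmetry, and the delta terms add up to three
-- times `r⁴`.
lemma hTensor_radial (x : Cn n) : ∑ k, ∑ l, hTensor g₀ Λ x k l * x k * x l =
    -(Λ / ((n : ℝ) + 1)) * ‖x‖ ^ 4 := by
  have h0 : ∑ i, ∑ k, ∑ j, ∑ l, riemann g₀ 0 i k j l * (x i * x k * x j * x l) = 0 := by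
    have h : ∑ i, ∑ k, ∑ j, ∑ l, riemann g₀ 0 i k j l * (x i * x k * x j * x l) =
        -∑ i, ∑ k, ∑ j, ∑ l, riemann g₀ 0 i k j l * (x i * x k * x j * x l) := by
      conv_lhs => rw [Finset.sum_comm]
      simp only [← Finset.sum_neg_distrib]
      refine Finset.sum_congr rfl fun i _ => Finset.sum_congr rfl fun k _ =>
        Finset.sum_congr rfl fun j _ => Finset.sum_congr rfl fun l _ => ?_
      rw [riemann_swap_left]; ring
    linarith
  rw [hTensor_contract, h0, sum_mul_self]
  have : (n : ℝ) + 1 ≠ 0 := by positivity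
  field_simp; ring

omit hU h0U hE in
lemma hTensor_hopf (x : Cn n) : ∑ k, ∑ l, hTensor g₀ Λ x k l * cstr x k * cstr x l =
    -(1 / 3) * holSect g₀ x - Λ / (3 * ((n : ℝ) + 1)) * ‖x‖ ^ 4 := by
  rw [hTensor_contract, norm_cstr_sq, sum_mul_cstr, holSect]; ring

omit hU h0U hE in
lemma holSect_smul (c : ℝ) (x : Cn n) : holSect g₀ (c • x) = c ^ 4 * holSect g₀ x := by
  have hc : ∀ i, cstr (c • x) i = c * cstr x i := fun i => by
    simp only [cstr_eq_sum, PiLp.smul_apply, smul_eq_mul, Finset.mul_sum]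
    exact Finset.sum_congr rfl fun j _ => by ring
  simp only [holSect, hc, PiLp.smul_apply, smul_eq_mul, Finset.mul_sum]
  refine Finset.sum_congr rfl fun i _ => Finset.sum_congr rfl fun k _ =>
    Finset.sum_congr rfl fun j _ => Finset.sum_congr rfl fun l _ => ?_
  ring

omit hU h0U hE in
/-- `R(x, Jx, x, Jx)` as a quartic polynomial. -/
lemma holSect_eq_quartic (x : Cn n) : holSect g₀ x =
    ∑ i, ∑ j, ∑ p, ∑ r, (∑ k, ∑ l, riemann g₀ 0 i k j l * kahler p k * kahler r l) *
      (x i * x j * x p * x r) := by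
  have h : ∀ i j, ∑ k, ∑ l, riemann g₀ 0 i k j l * (x i * cstr x k * x j * cstr x l) =
      ∑ p, ∑ r, (∑ k, ∑ l, riemann g₀ 0 i k j l * kahler p k * kahler r l) *
        (x i * x j * x p * x r) := by
    intro i j
    have h1 : ∀ k l, riemann g₀ 0 i k j l * (x i * cstr x k * x j * cstr x l) =
        ∑ p, ∑ r, riemann g₀ 0 i k j l * kahler p k * kahler r l * (x i * x j * x p * x r) := by
      intro k l
      rw [cstr_eq_sum x k, cstr_eq_sum x l]
      simp only [Finset.mul_sum, Finset.sum_mul]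
      rw [Finset.sum_comm]
      exact Finset.sum_congr rfl fun p _ => Finset.sum_congr rfl fun r _ => by ring
    simp only [h1, Finset.sum_mul]
    calc _ = ∑ k, ∑ p, ∑ l, ∑ r, riemann g₀ 0 i k j l * kahler p k * kahler r l *
          (x i * x j * x p * x r) := Finset.sum_congr rfl fun k _ => Finset.sum_comm
      _ = ∑ p, ∑ k, ∑ l, ∑ r, riemann g₀ 0 i k j l * kahler p k * kahler r l *
          (x i * x j * x p * x r) := Finset.sum_comm
      _ = ∑ p, ∑ k, ∑ r, ∑ l, riemann g₀ 0 i k j l * kahler p k * kahler r l *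
          (x i * x j * x p * x r) :=
        Finset.sum_congr rfl fun p _ => Finset.sum_congr rfl fun k _ => Finset.sum_comm
      _ = _ := Finset.sum_congr rfl fun p _ => Finset.sum_comm
  rw [holSect]
  simp only [← h]
  exact Finset.sum_congr rfl fun i _ => Finset.sum_comm

include hδ in
/-- The full contraction of the quartic form `R(x, Jx, x, Jx)`. -/
lemma holSect_contraction :
    ∑ i, ∑ j, ∑ p, ∑ r, (∑ k, ∑ l, riemann g₀ 0 i k j l * kahler p k * kahler r l) *
      (kron i j * kron p r + kron i p * kron j r + kron i r * kron j p) =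
    2 * n * Λ + 3 / 2 * curvOmega g₀ := by
  have hg := hE.toIsRiemannianMetricOn.isNondegenerateOn
  set K : Idx n → Idx n → Idx n → Idx n → ℝ := fun i j p r =>
    ∑ k, ∑ l, riemann g₀ 0 i k j l * kahler p k * kahler r l with hK
  have e1 : ∑ i, ∑ j, ∑ p, ∑ r, K i j p r * (kron i j * kron p r) = ∑ i, ∑ p, K i i p p := by
    have h : ∀ i j p r, K i j p r * (kron i j * kron p r) = kron i j * (kron p r * K i j p r) :=
      fun _ _ _ _ => by ring
    simp only [h, ← Finset.mul_sum, sum_kron_mul]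
  have e2 : ∑ i, ∑ j, ∑ p, ∑ r, K i j p r * (kron i p * kron j r) = ∑ i, ∑ j, K i j i j := by
    have h : ∀ i j p r, K i j p r * (kron i p * kron j r) = kron i p * (kron j r * K i j p r) :=
      fun _ _ _ _ => by ring
    simp only [h, ← Finset.mul_sum, sum_kron_mul]
  have e3 : ∑ i, ∑ j, ∑ p, ∑ r, K i j p r * (kron i r * kron j p) = ∑ i, ∑ j, K i j j i := by
    have h : ∀ i j p r, K i j p r * (kron i r * kron j p) = kron j p * (kron i r * K i j p r) :=
      fun _ _ _ _ => by ring
    simp only [h, ← Finset.mul_sum, sum_kron_mul]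
  -- `J` is orthogonal, so the two Kähler forms contract to a delta and leave the trace of Ricci.
  have t1 : ∑ i, ∑ p, K i i p p = 2 * n * Λ := by
    have h : ∀ i, ∑ p, K i i p p = Λ := by
      intro i
      have h1 : ∑ p, K i i p p =
          ∑ k, ∑ l, riemann g₀ 0 i k i l * ∑ p, kahler p k * kahler p l := by
        simp only [hK, Finset.mul_sum]
        rw [Finset.sum_comm]
        refine Finset.sum_congr rfl fun k _ => ?_
        rw [Finset.sum_comm]
        exact Finset.sum_congr rfl fun l _ => Finset.sum_congr rfl fun p _ => by ring
      rw [h1]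
      simp only [sum_kahler_mul_kahler, sum_mul_kron, sum_riemann_origin hU h0U hE hδ, kron_self,
        mul_one]
    simp only [h, Finset.sum_const, Finset.card_univ, nsmul_eq_mul, card_Idx]
  have t2 : ∑ i, ∑ j, K i j i j = curvOmega g₀ := by
    simp only [hK, curvOmega]
    exact Finset.sum_congr rfl fun i _ => Finset.sum_comm
  -- By the first Bianchi identity this contraction equals `⟨R(ω), ω⟩` minus itself.
  have t3 : 2 * ∑ i, ∑ j, K i j j i = curvOmega g₀ := by
    have b : ∀ i j k l, riemann g₀ 0 i k j l * kahler j k * kahler i l =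
        -(riemann g₀ 0 k l j i * kahler j k * kahler i l) +
          riemann g₀ 0 l i k j * kahler j k * kahler i l := by
      intro i j k l
      have h1 := hg.riemann_bianchi hU h0U i k j l
      have h2 := hg.riemann_swap_right hU h0U l i j k
      have : riemann g₀ 0 i k j l = -riemann g₀ 0 k l j i + riemann g₀ 0 l i k j := by linarith
      rw [this]; ring
    have z : ∑ i, ∑ j, K i j j i = ∑ i, ∑ j, ∑ k, ∑ l,
        riemann g₀ 0 i k j l * kahler j k * kahler i l := rfl
    have z1 : ∑ i, ∑ j, ∑ k, ∑ l, riemann g₀ 0 k l j i * kahler j k * kahler i l =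
        ∑ i, ∑ j, K i j j i := by
      rw [z]
      calc _ = ∑ j, ∑ i, ∑ k, ∑ l, riemann g₀ 0 k l j i * kahler j k * kahler i l :=
            Finset.sum_comm
        _ = ∑ j, ∑ k, ∑ i, ∑ l, riemann g₀ 0 k l j i * kahler j k * kahler i l :=
            Finset.sum_congr rfl fun j _ => Finset.sum_comm
        _ = ∑ j, ∑ k, ∑ l, ∑ i, riemann g₀ 0 k l j i * kahler j k * kahler i l :=
            Finset.sum_congr rfl fun j _ => Finset.sum_congr rfl fun k _ => Finset.sum_comm
        _ = ∑ j, ∑ l, ∑ k, ∑ i, riemann g₀ 0 k l j i * kahler j k * kahler i l :=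
            Finset.sum_congr rfl fun j _ => Finset.sum_comm
        _ = ∑ l, ∑ j, ∑ k, ∑ i, riemann g₀ 0 k l j i * kahler j k * kahler i l :=
            Finset.sum_comm
        _ = _ := by
            refine Finset.sum_congr rfl fun i _ => Finset.sum_congr rfl fun j _ =>
              Finset.sum_congr rfl fun k _ => Finset.sum_congr rfl fun l _ => ?_
            rw [riemann_swap_left, kahler_antisymm l i]; ring
    have z2 : ∑ i, ∑ j, ∑ k, ∑ l, riemann g₀ 0 l i k j * kahler j k * kahler i l =
        curvOmega g₀ := by
      rw [curvOmega]
      calc _ = ∑ i, ∑ j, ∑ l, ∑ k, riemann g₀ 0 l i k j * kahler j k * kahler i l :=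
            Finset.sum_congr rfl fun i _ => Finset.sum_congr rfl fun j _ => Finset.sum_comm
        _ = ∑ i, ∑ l, ∑ j, ∑ k, riemann g₀ 0 l i k j * kahler j k * kahler i l :=
            Finset.sum_congr rfl fun i _ => Finset.sum_comm
        _ = ∑ l, ∑ i, ∑ j, ∑ k, riemann g₀ 0 l i k j * kahler j k * kahler i l :=
            Finset.sum_comm
        _ = ∑ l, ∑ i, ∑ k, ∑ j, riemann g₀ 0 l i k j * kahler j k * kahler i l :=
            Finset.sum_congr rfl fun l _ => Finset.sum_congr rfl fun i _ => Finset.sum_comm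
        _ = _ := by
            refine Finset.sum_congr rfl fun i _ => Finset.sum_congr rfl fun j _ =>
              Finset.sum_congr rfl fun k _ => Finset.sum_congr rfl fun l _ => ?_
            rw [kahler_antisymm l k, kahler_antisymm j i]; ring
    have : ∑ i, ∑ j, K i j j i = -∑ i, ∑ j, K i j j i + curvOmega g₀ := by
      conv_lhs => rw [z]
      simp only [b, Finset.sum_add_distrib, Finset.sum_neg_distrib]
      rw [z1, z2]
    linarith
  simp only [mul_add, Finset.sum_add_distrib]
  rw [e1, e2, e3, t1, t2]
  linarith

end Contractions


/-! ### Polar coordinates and moments of the sphere -/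

section Polar

open Metric Set

/-- The homeomorphism of the punctured space with the unit sphere times `(0, ∞)` takes `μ` to the
product of the sphere measure and `r^{d-1} dr`. Fubini then applies, and the origin is a null set.
-/
theorem integral_polar {E : Type*} [NormedAddCommGroup E] [NormedSpace ℝ E] [Nontrivial E]
    [FiniteDimensional ℝ E] [MeasurableSpace E] [BorelSpace E] (μ : Measure E)
    [μ.IsAddHaarMeasure] (F : E → ℝ) (hF : Integrable F μ) :
    ∫ x, F x ∂μ = ∫ r in Ioi (0 : ℝ), r ^ (Module.finrank ℝ E - 1) *
      ∫ u : sphere (0 : E) 1, F (r • (u : E)) ∂μ.toSphere := by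
  set d := Module.finrank ℝ E
  set G : sphere (0 : E) 1 × Ioi (0 : ℝ) → ℝ := fun p => F ((p.2 : ℝ) • (p.1 : E)) with hG
  have hGe : ∀ x : ({0}ᶜ : Set E), G (homeomorphUnitSphereProd E x) = F x := by
    intro x
    have : (homeomorphUnitSphereProd E).symm (homeomorphUnitSphereProd E x) = x := by simp
    have h := congrArg (Subtype.val) this
    rw [homeomorphUnitSphereProd_symm_apply_coe] at h
    simp only [hG, h]
  have mp := μ.measurePreserving_homeomorphUnitSphereProd
  have emb := (homeomorphUnitSphereProd E).measurableEmbedding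
  have hGi : Integrable G (μ.toSphere.prod (Measure.volumeIoiPow (d - 1))) := by
    rw [← mp.integrable_comp_emb emb]
    have : G ∘ (homeomorphUnitSphereProd E) = F ∘ Subtype.val := by
      funext x; exact hGe x
    rw [this, ← integrableOn_iff_comap_subtypeVal (measurableSet_singleton _).compl]
    exact hF.integrableOn
  calc ∫ x, F x ∂μ = ∫ x : ({(0)}ᶜ : Set E), F x ∂(μ.comap (↑)) := by
        rw [integral_subtype_comap (measurableSet_singleton _).compl F,
          restrict_compl_singleton]
    _ = ∫ p, G p ∂μ.toSphere.prod (Measure.volumeIoiPow (d - 1)) := by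
        rw [← mp.integral_comp emb]
        exact integral_congr_ae (.of_forall fun x => (hGe x).symm)
    _ = ∫ r : Ioi (0 : ℝ), ∫ u : sphere (0 : E) 1, F ((r : ℝ) • (u : E)) ∂μ.toSphere
          ∂Measure.volumeIoiPow (d - 1) := integral_prod_symm _ hGi
    _ = _ := by
      simp only [Measure.volumeIoiPow, ENNReal.ofReal]
      rw [integral_withDensity_eq_integral_smul,
        integral_subtype_comap measurableSet_Ioi fun r => Real.toNNReal (r ^ (d - 1)) •
          ∫ u : sphere (0 : E) 1, F (r • (u : E)) ∂μ.toSphere,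
        setIntegral_congr_fun measurableSet_Ioi fun x hx ↦ ?_]
      · rw [NNReal.smul_def, Real.coe_toNNReal _ (pow_nonneg hx.out.le _), smul_eq_mul]
      · exact (measurable_subtype_coe.pow_const _).real_toNNReal

theorem integral_fderiv_eq_zero {E : Type*} [NormedAddCommGroup E] [NormedSpace ℝ E]
    [FiniteDimensional ℝ E] [MeasurableSpace E] [BorelSpace E] (μ : Measure E)
    [μ.IsAddHaarMeasure] {F : E → ℝ} (hF : ContDiff ℝ 1 F) (hc : HasCompactSupport F) (v : E) :
    ∫ x, fderiv ℝ F x v ∂μ = 0 := by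
  have h1 : Integrable (fun x => fderiv ℝ F x v) μ :=
    ((hF.continuous_fderiv (by simp)).clm_apply continuous_const).integrable_of_hasCompactSupport
      (hc.fderiv_apply ℝ v)
  have h := integral_mul_fderiv_eq_neg_fderiv_mul_of_integrable (μ := μ) (f := fun _ : E => (1 : ℝ))
    (g := F) (v := v) (by simp) (by simpa using h1)
    (by simpa using hF.continuous.integrable_of_hasCompactSupport hc)
    (fun x _ => differentiableAt_const _) (fun x _ => (hF.differentiable (by simp)) x)
  simpa using h

lemma integrable_mul_radial {E : Type*} [NormedAddCommGroup E] [NormedSpace ℝ E]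
    [FiniteDimensional ℝ E] [MeasurableSpace E] [BorelSpace E] (μ : Measure E)
    [μ.IsAddHaarMeasure] {q : E → ℝ} (hq : Continuous q) {ρ : ℝ → ℝ} (hρ : Continuous ρ) {R : ℝ}
    (hR : ∀ t, R ≤ t → ρ t = 0) : Integrable (fun x => q x * ρ (‖x‖ ^ 2)) μ := by
  have hc : HasCompactSupport fun x => q x * ρ (‖x‖ ^ 2) := by
    refine HasCompactSupport.intro (isCompact_closedBall (0 : E) (max R 1)) fun x hx => ?_
    rw [mem_closedBall_zero_iff, not_le] at hx
    have h1 : 1 < ‖x‖ := (le_max_right _ _).trans_lt hx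
    rw [hR, mul_zero]
    nlinarith [(le_max_left R 1).trans_lt hx]
  exact (hq.mul (hρ.comp (continuous_norm.pow 2))).integrable_of_hasCompactSupport hc

lemma integral_homogeneous_mul_radial {E : Type*} [NormedAddCommGroup E] [NormedSpace ℝ E]
    [Nontrivial E] [FiniteDimensional ℝ E] [MeasurableSpace E] [BorelSpace E] (μ : Measure E)
    [μ.IsAddHaarMeasure] {q : E → ℝ} (k : ℕ) (hq : Continuous q)
    (hqk : ∀ (r : ℝ) x, q (r • x) = r ^ k * q x) {ρ : ℝ → ℝ} (hρ : Continuous ρ) {R : ℝ}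
    (hR : ∀ t, R ≤ t → ρ t = 0) :
    ∫ x, q x * ρ (‖x‖ ^ 2) ∂μ = (∫ u : sphere (0 : E) 1, q u ∂μ.toSphere) *
      ∫ r in Ioi (0 : ℝ), r ^ (Module.finrank ℝ E - 1) * (r ^ k * ρ (r ^ 2)) := by
  have hi := integrable_mul_radial μ hq hρ hR
  rw [integral_polar μ _ hi, ← integral_const_mul]
  refine setIntegral_congr_fun measurableSet_Ioi fun r hr => ?_
  have : ∀ u : sphere (0 : E) 1, q (r • (u : E)) * ρ (‖r • (u : E)‖ ^ 2) =
      q u * (r ^ k * ρ (r ^ 2)) := by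
    intro u
    rw [norm_smul, norm_eq_of_mem_sphere, mul_one, Real.norm_eq_abs, sq_abs, hqk]; ring
  simp only [this, integral_mul_const]
  ring

end Polar

/-! ### Second and fourth moments of the unit sphere -/

section Moments

open Metric Set

variable {ι : Type} [Fintype ι] [DecidableEq ι] [Nonempty ι]

/-- A smooth function on the real line which is positive near `0` and vanishes on `[2, ∞)`. -/
def bumpProfile (t : ℝ) : ℝ := Real.smoothTransition (2 - t)

lemma bumpProfile_contDiff : ContDiff ℝ ∞ bumpProfile :=
  Real.smoothTransition.contDiff.comp (contDiff_const.sub contDiff_id)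

lemma bumpProfile_eq_zero {t : ℝ} (ht : 2 ≤ t) : bumpProfile t = 0 :=
  Real.smoothTransition.zero_of_nonpos (by linarith)

lemma deriv_bumpProfile_eq_zero {t : ℝ} (ht : 3 ≤ t) : deriv bumpProfile t = 0 := by
  have : bumpProfile =ᶠ[𝓝 t] fun _ => 0 :=
    Filter.eventuallyEq_of_mem (Ioi_mem_nhds (show (2 : ℝ) < t by linarith)) fun s hs =>
      bumpProfile_eq_zero (le_of_lt hs)
  rw [this.deriv_eq]; simp

omit [Nonempty ι] in
lemma pd_norm_sq (i : ι) (x : EuclideanSpace ℝ ι) :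
    pd i (fun y => ‖y‖ ^ 2) x = 2 * x i := by
  have : (fun y : EuclideanSpace ℝ ι => ‖y‖ ^ 2) = fun y => ∑ j, y j * y j := by
    funext y
    rw [EuclideanSpace.real_norm_sq_eq]
    exact Finset.sum_congr rfl fun i _ => by ring
  have d := fun j => differentiable_coord (ι := ι) j x
  rw [this, pd_sum i _ fun j _ => (d j).fun_mul (d j)]
  simp only [pd_mul i (d _) (d _), pd_coord, Finset.sum_add_distrib, sum_kron_mul, sum_mul_kron]
  ring

omit [Nonempty ι] in
lemma pd_comp {f : EuclideanSpace ℝ ι → ℝ} {x : EuclideanSpace ℝ ι} {φ : ℝ → ℝ} (i : ι)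
    (hφ : DifferentiableAt ℝ φ (f x)) (hf : DifferentiableAt ℝ f x) :
    pd i (fun y => φ (f y)) x = deriv φ (f x) * pd i f x := by
  simp only [pd]
  rw [show (fun y => φ (f y)) = φ ∘ f from rfl, fderiv_comp x hφ hf]
  simp [mul_comm]

omit [Nonempty ι] in
lemma pd_bump (i : ι) (x : EuclideanSpace ℝ ι) :
    pd i (fun y => bumpProfile (‖y‖ ^ 2)) x = 2 * x i * deriv bumpProfile (‖x‖ ^ 2) := by
  rw [pd_comp i (bumpProfile_contDiff.differentiable (by simp) _)
    ((contDiff_norm_sq ℝ).differentiable (n := ∞) (by simp) x), pd_norm_sq]; ring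

omit [Nonempty ι] in
-- Integrating `∂_i (q ρ(|x|²))` relates, for a monomial `q`, the spherical mean of `x_i q` to that
-- of `∂_i q`, which has lower degree. The moments follow by induction on the degree.
lemma integral_pd_mul_bump (i : ι) {q : EuclideanSpace ℝ ι → ℝ} (hq : ContDiff ℝ ∞ q) :
    ∫ x, (pd i q x * bumpProfile (‖x‖ ^ 2) +
      2 * (x i * q x) * deriv bumpProfile (‖x‖ ^ 2)) = 0 := by
  have hb : ContDiff ℝ ∞ fun x : EuclideanSpace ℝ ι => bumpProfile (‖x‖ ^ 2) :=
    bumpProfile_contDiff.comp (contDiff_norm_sq ℝ)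
  have hc : HasCompactSupport fun x => q x * bumpProfile (‖x‖ ^ 2) := by
    refine HasCompactSupport.intro (isCompact_closedBall (0 : EuclideanSpace ℝ ι) 2) fun x hx => ?_
    rw [mem_closedBall_zero_iff, not_le] at hx
    rw [bumpProfile_eq_zero (by nlinarith), mul_zero]
  have h := integral_fderiv_eq_zero volume ((hq.mul hb).of_le (by simp)) hc
    (EuclideanSpace.single i 1)
  rw [← h]
  refine integral_congr_ae (.of_forall fun x => ?_)
  have := pd_mul i (hq.differentiable (by simp) x) (hb.differentiable (by simp) x)
  simp only [pd_bump] at this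
  simp only [pd] at this ⊢
  rw [this]; ring

/-- The surface measure of the unit sphere. -/
abbrev sphMeas (ι : Type) [Fintype ι] : Measure (sphere (0 : EuclideanSpace ℝ ι) 1) :=
  (volume : Measure (EuclideanSpace ℝ ι)).toSphere

lemma sum_sphere_sq (u : sphere (0 : EuclideanSpace ℝ ι) 1) : ∑ i, u.1 i * u.1 i = 1 := by
  have h : ‖u.1‖ ^ 2 = 1 := by rw [norm_eq_of_mem_sphere]; norm_num
  rw [EuclideanSpace.real_norm_sq_eq] at h
  refine Eq.trans (Finset.sum_congr rfl fun i _ => ?_) h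
  ring

omit [Nonempty ι] in
lemma integrable_sphere {q : EuclideanSpace ℝ ι → ℝ} (hq : Continuous q) :
    Integrable (fun u : sphere (0 : EuclideanSpace ℝ ι) 1 => q u) (sphMeas ι) :=
  (hq.comp continuous_subtype_val).integrable_of_hasCompactSupport
    (HasCompactSupport.of_compactSpace _)

lemma sphere_real_pos : 0 < (sphMeas ι).real univ := by
  have h : (sphMeas ι) univ ≠ 0 := by
    rw [Ne, Measure.measure_univ_eq_zero]
    exact Measure.toSphere_ne_zero _
  exact ENNReal.toReal_pos h (measure_ne_top _ _)

omit [DecidableEq ι] in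
lemma integral_norm_pow_bump_pos (k : ℕ) :
    0 < ∫ r in Ioi (0 : ℝ), r ^ (Module.finrank ℝ (EuclideanSpace ℝ ι) - 1) *
      (r ^ (2 * k) * bumpProfile (r ^ 2)) := by
  classical
  have hq : Continuous fun x : EuclideanSpace ℝ ι => (‖x‖ ^ 2) ^ k := by fun_prop
  have h := integral_homogeneous_mul_radial (volume : Measure (EuclideanSpace ℝ ι))
    (q := fun x => (‖x‖ ^ 2) ^ k) (2 * k) hq (fun r x => by
      rw [norm_smul, Real.norm_eq_abs, mul_pow, sq_abs, mul_pow, pow_mul])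
    bumpProfile_contDiff.continuous (R := 2) (fun t ht => bumpProfile_eq_zero ht)
  have h1 : ∫ u : sphere (0 : EuclideanSpace ℝ ι) 1, (‖u.1‖ ^ 2) ^ k ∂(sphMeas ι) = (sphMeas ι).real univ := by
    simp
  have hpos : 0 < ∫ x : EuclideanSpace ℝ ι, (‖x‖ ^ 2) ^ k * bumpProfile (‖x‖ ^ 2) := by
    obtain ⟨i⟩ := (inferInstance : Nonempty ι)
    refine Continuous.integral_pos_of_hasCompactSupport_nonneg_nonzero
      (x := EuclideanSpace.single i 1)
      (hq.mul (bumpProfile_contDiff.continuous.comp (continuous_norm.pow 2))) ?_ ?_ ?_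
    · refine HasCompactSupport.intro (isCompact_closedBall (0 : EuclideanSpace ℝ ι) 2)
        fun x hx => ?_
      rw [mem_closedBall_zero_iff, not_le] at hx
      rw [bumpProfile_eq_zero (by nlinarith), mul_zero]
    · exact fun x => mul_nonneg (by positivity) (Real.smoothTransition.nonneg _)
    · simp only [PiLp.norm_single, norm_one, one_pow, one_mul, bumpProfile]
      norm_num [Real.smoothTransition.one]
  rw [h, h1] at hpos
  exact pos_of_mul_pos_right hpos sphere_real_pos.le

/-- Integration by parts with `q = x_j` gives `δ_ij |S| b + M_ij a = 0`. The radial integrals `a`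
and `b` are never evaluated: the trace identity `Σ u_i² = 1` fixes their ratio. -/
lemma moment_two (i j : ι) : (Fintype.card ι : ℝ) *
    ∫ u : sphere (0 : EuclideanSpace ℝ ι) 1, u.1 i * u.1 j ∂(sphMeas ι) = kron i j * (sphMeas ι).real univ := by
  set M : ι → ι → ℝ := fun i j => ∫ u : sphere (0 : EuclideanSpace ℝ ι) 1, u.1 i * u.1 j ∂(sphMeas ι)
    with hM
  set b := ∫ r in Ioi (0 : ℝ), r ^ (Module.finrank ℝ (EuclideanSpace ℝ ι) - 1) *
    (r ^ 0 * bumpProfile (r ^ 2)) with hb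
  set a := ∫ r in Ioi (0 : ℝ), r ^ (Module.finrank ℝ (EuclideanSpace ℝ ι) - 1) *
    (r ^ 2 * (2 * deriv bumpProfile (r ^ 2))) with ha
  have hb0 : 0 < b := integral_norm_pow_bump_pos (ι := ι) 0
  have hd : Continuous (deriv bumpProfile) := bumpProfile_contDiff.continuous_deriv (by simp)
  have cc := fun j : ι => (differentiable_coord j).continuous
  have key : ∀ i j, kron i j * (sphMeas ι).real univ * b + M i j * a = 0 := by
    intro i j
    have h := integral_pd_mul_bump i (contDiff_coord j)
    have h1 := integral_homogeneous_mul_radial (volume : Measure (EuclideanSpace ℝ ι))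
      (q := fun _ => kron i j) 0 continuous_const (fun r x => by simp)
      bumpProfile_contDiff.continuous (R := 2) (fun t ht => bumpProfile_eq_zero ht)
    have h2 := integral_homogeneous_mul_radial (volume : Measure (EuclideanSpace ℝ ι))
      (q := fun x => x i * x j) 2 ((cc i).mul (cc j))
      (fun r x => by simp only [PiLp.smul_apply, smul_eq_mul]; ring)
      (ρ := fun t => 2 * deriv bumpProfile t) (hd.const_mul 2) (R := 3)
      (fun t ht => by rw [deriv_bumpProfile_eq_zero ht, mul_zero])
    have e1 : ∫ u : sphere (0 : EuclideanSpace ℝ ι) 1, kron i j ∂(sphMeas ι) = kron i j * (sphMeas ι).real univ := by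
      simp [mul_comm]
    rw [e1] at h1
    have hi1 := integrable_mul_radial (volume : Measure (EuclideanSpace ℝ ι))
      (q := fun _ => kron i j) continuous_const bumpProfile_contDiff.continuous (R := 2)
      (fun t ht => bumpProfile_eq_zero ht)
    have hi2 := integrable_mul_radial (volume : Measure (EuclideanSpace ℝ ι))
      (q := fun x => x i * x j) ((cc i).mul (cc j)) (ρ := fun t => 2 * deriv bumpProfile t)
      (hd.const_mul 2) (R := 3) (fun t ht => by rw [deriv_bumpProfile_eq_zero ht, mul_zero])
    rw [← h1, ← h2, ← integral_add hi1 hi2, ← h]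
    refine integral_congr_ae (.of_forall fun x => ?_)
    simp only [pd_coord]; ring
  have hsum : ∑ i, M i i = (sphMeas ι).real univ := by
    simp only [hM]
    rw [← integral_finsetSum _ fun i _ => integrable_sphere (q := fun x => x i * x i)
      ((cc i).mul (cc i))]
    simp [sum_sphere_sq]
  have ht : ∑ i, (kron i i * (sphMeas ι).real univ * b + M i i * a) = 0 :=
    Finset.sum_eq_zero fun i _ => key i i
  rw [Finset.sum_add_distrib, ← Finset.sum_mul, ← Finset.sum_mul, ← Finset.sum_mul, hsum] at ht
  simp only [kron_self, Finset.sum_const, Finset.card_univ, nsmul_eq_mul] at ht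
  have hs : 0 < (sphMeas ι).real univ := sphere_real_pos
  have ha' : a = -(Fintype.card ι * b) := by
    have : (sphMeas ι).real univ * (Fintype.card ι * b + a) = 0 := by linarith
    rcases mul_eq_zero.1 this with h | h
    · exact absurd h hs.ne'
    · linarith
  have := key i j
  rw [ha'] at this
  have h2 : b * ((Fintype.card ι : ℝ) * M i j - kron i j * (sphMeas ι).real univ) = 0 := by linarith
  rcases mul_eq_zero.1 h2 with h | h
  · exact absurd h hb0.ne'
  · linarith

/-- The same argument with `q = x_j x_p x_r` expresses fourth moments through second ones.
Contracting one pair of indices fixes the ratio of the radial integrals. -/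
lemma moment_four (i j p r : ι) : (Fintype.card ι : ℝ) * (Fintype.card ι + 2) *
    ∫ u : sphere (0 : EuclideanSpace ℝ ι) 1, u.1 i * u.1 j * u.1 p * u.1 r ∂(sphMeas ι) =
    (kron i j * kron p r + kron i p * kron j r + kron i r * kron j p) * (sphMeas ι).real univ := by
  set M : ι → ι → ℝ := fun i j => ∫ u : sphere (0 : EuclideanSpace ℝ ι) 1, u.1 i * u.1 j ∂(sphMeas ι)
    with hM
  set N : ι → ι → ι → ι → ℝ := fun i j p r =>
    ∫ u : sphere (0 : EuclideanSpace ℝ ι) 1, u.1 i * u.1 j * u.1 p * u.1 r ∂(sphMeas ι) with hN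
  have hM2 : ∀ i j, (Fintype.card ι : ℝ) * M i j = kron i j * (sphMeas ι).real univ := moment_two
  set b := ∫ r in Ioi (0 : ℝ), r ^ (Module.finrank ℝ (EuclideanSpace ℝ ι) - 1) *
    (r ^ 2 * bumpProfile (r ^ 2)) with hb
  set a := ∫ r in Ioi (0 : ℝ), r ^ (Module.finrank ℝ (EuclideanSpace ℝ ι) - 1) *
    (r ^ 4 * (2 * deriv bumpProfile (r ^ 2))) with ha
  have hb0 : 0 < b := integral_norm_pow_bump_pos (ι := ι) 1
  have hd : Continuous (deriv bumpProfile) := bumpProfile_contDiff.continuous_deriv (by simp)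
  have cc := fun j : ι => (differentiable_coord j).continuous
  have key : ∀ i j p r, (kron i j * M p r + kron i p * M j r + kron i r * M j p) * b +
      N i j p r * a = 0 := by
    intro i j p r
    have h := integral_pd_mul_bump i
      (((contDiff_coord j).mul (contDiff_coord p)).mul (contDiff_coord r))
    have h1 := integral_homogeneous_mul_radial (volume : Measure (EuclideanSpace ℝ ι))
      (q := fun x => kron i j * (x p * x r) + kron i p * (x j * x r) + kron i r * (x j * x p)) 2
      (by have := cc j; have := cc p; have := cc r; fun_prop)
      (fun r x => by simp only [PiLp.smul_apply, smul_eq_mul]; ring)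
      bumpProfile_contDiff.continuous (R := 2) (fun t ht => bumpProfile_eq_zero ht)
    have h2 := integral_homogeneous_mul_radial (volume : Measure (EuclideanSpace ℝ ι))
      (q := fun x => x i * x j * x p * x r) 4 ((((cc i).mul (cc j)).mul (cc p)).mul (cc r))
      (fun r x => by simp only [PiLp.smul_apply, smul_eq_mul]; ring)
      (ρ := fun t => 2 * deriv bumpProfile t) (hd.const_mul 2) (R := 3)
      (fun t ht => by rw [deriv_bumpProfile_eq_zero ht, mul_zero])
    have e1 : ∫ u : sphere (0 : EuclideanSpace ℝ ι) 1, (kron i j * (u.1 p * u.1 r) +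
        kron i p * (u.1 j * u.1 r) + kron i r * (u.1 j * u.1 p)) ∂(sphMeas ι) =
        kron i j * M p r + kron i p * M j r + kron i r * M j p := by
      have I := fun a b : ι => integrable_sphere (q := fun x => x a * x b) ((cc a).mul (cc b))
      rw [integral_add (((I p r).const_mul _).fun_add ((I j r).const_mul _)) ((I j p).const_mul _),
        integral_add ((I p r).const_mul _) ((I j r).const_mul _), integral_const_mul,
        integral_const_mul, integral_const_mul]
    rw [e1] at h1
    have hi1 := integrable_mul_radial (volume : Measure (EuclideanSpace ℝ ι))
      (q := fun x => kron i j * (x p * x r) + kron i p * (x j * x r) + kron i r * (x j * x p))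
      (by have := cc j; have := cc p; have := cc r; fun_prop)
      bumpProfile_contDiff.continuous (R := 2) (fun t ht => bumpProfile_eq_zero ht)
    have hi2 := integrable_mul_radial (volume : Measure (EuclideanSpace ℝ ι))
      (q := fun x => x i * x j * x p * x r) ((((cc i).mul (cc j)).mul (cc p)).mul (cc r))
      (ρ := fun t => 2 * deriv bumpProfile t) (hd.const_mul 2) (R := 3)
      (fun t ht => by rw [deriv_bumpProfile_eq_zero ht, mul_zero])
    rw [← h1, ← h2, ← integral_add hi1 hi2, ← h]
    refine integral_congr_ae (.of_forall fun x => ?_)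
    have d := fun j => differentiable_coord (ι := ι) j x
    simp only [pd_mul i ((d _).fun_mul (d _)) (d _), pd_mul i (d _) (d _), pd_coord]; ring
  obtain ⟨m⟩ := (inferInstance : Nonempty ι)
  have hsum : ∑ i, N i i m m = M m m := by
    simp only [hN, hM]
    rw [← integral_finsetSum _ fun i _ => integrable_sphere
      (q := fun x => x i * x i * x m * x m) ((((cc i).mul (cc i)).mul (cc m)).mul (cc m))]
    simp only [← Finset.sum_mul, sum_sphere_sq, one_mul]
  have ht : ∑ i, ((kron i i * M m m + kron i m * M i m + kron i m * M i m) * b +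
      N i i m m * a) = 0 := Finset.sum_eq_zero fun i _ => key i i m m
  rw [Finset.sum_add_distrib, ← Finset.sum_mul, ← Finset.sum_mul, hsum] at ht
  simp only [kron_self, one_mul, Finset.sum_add_distrib, sum_kron_mul', Finset.sum_const,
    Finset.card_univ, nsmul_eq_mul] at ht
  have hs : 0 < (sphMeas ι).real univ := sphere_real_pos
  have hMm : M m m ≠ 0 := by
    intro h0
    have := hM2 m m
    rw [h0, kron_self] at this
    linarith
  have ha' : a = -((Fintype.card ι + 2) * b) := by
    have : M m m * ((Fintype.card ι + 2) * b + a) = 0 := by linarith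
    rcases mul_eq_zero.1 this with h | h
    · exact absurd h hMm
    · linarith
  have := key i j p r
  rw [ha'] at this
  have h2 : b * (((Fintype.card ι : ℝ) + 2) * N i j p r -
      (kron i j * M p r + kron i p * M j r + kron i r * M j p)) = 0 := by linarith
  rcases mul_eq_zero.1 h2 with h | h
  · exact absurd h hb0.ne'
  · have e := congrArg (fun t => (Fintype.card ι : ℝ) * t) h
    simp only [mul_zero] at e
    have := hM2 p r
    have := hM2 j r
    have := hM2 j p
    calc _ = (Fintype.card ι : ℝ) * (((Fintype.card ι : ℝ) + 2) * N i j p r -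
          (kron i j * M p r + kron i p * M j r + kron i r * M j p)) +
          (kron i j * (Fintype.card ι * M p r) + kron i p * (Fintype.card ι * M j r) +
            kron i r * (Fintype.card ι * M j p)) := by ring
      _ = _ := by rw [e, hM2, hM2, hM2]; ring

end Moments

/-! ### Spherical mean of the form `R(x, Jx, x, Jx)` -/

section SphereAverage

open Metric Set

variable {n : ℕ} {Λ : ℝ} {U : Set (Cn n)} {g₀ : TwoTensor (Idx n)}

lemma continuous_holSect : Continuous (holSect g₀) := by
  have : holSect g₀ = fun x => ∑ i, ∑ j, ∑ p, ∑ r,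
      (∑ k, ∑ l, riemann g₀ 0 i k j l * kahler p k * kahler r l) * (x i * x j * x p * x r) :=
    funext holSect_eq_quartic
  rw [this]
  fun_prop

/-- The factor is `d (d + 2)` with `d = 2n`. -/
lemma integral_quartic (hn : 0 < n) (c : Idx n → Idx n → Idx n → Idx n → ℝ) :
    4 * n * ((n : ℝ) + 1) * ∫ u : sphere (0 : Cn n) 1,
      ∑ i, ∑ j, ∑ p, ∑ r, c i j p r * (u.1 i * u.1 j * u.1 p * u.1 r)
      ∂(volume : Measure (Cn n)).toSphere =
    (∑ i, ∑ j, ∑ p, ∑ r, c i j p r *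
      (kron i j * kron p r + kron i p * kron j r + kron i r * kron j p)) * sphereArea n := by
  have : Nonempty (Idx n) := ⟨(⟨0, hn⟩, 0)⟩
  have cc := fun j : Idx n => (differentiable_coord j).continuous
  have hint : ∀ c : ℝ, ∀ i j p r : Idx n, Integrable
      (fun u : sphere (0 : Cn n) 1 => c * (u.1 i * u.1 j * u.1 p * u.1 r)) (sphMeas (Idx n)) :=
    fun c i j p r => integrable_sphere (q := fun x => c * (x i * x j * x p * x r))
      (continuous_const.mul ((((cc i).mul (cc j)).mul (cc p)).mul (cc r)))
  rw [integral_finsetSum _ fun i _ => integrable_finsetSum _ fun j _ => integrable_finsetSum _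
    fun p _ => integrable_finsetSum _ fun r _ => hint _ i j p r, Finset.mul_sum, Finset.sum_mul]
  refine Finset.sum_congr rfl fun i _ => ?_
  rw [integral_finsetSum _ fun j _ => integrable_finsetSum _
    fun p _ => integrable_finsetSum _ fun r _ => hint _ i j p r, Finset.mul_sum, Finset.sum_mul]
  refine Finset.sum_congr rfl fun j _ => ?_
  rw [integral_finsetSum _ fun p _ => integrable_finsetSum _ fun r _ => hint _ i j p r,
    Finset.mul_sum, Finset.sum_mul]
  refine Finset.sum_congr rfl fun p _ => ?_
  rw [integral_finsetSum _ fun r _ => hint _ i j p r, Finset.mul_sum, Finset.sum_mul]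
  refine Finset.sum_congr rfl fun r _ => ?_
  rw [integral_const_mul]
  have h := moment_four i j p r
  rw [card_Idx] at h
  have hs : (sphMeas (Idx n)).real univ = sphereArea n := rfl
  rw [hs] at h
  rw [mul_assoc _ _ (sphereArea n), ← h]
  ring

theorem integral_holSect (hn : 0 < n) (hU : IsOpen U) (h0U : (0 : Cn n) ∈ U)
    (hE : IsEinsteinOn U g₀ Λ) (hδ : g₀ 0 = euclMetric (0 : Cn n)) :
    4 * n * ((n : ℝ) + 1) * ∫ u : sphere (0 : Cn n) 1, holSect g₀ u
      ∂(volume : Measure (Cn n)).toSphere =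
    (2 * n * Λ + 3 / 2 * curvOmega g₀) * sphereArea n := by
  rw [← holSect_contraction hU h0U hE hδ]
  simp only [holSect_eq_quartic]
  exact integral_quartic hn fun i j p r =>
    ∑ k, ∑ l, riemann g₀ 0 i k j l * kahler p k * kahler r l

end SphereAverage


/-! ### The Calabi metric in Cartesian coordinates -/

section CalabiFormulas

variable {n : ℕ} {x : Cn n}

/-- `f = 1 / (1 + r^{2n})`. -/
def fF (n : ℕ) (x : Cn n) : ℝ := 1 / (1 + (‖x‖ ^ 2) ^ n)

/-- `α = (1 + r^{2n})^{1/n} / r²`. -/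
def aF (n : ℕ) (x : Cn n) : ℝ := (1 + (‖x‖ ^ 2) ^ n) ^ ((1 : ℝ) / n) / ‖x‖ ^ 2

/-- `x_i x_j + y_i y_j` with `y = J x`. -/
def piF (x : Cn n) (i j : Idx n) : ℝ := x i * x j + cstr x i * cstr x j

lemma normSq_pos (hx : x ≠ 0) : 0 < ‖x‖ ^ 2 := by positivity

lemma fF_pos (x : Cn n) : 0 < fF n x := by unfold fF; positivity

lemma fF_lt_one (hx : x ≠ 0) : fF n x < 1 := by
  have := normSq_pos hx
  unfold fF
  rw [div_lt_one (by positivity)]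
  linarith [pow_pos this n]

lemma one_sub_fF (x : Cn n) : 1 - fF n x = (‖x‖ ^ 2) ^ n * fF n x := by
  have : 1 + (‖x‖ ^ 2) ^ n ≠ 0 := by positivity
  unfold fF; field_simp; ring

lemma aF_pos (hx : x ≠ 0) : 0 < aF n x := by
  have := normSq_pos hx
  unfold aF; positivity

/-- The Monge–Ampère relation behind `det g_cal = 1`. -/
lemma aF_pow (hn : 0 < n) (hx : x ≠ 0) : aF n x ^ n * (1 - fF n x) = 1 := by
  have hs := normSq_pos hx
  have hq : 0 < 1 + (‖x‖ ^ 2) ^ n := by positivity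
  have : ((1 + (‖x‖ ^ 2) ^ n) ^ ((1 : ℝ) / n)) ^ n = 1 + (‖x‖ ^ 2) ^ n := by
    rw [← Real.rpow_natCast, ← Real.rpow_mul hq.le, one_div_mul_cancel (by positivity),
      Real.rpow_one]
  rw [one_sub_fF, aF, div_pow, this, fF]
  field_simp

lemma coefA_sq (hn : 0 < n) (hx : x ≠ 0) :
    coefA n ‖x‖ ^ 2 = aF n x * (1 - fF n x) := by
  have hs : 0 < ‖x‖ := by positivity
  obtain ⟨m, rfl⟩ : ∃ m, n = m + 1 := ⟨n - 1, by omega⟩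
  set q := 1 + (‖x‖ ^ 2) ^ (m + 1) with hqd
  have hq : 0 < q := by positivity
  have h1 : (q ^ ((((m + 1 : ℕ) : ℝ) - 1) / (2 * (m + 1 : ℕ)))) ^ 2 *
      q ^ ((1 : ℝ) / (m + 1 : ℕ)) = q := by
    rw [← Real.rpow_natCast, ← Real.rpow_mul hq.le, ← Real.rpow_add hq]
    conv_rhs => rw [← Real.rpow_one q]
    congr 1
    have : ((m + 1 : ℕ) : ℝ) ≠ 0 := by positivity
    field_simp
    push_cast; ring
  rw [one_sub_fF, coefA, aF, fF, pow_mul, ← hqd, div_pow]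
  have h2 : 0 < q ^ ((((m + 1 : ℕ) : ℝ) - 1) / (2 * (m + 1 : ℕ))) := Real.rpow_pos_of_pos hq _
  have h3 : 0 < q ^ ((1 : ℝ) / (m + 1 : ℕ)) := Real.rpow_pos_of_pos hq _
  set u := q ^ ((((m + 1 : ℕ) : ℝ) - 1) / (2 * (m + 1 : ℕ)))
  set v := q ^ ((1 : ℝ) / (m + 1 : ℕ))
  rw [← h1]
  simp only [add_tsub_cancel_right]
  field_simp
  ring

lemma coefC_sq (hn : 0 < n) (hx : x ≠ 0) :
    coefC n ‖x‖ ^ 2 = ‖x‖ ^ 2 * (aF n x * (1 - fF n x)) := by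
  have hs : 0 < ‖x‖ := by positivity
  have hA : coefC n ‖x‖ = ‖x‖ * coefA n ‖x‖ := by
    have hq : 0 < 1 + ‖x‖ ^ (2 * n) := by positivity
    have e : (1 - (n : ℝ)) / (2 * n) = -(((n : ℝ) - 1) / (2 * n)) := by ring
    rw [coefC, coefA, e, Real.rpow_neg hq.le]
    obtain ⟨m, rfl⟩ : ∃ m, n = m + 1 := ⟨n - 1, by omega⟩
    simp only [add_tsub_cancel_right, pow_succ]
    ring
  rw [hA, mul_pow, coefA_sq hn hx]

lemma coefB_eq (hx : x ≠ 0) : coefB n ‖x‖ = ‖x‖ ^ 2 * aF n x := by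
  have hs := normSq_pos hx
  rw [coefB, aF, pow_mul]; field_simp

/-- In this form the metric has eigenvalue `a (1 - f)` on the complex line of `x` and `a` on its
orthogonal complement. -/
lemma calabi_apply (hn : 0 < n) (hx : x ≠ 0) (i j : Idx n) :
    calabi n x i j = aF n x * (kron i j - fF n x / ‖x‖ ^ 2 * piF x i j) := by
  have hs : ‖x‖ ≠ 0 := norm_ne_zero_iff.2 hx
  rw [calabi, coefA_sq hn hx, coefC_sq hn hx, coefB_eq hx]
  simp only [fubiniStudy, drForm, thetaForm, piF]
  field_simp; ring

lemma oTensor_apply (hn : 0 < n) (hx : x ≠ 0) (i j : Idx n) :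
    oTensor n x i j = aF n x * fF n x *
      (-kron i j + (n - (n - 1) * fF n x) / ‖x‖ ^ 2 * piF x i j) := by
  have hs : ‖x‖ ≠ 0 := norm_ne_zero_iff.2 hx
  have hf : 1 / (1 + ‖x‖ ^ (2 * n)) = fF n x := by rw [fF, pow_mul]
  rw [oTensor, hf, coefA_sq hn hx, coefC_sq hn hx, coefB_eq hx]
  simp only [fubiniStudy, drForm, thetaForm, piF]
  field_simp; ring

/-! #### Derivatives -/

lemma pd_radial {φ : ℝ → ℝ} {φ' : ℝ} (h : HasDerivAt φ φ' (‖x‖ ^ 2)) (k : Idx n) :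
    pd k (fun y => φ (‖y‖ ^ 2)) x = φ' * (2 * x k) := by
  rw [pd_comp k h.differentiableAt ((contDiff_norm_sq ℝ).differentiable (n := ∞) (by simp) x),
    h.deriv, pd_norm_sq]

/-- With `t = log r²` this is the logistic equation `f' = -n f (1 - f)`, and the derivative of `a`
below is `(log a)' = -f`. Rational expressions in `f`, `a`, `r²` are thus closed under
differentiation, and later identities reduce to `field_simp` and `ring`. -/
lemma pd_fF (hn : 0 < n) (hx : x ≠ 0) (k : Idx n) :
    pd k (fF n) x = -(2 * n * fF n x * (1 - fF n x) / ‖x‖ ^ 2) * x k := by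
  have hs := normSq_pos hx
  have hq : 1 + (‖x‖ ^ 2) ^ n ≠ 0 := by positivity
  have h : HasDerivAt (fun t : ℝ => 1 / (1 + t ^ n))
      (-(n * (‖x‖ ^ 2) ^ (n - 1)) / (1 + (‖x‖ ^ 2) ^ n) ^ 2) (‖x‖ ^ 2) := by
    have := (((hasDerivAt_pow n (‖x‖ ^ 2)).const_add 1).fun_inv hq)
    simpa [one_div] using this
  have e : fF n = fun y => (fun t : ℝ => 1 / (1 + t ^ n)) (‖y‖ ^ 2) := rfl
  rw [one_sub_fF, e, pd_radial h]
  obtain ⟨m, rfl⟩ : ∃ m, n = m + 1 := ⟨n - 1, by omega⟩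
  simp only [add_tsub_cancel_right]
  field_simp
  ring

lemma pd_aF (hn : 0 < n) (hx : x ≠ 0) (k : Idx n) :
    pd k (aF n) x = -(2 * fF n x * aF n x / ‖x‖ ^ 2) * x k := by
  have hs := normSq_pos hx
  have hq : 0 < 1 + (‖x‖ ^ 2) ^ n := by positivity
  have h : HasDerivAt (fun t : ℝ => (1 + t ^ n) ^ ((1 : ℝ) / n) / t)
      ((((n : ℝ) * (‖x‖ ^ 2) ^ (n - 1)) * ((1 : ℝ) / n) *
        (1 + (‖x‖ ^ 2) ^ n) ^ ((1 : ℝ) / n - 1) * (‖x‖ ^ 2) -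
        (1 + (‖x‖ ^ 2) ^ n) ^ ((1 : ℝ) / n) * 1) / (‖x‖ ^ 2) ^ 2) (‖x‖ ^ 2) :=
    (((hasDerivAt_pow n (‖x‖ ^ 2)).const_add 1).rpow_const (Or.inl hq.ne')).fun_div
      (hasDerivAt_id _) hs.ne'
  have e : aF n = fun y => (fun t : ℝ => (1 + t ^ n) ^ ((1 : ℝ) / n) / t) (‖y‖ ^ 2) := rfl
  rw [e, pd_radial h, Real.rpow_sub_one hq.ne', fF]
  have hn' : (n : ℝ) ≠ 0 := by positivity
  obtain ⟨m, rfl⟩ : ∃ m, n = m + 1 := ⟨n - 1, by omega⟩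
  simp only [add_tsub_cancel_right]
  field_simp
  ring

lemma contDiff_cstr (j : Idx n) : ContDiff ℝ ∞ fun y : Cn n => cstr y j := by
  simp only [cstr_eq_sum]
  exact ContDiff.sum fun i _ => contDiff_const.mul (contDiff_coord i)

lemma pd_cstr (k j : Idx n) : pd k (fun y : Cn n => cstr y j) x = kahler k j := by
  simp only [cstr_eq_sum]
  exact pd_linear (fun i => kahler i j) k

lemma contDiffOn_normSq (S : Set (Cn n)) : ContDiffOn ℝ ∞ (fun y : Cn n => ‖y‖ ^ 2) S :=
  (contDiff_norm_sq ℝ).contDiffOn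

lemma contDiffOn_fF : ContDiffOn ℝ ∞ (fF n) {x : Cn n | x ≠ 0} := by
  unfold fF
  exact contDiffOn_const.div (contDiffOn_const.add ((contDiffOn_normSq _).pow n))
    fun x _ => by positivity

lemma contDiffOn_aF : ContDiffOn ℝ ∞ (aF n) {x : Cn n | x ≠ 0} := by
  unfold aF
  exact ((contDiffOn_const.add ((contDiffOn_normSq _).pow n)).rpow_const_of_ne
    fun x _ => by positivity).div (contDiffOn_normSq _) fun x hx => (normSq_pos hx).ne'

lemma contDiff_piF (i j : Idx n) : ContDiff ℝ ∞ fun y : Cn n => piF y i j :=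
  ((contDiff_coord i).mul (contDiff_coord j)).add ((contDiff_cstr i).mul (contDiff_cstr j))

lemma pd_piF (k i j : Idx n) : pd k (fun y : Cn n => piF y i j) x =
    kron k i * x j + x i * kron k j + (kahler k i * cstr x j + cstr x i * kahler k j) := by
  have d := fun i => differentiable_coord (ι := Idx n) i x
  have d' := fun i => (contDiff_cstr (n := n) i).differentiable (by simp) x
  simp only [piF]
  rw [pd_add k ((d i).fun_mul (d j)) ((d' i).fun_mul (d' j)), pd_mul k (d i) (d j),
    pd_mul k (d' i) (d' j)]
  simp only [pd_coord, pd_cstr]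

end CalabiFormulas


/-! ### Inverse, determinant and Christoffel symbols of the Calabi metric -/

section CalabiConnection

variable {n : ℕ} {x : Cn n}

open Matrix

/-- The complement of the zero section, as a subset of `ℂⁿ`. -/
def puncture (n : ℕ) : Set (Cn n) := {x : Cn n | x ≠ 0}

lemma isOpen_puncture : IsOpen (puncture n) := isOpen_ne

/-- The matrix `x xᵀ + y yᵀ`, with `y = J x`. -/
def piM (x : Cn n) : Matrix (Idx n) (Idx n) ℝ := Matrix.of (piF x)

lemma piF_symm (i j : Idx n) : piF x i j = piF x j i := by simp only [piF]; ring

lemma sum_mul_piF (j : Idx n) : ∑ i, x i * piF x i j = ‖x‖ ^ 2 * x j := by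
  simp only [piF, mul_add, Finset.sum_add_distrib, ← mul_assoc, ← Finset.sum_mul, sum_mul_self,
    sum_mul_cstr]; ring

lemma sum_cstr_mul_piF (j : Idx n) : ∑ i, cstr x i * piF x i j = ‖x‖ ^ 2 * cstr x j := by
  have : ∑ i, cstr x i * x i = 0 := by
    rw [← sum_mul_cstr x]; exact Finset.sum_congr rfl fun i _ => mul_comm _ _
  simp only [piF, mul_add, Finset.sum_add_distrib, ← mul_assoc, ← Finset.sum_mul,
    sum_cstr_mul_self, this]; ring

lemma piM_mul_piM : piM x * piM x = ‖x‖ ^ 2 • piM x := by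
  ext i j
  have : ∀ k, piF x i k * piF x k j =
      x i * (x k * piF x k j) + cstr x i * (cstr x k * piF x k j) := fun k => by
    simp only [piF]; ring
  simp only [piM, Matrix.mul_apply, Matrix.of_apply, this, Finset.sum_add_distrib,
    ← Finset.mul_sum, sum_mul_piF, sum_cstr_mul_piF, Matrix.smul_apply, smul_eq_mul]
  simp only [piF]; ring

lemma trace_piM : (piM x).trace = 2 * ‖x‖ ^ 2 := by
  simp only [Matrix.trace, Matrix.diag, piM, Matrix.of_apply, piF, Finset.sum_add_distrib,
    sum_mul_self, norm_cstr_sq]; ring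

lemma trace_one_Idx : (1 : Matrix (Idx n) (Idx n) ℝ).trace = 2 * n := by
  rw [Matrix.trace_one, card_Idx]

lemma tMat_calabi (hn : 0 < n) (hx : x ≠ 0) :
    tMat (calabi n) x = aF n x • (1 - (fF n x / ‖x‖ ^ 2) • piM x) := by
  ext i j
  simp [tMat_apply, calabi_apply hn hx, piM, kron_eq_one_apply]

lemma tMat_oTensor (hn : 0 < n) (hx : x ≠ 0) : tMat (oTensor n) x =
    (aF n x * fF n x) • (-1 + ((n - (n - 1) * fF n x) / ‖x‖ ^ 2) • piM x) := by
  ext i j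
  simp [tMat_apply, oTensor_apply hn hx, piM, kron_eq_one_apply]

/-- As `π² = r² π`, the span of `1` and `π` is a commutative algebra. It contains the metric, its
inverse and `o`. -/
lemma smul_one_add_piM_mul (a b c d : ℝ) :
    (a • (1 : Matrix (Idx n) (Idx n) ℝ) + b • piM x) * (c • 1 + d • piM x) =
      (a * c) • 1 + (a * d + b * c + b * d * ‖x‖ ^ 2) • piM x := by
  simp only [Matrix.add_mul, Matrix.mul_add, Matrix.smul_mul, Matrix.mul_smul, Matrix.one_mul,
    Matrix.mul_one, piM_mul_piM, smul_smul, add_smul]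
  module

lemma tMat_calabi' (hn : 0 < n) (hx : x ≠ 0) : tMat (calabi n) x =
    aF n x • 1 + (-(aF n x * (fF n x / ‖x‖ ^ 2))) • piM x := by
  rw [tMat_calabi hn hx]; module

lemma tMat_oTensor' (hn : 0 < n) (hx : x ≠ 0) : tMat (oTensor n) x =
    (-(aF n x * fF n x)) • 1 +
      (aF n x * fF n x * ((n - (n - 1) * fF n x) / ‖x‖ ^ 2)) • piM x := by
  rw [tMat_oTensor hn hx]; module

lemma calabi_mul_inverse (hn : 0 < n) (hx : x ≠ 0) : tMat (calabi n) x *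
    ((aF n x)⁻¹ • 1 + ((aF n x)⁻¹ * (fF n x / (1 - fF n x) / ‖x‖ ^ 2)) • piM x) = 1 := by
  have hs := (normSq_pos hx).ne'
  have ha := (aF_pos (n := n) hx).ne'
  have hf : 1 - fF n x ≠ 0 := (sub_pos.2 (fF_lt_one hx)).ne'
  rw [tMat_calabi' hn hx, smul_one_add_piM_mul]
  have h1 : aF n x * (aF n x)⁻¹ = 1 := mul_inv_cancel₀ ha
  have h2 : aF n x * ((aF n x)⁻¹ * (fF n x / (1 - fF n x) / ‖x‖ ^ 2)) +
      -(aF n x * (fF n x / ‖x‖ ^ 2)) * (aF n x)⁻¹ + -(aF n x * (fF n x / ‖x‖ ^ 2)) *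
      ((aF n x)⁻¹ * (fF n x / (1 - fF n x) / ‖x‖ ^ 2)) * ‖x‖ ^ 2 = 0 := by
    field_simp; ring
  rw [h1, h2]; simp

lemma inv_calabi (hn : 0 < n) (hx : x ≠ 0) : (tMat (calabi n) x)⁻¹ =
    (aF n x)⁻¹ • 1 + ((aF n x)⁻¹ * (fF n x / (1 - fF n x) / ‖x‖ ^ 2)) • piM x :=
  Matrix.inv_eq_right_inv (calabi_mul_inverse hn hx)

lemma smooth_calabi (hn : 0 < n) : SmoothMatOn (puncture n) (tMat (calabi n)) := by
  intro i j
  have h : ContDiffOn ℝ ∞ (fun x => aF n x * (kron i j - fF n x / ‖x‖ ^ 2 * piF x i j))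
      (puncture n) :=
    contDiffOn_aF.mul (contDiffOn_const.sub ((contDiffOn_fF.div (contDiffOn_normSq _)
      fun x hx => (normSq_pos hx).ne').mul (contDiff_piF i j).contDiffOn))
  exact h.congr fun x hx => calabi_apply hn hx i j

lemma smooth_oTensor (hn : 0 < n) : SmoothMatOn (puncture n) (tMat (oTensor n)) := by
  intro i j
  have h : ContDiffOn ℝ ∞ (fun x => aF n x * fF n x *
      (-kron i j + (n - (n - 1) * fF n x) / ‖x‖ ^ 2 * piF x i j)) (puncture n) :=
    (contDiffOn_aF.mul contDiffOn_fF).mul (contDiffOn_const.add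
      (((contDiffOn_const.sub (contDiffOn_const.mul contDiffOn_fF)).div (contDiffOn_normSq _)
      fun x hx => (normSq_pos hx).ne').mul (contDiff_piF i j).contDiffOn))
  exact h.congr fun x hx => oTensor_apply hn hx i j

lemma calabi_nondegenerate (hn : 0 < n) : IsNondegenerateOn (puncture n) (calabi n) where
  smooth := smooth_calabi hn
  symm x hx i j := by
    rw [calabi_apply hn hx, calabi_apply hn hx, kron_comm, piF_symm]
  det x hx := Matrix.isUnit_det_of_right_inverse (calabi_mul_inverse hn hx)

lemma oTensor_symm (hn : 0 < n) : ∀ y ∈ puncture n, ∀ i j, oTensor n y i j = oTensor n y j i :=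
  fun x hx i j => by rw [oTensor_apply hn hx, oTensor_apply hn hx, kron_comm, piF_symm]

/-- Sylvester's determinant identity for the rank-two term reduces to a `2 × 2` determinant. It
yields `a^{2n} (1 - f)²`, which is `1` by `aF_pow`. -/
lemma det_calabi (hn : 0 < n) (hx : x ≠ 0) : (tMat (calabi n) x).det = 1 := by
  have hs := (normSq_pos hx).ne'
  set c := -(fF n x / ‖x‖ ^ 2) with hc
  set A : Matrix (Idx n) (Fin 2) ℝ := Matrix.of fun i b => if b = 0 then x i else cstr x i with hA
  have h1 : tMat (calabi n) x = aF n x • (1 + (c • A) * Aᵀ) := by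
    rw [tMat_calabi hn hx]
    congr 1
    rw [sub_eq_add_neg, hc]
    congr 1
    ext i j
    simp [Matrix.mul_apply, hA, piM, piF, Fin.sum_univ_two]
    ring
  have h2 : Aᵀ * (c • A) = (-fF n x) • (1 : Matrix (Fin 2) (Fin 2) ℝ) := by
    have hyx : ∑ i, cstr x i * x i = 0 := by
      rw [← sum_mul_cstr x]; exact Finset.sum_congr rfl fun i _ => mul_comm _ _
    rw [Matrix.mul_smul]
    ext a b
    fin_cases a <;> fin_cases b <;>
      simp [Matrix.mul_apply, hA, sum_mul_self, norm_cstr_sq, sum_mul_cstr, hyx, hc, hs]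
  rw [h1, Matrix.det_smul, Matrix.det_one_add_mul_comm, h2]
  have h3 : (1 + (-fF n x) • (1 : Matrix (Fin 2) (Fin 2) ℝ)).det = (1 - fF n x) ^ 2 := by
    rw [Matrix.det_fin_two]
    simp
    ring
  have h4 : Fintype.card (Idx n) = n * 2 := by simp [Idx]
  rw [h3, h4, pow_mul, ← mul_pow, aF_pow hn hx, one_pow]

lemma volDensity_calabi (hn : 0 < n) (hx : x ≠ 0) : volDensity (calabi n) x = 1 := by
  have := det_calabi hn hx
  rw [tMat] at this
  rw [volDensity, this, Real.sqrt_one]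

lemma pd_calabi (hn : 0 < n) (hx : x ≠ 0) (k i j : Idx n) :
    pd k (fun y => calabi n y i j) x = aF n x * (
      -(2 * fF n x / ‖x‖ ^ 2) * x k * kron i j +
      2 * fF n x * ((n + 1) - (n - 1) * fF n x) / (‖x‖ ^ 2) ^ 2 * x k * piF x i j -
      fF n x / ‖x‖ ^ 2 * (kron k i * x j + x i * kron k j +
        (kahler k i * cstr x j + cstr x i * kahler k j))) := by
  have hs := (normSq_pos hx).ne'
  have hS := isOpen_puncture (n := n)
  have da := diffAt_of_contDiffOn hS contDiffOn_aF hx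
  have df := diffAt_of_contDiffOn hS contDiffOn_fF hx
  have ds : DifferentiableAt ℝ (fun y : Cn n => ‖y‖ ^ 2) x :=
    (contDiff_norm_sq ℝ).differentiable (n := ∞) (by simp) x
  have di : DifferentiableAt ℝ (fun y : Cn n => (‖y‖ ^ 2)⁻¹) x := ds.fun_inv hs
  have dp := (contDiff_piF (n := n) i j).differentiable (by simp) x
  have pi : pd k (fun y : Cn n => (‖y‖ ^ 2)⁻¹) x = -(1 / (‖x‖ ^ 2) ^ 2) * (2 * x k) := by
    refine pd_radial (φ := fun t => t⁻¹) ?_ k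
    simpa [one_div] using hasDerivAt_inv hs
  rw [pd_congr_on k hS hx
    (g := fun y => aF n y * (kron i j - fF n y * (‖y‖ ^ 2)⁻¹ * piF y i j))
    fun y hy => by simp only; rw [calabi_apply hn hy]; ring,
    pd_mul k da ((differentiableAt_const _).fun_sub ((df.fun_mul di).fun_mul dp)),
    pd_sub k (differentiableAt_const _) ((df.fun_mul di).fun_mul dp), pd_const,
    pd_mul k (df.fun_mul di) dp, pd_mul k df di, pi, pd_fF hn hx, pd_aF hn hx, pd_piF]
  field_simp
  ring

/-- The origin of `o`: it is the variation of the Calabi metric under dilation, up to the factor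
two. -/
lemma eul_calabi (hn : 0 < n) (hx : x ≠ 0) (i j : Idx n) :
    eul (fun y => calabi n y i j) x = 2 * oTensor n x i j := by
  have hs := (normSq_pos hx).ne'
  have e : ∀ k, x k * pd k (fun y => calabi n y i j) x = aF n x * (
      (-(2 * fF n x / ‖x‖ ^ 2) * kron i j +
      2 * fF n x * ((n + 1) - (n - 1) * fF n x) / (‖x‖ ^ 2) ^ 2 * piF x i j) * (x k * x k) -
      fF n x / ‖x‖ ^ 2 * (x j * (x k * kron k i) + x i * (x k * kron k j) +
        (cstr x j * (kahler k i * x k) + cstr x i * (kahler k j * x k)))) := by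
    intro k; rw [pd_calabi hn hx]; ring
  simp only [eul, e, ← Finset.mul_sum, Finset.sum_sub_distrib, Finset.sum_add_distrib,
    sum_mul_self, sum_mul_kron', ← cstr_eq_sum]
  rw [oTensor_apply hn hx]
  simp only [piF]
  field_simp
  ring

/-- Contraction of a vector with a linear combination of the six basic vectors. -/
lemma sum_mul_six (z x y : Idx n → ℝ) (k j : Idx n) (c₁ c₂ c₃ c₄ c₅ c₆ : ℝ) :
    ∑ a, z a * (c₁ * kron a j + c₂ * kron a k + c₃ * kahler k a + c₄ * kahler j a + c₅ * x a +
      c₆ * y a) = c₁ * z j + c₂ * z k + c₃ * ∑ a, kahler k a * z a + c₄ * ∑ a, kahler j a * z a +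
      c₅ * ∑ a, x a * z a + c₆ * ∑ a, y a * z a := by
  have : ∀ a, z a * (c₁ * kron a j + c₂ * kron a k + c₃ * kahler k a + c₄ * kahler j a + c₅ * x a +
      c₆ * y a) = c₁ * (z a * kron a j) + c₂ * (z a * kron a k) + c₃ * (kahler k a * z a) +
      c₄ * (kahler j a * z a) + c₅ * (x a * z a) + c₆ * (y a * z a) := fun a => by ring
  simp only [this, Finset.sum_add_distrib, ← Finset.mul_sum, sum_mul_kron']

/-- The Christoffel symbols `Γ^a_{kj}` of the Calabi metric. -/
def gam (n : ℕ) (x : Cn n) (k a j : Idx n) : ℝ :=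
  -(fF n x / ‖x‖ ^ 2) * x k * kron a j + -(fF n x / ‖x‖ ^ 2) * x j * kron a k +
    -(fF n x / ‖x‖ ^ 2) * cstr x j * kahler k a + -(fF n x / ‖x‖ ^ 2) * cstr x k * kahler j a +
    (n + 1) * fF n x / (‖x‖ ^ 2) ^ 2 * (x k * x j - cstr x k * cstr x j) * x a +
    (n + 1) * fF n x / (‖x‖ ^ 2) ^ 2 * (x k * cstr x j + x j * cstr x k) * cstr x a

lemma sum_kahler_right (k : Idx n) (x : Cn n) : ∑ a, kahler k a * x a = -cstr x k := by
  rw [cstr_eq_sum, ← Finset.sum_neg_distrib]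
  exact Finset.sum_congr rfl fun a _ => by rw [kahler_antisymm]; ring

lemma sum_kahler_right_cstr (k : Idx n) (x : Cn n) : ∑ a, kahler k a * cstr x a = x k := by
  rw [← neg_neg (x k), ← sum_kahler_cstr, ← Finset.sum_neg_distrib]
  exact Finset.sum_congr rfl fun a _ => by rw [kahler_antisymm]; ring

lemma sum_cstr_mul (x : Cn n) : ∑ i, cstr x i * x i = 0 := by
  rw [← sum_mul_cstr x]; exact Finset.sum_congr rfl fun i _ => mul_comm _ _

lemma sum_mul_gam (hx : x ≠ 0) (k j : Idx n) : ∑ a, x a * gam n x k a j =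
    (n - 1) * fF n x / ‖x‖ ^ 2 * (x k * x j - cstr x k * cstr x j) := by
  have hs := (normSq_pos hx).ne'
  simp only [gam]
  rw [sum_mul_six, sum_kahler_right, sum_kahler_right, sum_mul_self, sum_cstr_mul]
  field_simp
  ring

lemma sum_cstr_mul_gam (hx : x ≠ 0) (k j : Idx n) : ∑ a, cstr x a * gam n x k a j =
    (n - 1) * fF n x / ‖x‖ ^ 2 * (x k * cstr x j + x j * cstr x k) := by
  have hs := (normSq_pos hx).ne'
  simp only [gam]
  rw [sum_mul_six, sum_kahler_right_cstr, sum_kahler_right_cstr, sum_mul_cstr, sum_cstr_mul_self]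
  field_simp
  ring

/-- It suffices to check that lowering the index of `gam` gives the first-kind symbols. This needs
only the contractions of `gam` with `x` and `Jx`. -/
lemma chMat_calabi (hn : 0 < n) (hx : x ≠ 0) (k : Idx n) :
    chMat (calabi n) k x = Matrix.of (gam n x k) := by
  have hs := (normSq_pos hx).ne'
  have h : tMat (calabi n) x * Matrix.of (gam n x k) = firstKind (calabi n) k x := by
    ext l j
    have e : ∀ a, tMat (calabi n) x l a * gam n x k a j = aF n x * (kron l a * gam n x k a j) -
        aF n x * (fF n x / ‖x‖ ^ 2) * x l * (x a * gam n x k a j) -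
        aF n x * (fF n x / ‖x‖ ^ 2) * cstr x l * (cstr x a * gam n x k a j) := fun a => by
      rw [tMat_apply, calabi_apply hn hx, piF]; ring
    simp only [Matrix.mul_apply, Matrix.of_apply, e, Finset.sum_sub_distrib, ← Finset.mul_sum,
      sum_kron_mul, sum_mul_gam hx, sum_cstr_mul_gam hx]
    simp only [firstKind, Matrix.of_apply, pd_calabi hn hx, gam, piF]
    rw [kron_comm l j, kron_comm l k, kron_comm k j, kahler_antisymm l k, kahler_antisymm l j,
      kahler_antisymm k j]
    field_simp
    ring
  rw [chMat_eq, ← h, ← Matrix.mul_assoc, (calabi_nondegenerate hn).inv_mul hx, Matrix.one_mul]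

lemma trace_chMat_calabi (hn : 0 < n) (hx : x ≠ 0) (j : Idx n) :
    ∑ i, chMat (calabi n) i x i j = 0 := by
  have hs := (normSq_pos hx).ne'
  have e : ∀ i, chMat (calabi n) i x i j = -(fF n x / ‖x‖ ^ 2) * (x i * kron i j) +
      -(fF n x / ‖x‖ ^ 2) * x j * 1 + -(fF n x / ‖x‖ ^ 2) * (kahler j i * cstr x i) +
      (n + 1) * fF n x / (‖x‖ ^ 2) ^ 2 * (x j * (x i * x i) + x j * (cstr x i * cstr x i)) :=
    fun i => by
      rw [chMat_calabi hn hx, Matrix.of_apply, gam, kron_self, kahler_self]; ring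
  simp only [e, Finset.sum_add_distrib, ← Finset.mul_sum, sum_mul_kron', sum_kahler_right_cstr,
    sum_mul_self, norm_cstr_sq, Finset.sum_const, Finset.card_univ, nsmul_eq_mul, card_Idx]
  field_simp
  ring

end CalabiConnection


/-! ### Covariant derivative and divergence of `o` -/

section CalabiTensors

variable {n : ℕ} {x : Cn n}

open Matrix

/-- The metric is parallel, so the covariant derivative of `g N` is that of the endomorphism `N`,
whose connection term is a commutator. -/
lemma covMat_mul {ι : Type} [Fintype ι] [DecidableEq ι] {S : Set (EuclideanSpace ℝ ι)}
    {g : TwoTensor ι} {x : EuclideanSpace ℝ ι} (hg : IsNondegenerateOn S g) (hS : IsOpen S)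
    (hx : x ∈ S) {N : EuclideanSpace ℝ ι → Matrix ι ι ℝ} (hN : SmoothMatOn S N) (k : ι) :
    covMat g k (fun y => tMat g y * N y) x =
      tMat g x * (pdMat k N x + chMat g k x * N x - N x * chMat g k x) := by
  rw [covMat, pdMat_mul k hS hx hg.smooth hN, hg.pdMat_metric hS hx]
  noncomm_ring

/-- The endomorphism associated with `o`. -/
def oEnd (n : ℕ) (x : Cn n) : Matrix (Idx n) (Idx n) ℝ :=
  (-fF n x) • 1 + (n * fF n x / ‖x‖ ^ 2) • piM x

lemma oEnd_apply (i j : Idx n) :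
    oEnd n x i j = -fF n x * kron i j + n * fF n x / ‖x‖ ^ 2 * piF x i j := by
  simp [oEnd, piM, kron_eq_one_apply]

lemma calabi_mul_oEnd (hn : 0 < n) (hx : x ≠ 0) :
    tMat (calabi n) x * oEnd n x = tMat (oTensor n) x := by
  have hs := (normSq_pos hx).ne'
  rw [tMat_calabi' hn hx, oEnd, smul_one_add_piM_mul, tMat_oTensor' hn hx]
  congr 2
  · ring
  · field_simp; ring

lemma inv_mul_oTensor (hn : 0 < n) (hx : x ≠ 0) :
    (tMat (calabi n) x)⁻¹ * tMat (oTensor n) x = oEnd n x := by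
  rw [← calabi_mul_oEnd hn hx, ← Matrix.mul_assoc, (calabi_nondegenerate hn).inv_mul hx,
    Matrix.one_mul]

lemma trace_oEnd (hx : x ≠ 0) : (oEnd n x).trace = 0 := by
  have hs := (normSq_pos hx).ne'
  rw [oEnd, Matrix.trace_add, Matrix.trace_smul, Matrix.trace_smul, trace_one_Idx, trace_piM,
    smul_eq_mul, smul_eq_mul]
  field_simp; ring

lemma smooth_oEnd : SmoothMatOn (puncture n) (oEnd n) := by
  intro i j
  have h : ContDiffOn ℝ ∞ (fun x => -fF n x * kron i j + n * fF n x / ‖x‖ ^ 2 * piF x i j)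
      (puncture n) :=
    (contDiffOn_fF.neg.mul contDiffOn_const).add
      (((contDiffOn_const.mul contDiffOn_fF).div (contDiffOn_normSq _)
      fun x hx => (normSq_pos hx).ne').mul (contDiff_piF i j).contDiffOn)
  exact h.congr fun x hx => oEnd_apply i j

lemma pd_inv_normSq (hx : x ≠ 0) (k : Idx n) :
    pd k (fun y : Cn n => (‖y‖ ^ 2)⁻¹) x = -(1 / (‖x‖ ^ 2) ^ 2) * (2 * x k) := by
  refine pd_radial (φ := fun t => t⁻¹) ?_ k
  simpa [one_div] using hasDerivAt_inv (normSq_pos hx).ne'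

lemma diffAt_inv_normSq (hx : x ≠ 0) : DifferentiableAt ℝ (fun y : Cn n => (‖y‖ ^ 2)⁻¹) x :=
  ((contDiff_norm_sq ℝ).differentiable (n := ∞) (by simp) x).fun_inv (normSq_pos hx).ne'

lemma diffAt_fF (hx : x ≠ 0) : DifferentiableAt ℝ (fF n) x :=
  diffAt_of_contDiffOn isOpen_puncture contDiffOn_fF hx

lemma pd_fF_div (hn : 0 < n) (hx : x ≠ 0) (k : Idx n) :
    pd k (fun y => fF n y * (‖y‖ ^ 2)⁻¹) x =
      -(2 * fF n x * (n * (1 - fF n x) + 1) / (‖x‖ ^ 2) ^ 2) * x k := by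
  have hs := (normSq_pos hx).ne'
  rw [pd_mul k (diffAt_fF hx) (diffAt_inv_normSq hx), pd_fF hn hx, pd_inv_normSq hx]
  field_simp; ring

lemma pd_fF_div_sq (hn : 0 < n) (hx : x ≠ 0) (k : Idx n) :
    pd k (fun y => fF n y * (‖y‖ ^ 2)⁻¹ * (‖y‖ ^ 2)⁻¹) x =
      -(2 * fF n x * (n * (1 - fF n x) + 2) / (‖x‖ ^ 2) ^ 3) * x k := by
  have hs := (normSq_pos hx).ne'
  rw [pd_mul k ((diffAt_fF hx).fun_mul (diffAt_inv_normSq hx)) (diffAt_inv_normSq hx),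
    pd_fF_div hn hx, pd_inv_normSq hx]
  field_simp; ring

lemma pd_oEnd (hn : 0 < n) (hx : x ≠ 0) (k i j : Idx n) : pd k (fun y => oEnd n y i j) x =
    2 * n * fF n x * (1 - fF n x) / ‖x‖ ^ 2 * x k * kron i j -
      n * (2 * fF n x * (n * (1 - fF n x) + 1) / (‖x‖ ^ 2) ^ 2) * x k * piF x i j +
      n * fF n x / ‖x‖ ^ 2 * (kron k i * x j + x i * kron k j +
        (kahler k i * cstr x j + cstr x i * kahler k j)) := by
  have hs := (normSq_pos hx).ne'
  have df := diffAt_fF hx (n := n)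
  have dm := (diffAt_fF hx (n := n)).fun_mul (diffAt_inv_normSq hx)
  have dp := (contDiff_piF (n := n) i j).differentiable (by simp) x
  have e : (fun y => oEnd n y i j) = fun y =>
      -(kron i j * fF n y) + n * (fF n y * (‖y‖ ^ 2)⁻¹ * piF y i j) := by
    funext y; rw [oEnd_apply]; ring
  rw [e, pd_add k (df.const_mul _).fun_neg ((dm.fun_mul dp).const_mul _), pd_neg,
    pd_const_mul k _ df, pd_const_mul k _ (dm.fun_mul dp), pd_mul k dm dp, pd_fF hn hx,
    pd_fF_div hn hx, pd_piF]
  ring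

lemma covMat_oTensor (hn : 0 < n) (hx : x ≠ 0) (k : Idx n) :
    covMat (calabi n) k (tMat (oTensor n)) x = tMat (calabi n) x *
      (pdMat k (oEnd n) x + chMat (calabi n) k x * oEnd n x - oEnd n x * chMat (calabi n) k x) := by
  rw [← covMat_mul (calabi_nondegenerate hn) isOpen_puncture hx smooth_oEnd, covMat, covMat,
    pdMat_congr k isOpen_puncture hx fun y hy => (calabi_mul_oEnd hn hy).symm]
  simp only [calabi_mul_oEnd hn hx]

/-- The radial connection matrix equals the endomorphism of `o` itself, so its commutator with that
endomorphism vanishes in the radial derivative of `o`. -/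
lemma sum_smul_chMat (hn : 0 < n) (hx : x ≠ 0) :
    ∑ k, x k • chMat (calabi n) k x = oEnd n x := by
  have hs := (normSq_pos hx).ne'
  ext a j
  have e : ∀ k, x k * gam n x k a j = -(fF n x / ‖x‖ ^ 2) * kron a j * (x k * x k) +
      -(fF n x / ‖x‖ ^ 2) * x j * (x k * kron a k) +
      -(fF n x / ‖x‖ ^ 2) * cstr x j * (kahler k a * x k) +
      -(fF n x / ‖x‖ ^ 2) * kahler j a * (x k * cstr x k) +
      (n + 1) * fF n x / (‖x‖ ^ 2) ^ 2 * (x j * x a + cstr x j * cstr x a) * (x k * x k) +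
      (n + 1) * fF n x / (‖x‖ ^ 2) ^ 2 * (x j * cstr x a - cstr x j * x a) * (x k * cstr x k) :=
    fun k => by rw [gam]; ring
  simp only [Matrix.sum_apply, Matrix.smul_apply, smul_eq_mul, chMat_calabi hn hx,
    Matrix.of_apply, e, Finset.sum_add_distrib, ← Finset.mul_sum, sum_mul_self, sum_mul_kron,
    ← cstr_eq_sum, sum_mul_cstr]
  rw [oEnd_apply, piF]
  field_simp
  ring

/-- `oEnd` is `f` times an endomorphism homogeneous of degree zero, so only `E f = -2n f (1 - f)`
contributes. -/
lemma eul_oEnd (hn : 0 < n) (hx : x ≠ 0) (i j : Idx n) :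
    ∑ k, x k * pd k (fun y => oEnd n y i j) x = -(2 * n * (1 - fF n x)) * oEnd n x i j := by
  have hs := (normSq_pos hx).ne'
  have e : ∀ k, x k * pd k (fun y => oEnd n y i j) x =
      (2 * n * fF n x * (1 - fF n x) / ‖x‖ ^ 2 * kron i j -
      n * (2 * fF n x * (n * (1 - fF n x) + 1) / (‖x‖ ^ 2) ^ 2) * piF x i j) * (x k * x k) +
      n * fF n x / ‖x‖ ^ 2 * (x j * (x k * kron k i) + x i * (x k * kron k j) +
        (cstr x j * (kahler k i * x k) + cstr x i * (kahler k j * x k))) := by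
    intro k; rw [pd_oEnd hn hx]; ring
  simp only [e, ← Finset.mul_sum, Finset.sum_add_distrib, sum_mul_self, sum_mul_kron',
    ← cstr_eq_sum]
  rw [oEnd_apply]
  simp only [piF]
  field_simp
  ring

/-- The radial covariant derivative of `o`. -/
lemma sum_smul_covMat_oTensor (hn : 0 < n) (hx : x ≠ 0) :
    ∑ k, x k • covMat (calabi n) k (tMat (oTensor n)) x =
      (-(2 * n * (1 - fF n x))) • tMat (oTensor n) x := by
  have h1 : ∑ k, x k • pdMat k (oEnd n) x = (-(2 * n * (1 - fF n x))) • oEnd n x := by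
    ext i j
    simp only [Matrix.sum_apply, Matrix.smul_apply, smul_eq_mul, pdMat_apply, eul_oEnd hn hx]
  have h2 : ∑ k, x k • (chMat (calabi n) k x * oEnd n x) = oEnd n x * oEnd n x := by
    simp only [← Matrix.smul_mul, ← Matrix.sum_mul, sum_smul_chMat hn hx]
  have h3 : ∑ k, x k • (oEnd n x * chMat (calabi n) k x) = oEnd n x * oEnd n x := by
    simp only [← Matrix.mul_smul, ← Matrix.mul_sum, sum_smul_chMat hn hx]
  have e : ∀ k, x k • covMat (calabi n) k (tMat (oTensor n)) x = tMat (calabi n) x *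
      (x k • pdMat k (oEnd n) x + x k • (chMat (calabi n) k x * oEnd n x) -
        x k • (oEnd n x * chMat (calabi n) k x)) := fun k => by
    rw [covMat_oTensor hn hx, ← Matrix.mul_smul, smul_sub, smul_add]
  rw [Finset.sum_congr rfl fun k _ => e k, ← Matrix.mul_sum, Finset.sum_sub_distrib,
    Finset.sum_add_distrib, h1, h2, h3, add_sub_cancel_right, Matrix.mul_smul, calabi_mul_oEnd hn hx]

lemma sum_gam_trace (hn : 0 < n) (hx : x ≠ 0) (j : Idx n) : ∑ k, gam n x k k j = 0 := by
  have := trace_chMat_calabi hn hx j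
  simpa only [chMat_calabi hn hx, Matrix.of_apply] using this

lemma gam_symm (k a j : Idx n) : gam n x k a j = gam n x j a k := by
  simp only [gam]; ring

lemma div_oEnd (hn : 0 < n) (hx : x ≠ 0) (j : Idx n) :
    ∑ k, (pdMat k (oEnd n) x + chMat (calabi n) k x * oEnd n x -
      oEnd n x * chMat (calabi n) k x) k j = 0 := by
  have hs := (normSq_pos hx).ne'
  have h1 : ∑ k, pd k (fun y => oEnd n y k j) x =
      2 * n * (n - 1) * fF n x * fF n x / ‖x‖ ^ 2 * x j := by
    have e : ∀ k, pd k (fun y => oEnd n y k j) x =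
        2 * n * fF n x * (1 - fF n x) / ‖x‖ ^ 2 * (x k * kron k j) -
        n * (2 * fF n x * (n * (1 - fF n x) + 1) / (‖x‖ ^ 2) ^ 2) * (x k * piF x k j) +
        n * fF n x / ‖x‖ ^ 2 * (x j * 1 + x k * kron k j + kahler k j * cstr x k) := by
      intro k; rw [pd_oEnd hn hx, kron_self, kahler_self]; ring
    simp only [e, Finset.sum_add_distrib, Finset.sum_sub_distrib, ← Finset.mul_sum, sum_mul_piF,
      sum_mul_kron', sum_kahler_cstr, Finset.sum_const, Finset.card_univ, nsmul_eq_mul, card_Idx]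
    field_simp
    ring
  have h2 : ∑ k, ∑ p, gam n x k k p * oEnd n x p j = 0 := by
    rw [Finset.sum_comm]
    simp only [← Finset.sum_mul, sum_gam_trace hn hx, zero_mul, Finset.sum_const_zero]
  have h3 : ∑ k, ∑ p, oEnd n x k p * gam n x k p j =
      2 * n * (n - 1) * fF n x * fF n x / ‖x‖ ^ 2 * x j := by
    have e : ∀ k p, oEnd n x k p * gam n x k p j = -fF n x * (kron k p * gam n x k p j) +
        n * fF n x / ‖x‖ ^ 2 * (x k * (x p * gam n x k p j) +
          cstr x k * (cstr x p * gam n x k p j)) := fun k p => by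
      rw [oEnd_apply, piF]; ring
    have e2 : ∀ k, x k * ((n - 1) * fF n x / ‖x‖ ^ 2 * (x k * x j - cstr x k * cstr x j)) +
        cstr x k * ((n - 1) * fF n x / ‖x‖ ^ 2 * (x k * cstr x j + x j * cstr x k)) =
        (n - 1) * fF n x / ‖x‖ ^ 2 * x j * (x k * x k + cstr x k * cstr x k) := fun k => by ring
    simp only [e, Finset.sum_add_distrib, ← Finset.mul_sum, sum_kron_mul, sum_mul_gam hx,
      sum_cstr_mul_gam hx, sum_gam_trace hn hx]
    rw [← Finset.sum_add_distrib]
    simp only [e2, ← Finset.mul_sum, Finset.sum_add_distrib, sum_mul_self, norm_cstr_sq]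
    field_simp
    ring
  simp only [Matrix.sub_apply, Matrix.add_apply, pdMat_apply, Matrix.mul_apply,
    chMat_calabi hn hx, Matrix.of_apply, Finset.sum_sub_distrib, Finset.sum_add_distrib, h1, h2, h3]
  ring

/-- By symmetry of `∇o` and parallelism of `g`, this is the divergence of the endomorphism treated
in `div_oEnd`. -/
lemma div_oTensor (hn : 0 < n) (hx : x ≠ 0) (j : Idx n) :
    ∑ k, ∑ l, (tMat (calabi n) x)⁻¹ k l * covMat (calabi n) k (tMat (oTensor n)) x j l = 0 := by
  have hg := calabi_nondegenerate (n := n) hn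
  have hsym : ∀ k l, covMat (calabi n) k (tMat (oTensor n)) x j l =
      covMat (calabi n) k (tMat (oTensor n)) x l j := by
    intro k l
    rw [← covDeriv_eq, ← covDeriv_eq, covDeriv, covDeriv,
      pd_congr_on k isOpen_puncture hx fun y hy => oTensor_symm hn y hy j l]
    congr 1
    refine Finset.sum_congr rfl fun p _ => ?_
    rw [oTensor_symm hn x hx p l, oTensor_symm hn x hx p j]; ring
  rw [← div_oEnd hn hx j]
  refine Finset.sum_congr rfl fun k _ => ?_
  simp only [hsym]
  rw [← Matrix.mul_apply (M := (tMat (calabi n) x)⁻¹)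
    (N := covMat (calabi n) k (tMat (oTensor n)) x), covMat_oTensor hn hx, ← Matrix.mul_assoc,
    hg.inv_mul hx, Matrix.one_mul]

end CalabiTensors

/-! ### Ricci-flatness of the Calabi metric and `P o = 0` -/

section CalabiRicci

variable {n : ℕ} {x : Cn n}

open Matrix

lemma cstr_cstr (x : Cn n) (j : Idx n) : cstr (cstr x) j = -x j := by
  rw [cstr_eq_sum, sum_kahler_cstr]

lemma pd_gam (hn : 0 < n) (hx : x ≠ 0) (k i a j : Idx n) : pd k (fun y => gam n y i a j) x =
    2 * fF n x * (n * (1 - fF n x) + 1) / (‖x‖ ^ 2) ^ 2 * x k *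
      (x i * kron a j + x j * kron a i + cstr x j * kahler i a + cstr x i * kahler j a) -
    fF n x / ‖x‖ ^ 2 * (kron k i * kron a j + kron k j * kron a i + kahler k j * kahler i a +
      kahler k i * kahler j a) -
    (n + 1) * (2 * fF n x * (n * (1 - fF n x) + 2) / (‖x‖ ^ 2) ^ 3) * x k *
      ((x i * x j - cstr x i * cstr x j) * x a + (x i * cstr x j + x j * cstr x i) * cstr x a) +
    (n + 1) * fF n x / (‖x‖ ^ 2) ^ 2 *
      ((kron k i * x j + x i * kron k j - (kahler k i * cstr x j + cstr x i * kahler k j)) * x a +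
      (x i * x j - cstr x i * cstr x j) * kron k a +
      (kron k i * cstr x j + x i * kahler k j + (kron k j * cstr x i + x j * kahler k i)) *
        cstr x a + (x i * cstr x j + x j * cstr x i) * kahler k a) := by
  have hs := (normSq_pos hx).ne'
  have d := fun i => differentiable_coord (ι := Idx n) i x
  have d' := fun i => (contDiff_cstr (n := n) i).differentiable (by simp) x
  have d1 := (diffAt_fF hx (n := n)).fun_mul (diffAt_inv_normSq hx)
  have d2 := d1.fun_mul (diffAt_inv_normSq hx)
  have e : (fun y => gam n y i a j) = fun y => (fF n y * (‖y‖ ^ 2)⁻¹) *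
      ((-kron a j) * y i + (-kron a i) * y j + ((-kahler i a) * cstr y j +
        (-kahler j a) * cstr y i)) +
      (fF n y * (‖y‖ ^ 2)⁻¹ * (‖y‖ ^ 2)⁻¹) * (((n + 1) * (y i * y j - cstr y i * cstr y j)) * y a +
        ((n + 1) * (y i * cstr y j + y j * cstr y i)) * cstr y a) := by
    funext y; rw [gam]; ring
  have e1 := (((d i).const_mul (-kron a j)).fun_add ((d j).const_mul (-kron a i))).fun_add
    (((d' j).const_mul (-kahler i a)).fun_add ((d' i).const_mul (-kahler j a)))
  have f1 := ((d i).fun_mul (d j)).fun_sub ((d' i).fun_mul (d' j))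
  have f2 := ((d i).fun_mul (d' j)).fun_add ((d j).fun_mul (d' i))
  have g1 := (f1.const_mul ((n : ℝ) + 1)).fun_mul (d a)
  have g2 := (f2.const_mul ((n : ℝ) + 1)).fun_mul (d' a)
  rw [e, pd_add k (d1.fun_mul e1) (d2.fun_mul (g1.fun_add g2)), pd_mul k d1 e1,
    pd_mul k d2 (g1.fun_add g2), pd_fF_div hn hx, pd_fF_div_sq hn hx, pd_add k g1 g2,
    pd_add k (((d i).const_mul (-kron a j)).fun_add ((d j).const_mul (-kron a i)))
      (((d' j).const_mul (-kahler i a)).fun_add ((d' i).const_mul (-kahler j a))),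
    pd_add k ((d i).const_mul (-kron a j)) ((d j).const_mul (-kron a i)),
    pd_add k ((d' j).const_mul (-kahler i a)) ((d' i).const_mul (-kahler j a)),
    pd_const_mul k _ (d i), pd_const_mul k _ (d j), pd_const_mul k _ (d' i),
    pd_const_mul k _ (d' j), pd_mul k (f1.const_mul _) (d a), pd_mul k (f2.const_mul _) (d' a),
    pd_const_mul k _ f1, pd_const_mul k _ f2, pd_sub k ((d i).fun_mul (d j))
      ((d' i).fun_mul (d' j)), pd_add k ((d i).fun_mul (d' j)) ((d j).fun_mul (d' i)),
    pd_mul k (d i) (d j), pd_mul k (d' i) (d' j), pd_mul k (d i) (d' j), pd_mul k (d j) (d' i)]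
  simp only [pd_coord, pd_cstr]
  field_simp
  ring

lemma sum_kahler_right_kahler (k l : Idx n) : ∑ p, kahler k p * kahler l p = kron k l := by
  rw [← sum_kahler_mul_kahler k l]
  exact Finset.sum_congr rfl fun p _ => by
    rw [kahler_antisymm k p, kahler_antisymm l p]; ring

lemma div_gam (hn : 0 < n) (hx : x ≠ 0) (i j : Idx n) :
    ∑ k, pd k (fun y => gam n y i k j) x = 2 * n * (n - 1) * (fF n x / ‖x‖ ^ 2) ^ 2 *
      (x i * x j - cstr x i * cstr x j) := by
  have hs := (normSq_pos hx).ne'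
  have e : ∀ k, pd k (fun y => gam n y i k j) x =
      2 * fF n x * (n * (1 - fF n x) + 1) / (‖x‖ ^ 2) ^ 2 *
      (x i * (x k * kron k j) + x j * (x k * kron k i) + cstr x j * (kahler i k * x k) +
        cstr x i * (kahler j k * x k)) -
      fF n x / ‖x‖ ^ 2 * (kron k i * kron k j + kron k j * kron k i - kahler j k * kahler i k -
      kahler i k * kahler j k) -
      (n + 1) * (2 * fF n x * (n * (1 - fF n x) + 2) / (‖x‖ ^ 2) ^ 3) *
      ((x i * x j - cstr x i * cstr x j) * (x k * x k) +
        (x i * cstr x j + x j * cstr x i) * (x k * cstr x k)) +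
      (n + 1) * fF n x / (‖x‖ ^ 2) ^ 2 *
      ((x j * (x k * kron k i) + x i * (x k * kron k j) -
        (cstr x j * (kahler k i * x k) + cstr x i * (kahler k j * x k))) +
      (x i * x j - cstr x i * cstr x j) * 1 +
      (cstr x j * (cstr x k * kron k i) + x i * (kahler k j * cstr x k) +
        (cstr x i * (cstr x k * kron k j) + x j * (kahler k i * cstr x k)))) := by
    intro k
    rw [pd_gam hn hx, kron_self, kahler_self, kahler_antisymm i k, kahler_antisymm j k]; ring
  simp only [e, Finset.sum_add_distrib, Finset.sum_sub_distrib, ← Finset.mul_sum, sum_mul_kron',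
    sum_kahler_right, sum_kahler_right_kahler, sum_mul_self, sum_mul_cstr, ← cstr_eq_sum,
    cstr_cstr, Finset.sum_const, Finset.card_univ, nsmul_eq_mul, card_Idx, kron_comm i j]
  field_simp
  ring

lemma sum_kahler_mul_gam (hx : x ≠ 0) (j : Idx n) :
    ∑ p, ∑ a, kahler p a * gam n x j p a = 0 := by
  have hs := (normSq_pos hx).ne'
  have e : ∀ p a, kahler p a * gam n x j p a =
      -(fF n x / ‖x‖ ^ 2) * x j * (kahler p a * kron p a) +
      -(fF n x / ‖x‖ ^ 2) * (kron p j * (kahler p a * x a)) +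
      -(fF n x / ‖x‖ ^ 2) * (kahler j p * (kahler p a * cstr x a)) +
      (fF n x / ‖x‖ ^ 2) * (cstr x j * (kahler p a * kahler p a)) +
      (n + 1) * fF n x / (‖x‖ ^ 2) ^ 2 * (x j * (x p * (kahler p a * x a)) -
        cstr x j * (x p * (kahler p a * cstr x a))) +
      (n + 1) * fF n x / (‖x‖ ^ 2) ^ 2 * (x j * (cstr x p * (kahler p a * cstr x a)) +
        cstr x j * (cstr x p * (kahler p a * x a))) := fun p a => by
    rw [gam, kahler_antisymm a p]; ring
  have e2 : ∀ p, x p * -cstr x p = -(x p * cstr x p) := fun p => by ring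
  have e3 : ∀ p, cstr x p * -cstr x p = -(cstr x p * cstr x p) := fun p => by ring
  have e4 : ∀ p, kron p j * -cstr x p = -(cstr x p * kron p j) := fun p => by ring
  simp only [e, Finset.sum_add_distrib, Finset.sum_sub_distrib, ← Finset.mul_sum, sum_mul_kron,
    sum_kahler_right, sum_kahler_right_kahler, cstr_cstr, neg_neg, kahler_self, kron_self,
    e2, e3, e4, Finset.sum_neg_distrib, sum_mul_kron', sum_mul_cstr, sum_cstr_mul, sum_mul_self,
    norm_cstr_sq, Finset.sum_const, Finset.card_univ, nsmul_eq_mul, card_Idx]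
  field_simp
  ring

lemma trace_gam_mul_gam (hn : 0 < n) (hx : x ≠ 0) (i j : Idx n) :
    ∑ p, ∑ a, gam n x i a p * gam n x j p a = 2 * n * (n - 1) * (fF n x / ‖x‖ ^ 2) ^ 2 *
      (x i * x j - cstr x i * cstr x j) := by
  have hs := (normSq_pos hx).ne'
  have e : ∀ p a, gam n x i a p * gam n x j p a =
      -(fF n x / ‖x‖ ^ 2) * x i * (kron p a * gam n x j p a) +
      -(fF n x / ‖x‖ ^ 2) * (kron i a * (x p * gam n x j p a)) +
      -(fF n x / ‖x‖ ^ 2) * (kahler i a * (cstr x p * gam n x j p a)) +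
      -(fF n x / ‖x‖ ^ 2) * cstr x i * (kahler p a * gam n x j p a) +
      (n + 1) * fF n x / (‖x‖ ^ 2) ^ 2 * (x i * (x a * (x p * gam n x j p a)) -
        cstr x i * (x a * (cstr x p * gam n x j p a)) + x i * (cstr x a * (cstr x p * gam n x j p a))
        + cstr x i * (cstr x a * (x p * gam n x j p a))) := fun p a => by
    rw [gam, kron_comm a p, kron_comm a i]; ring
  have t1 : ∑ p, ∑ a, kron p a * gam n x j p a = 0 := by
    simp only [sum_kron_mul]
    rw [← sum_gam_trace hn hx j]
    exact Finset.sum_congr rfl fun p _ => gam_symm _ _ _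
  have sw : ∀ z : Idx n → ℝ, ∀ F : Idx n → Idx n → ℝ, ∑ p, ∑ a, z a * F p a =
      ∑ a, z a * ∑ p, F p a := fun z F => by
    rw [Finset.sum_comm]; simp only [Finset.mul_sum]
  have r1 : ∀ z : Idx n → ℝ, ∑ a, z a * ((n - 1) * fF n x / ‖x‖ ^ 2 *
      (x j * x a - cstr x j * cstr x a)) = (n - 1) * fF n x / ‖x‖ ^ 2 *
      (x j * ∑ a, z a * x a - cstr x j * ∑ a, z a * cstr x a) := fun z => by
    simp only [Finset.mul_sum, ← Finset.sum_sub_distrib]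
    exact Finset.sum_congr rfl fun a _ => by ring
  have r2 : ∀ z : Idx n → ℝ, ∑ a, z a * ((n - 1) * fF n x / ‖x‖ ^ 2 *
      (x j * cstr x a + x a * cstr x j)) = (n - 1) * fF n x / ‖x‖ ^ 2 *
      (x j * ∑ a, z a * cstr x a + cstr x j * ∑ a, z a * x a) := fun z => by
    simp only [Finset.mul_sum, ← Finset.sum_add_distrib]
    exact Finset.sum_congr rfl fun a _ => by ring
  simp only [e, Finset.sum_add_distrib, Finset.sum_sub_distrib, ← Finset.mul_sum, t1,
    sum_kahler_mul_gam hx]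
  simp only [Finset.mul_sum]
  simp only [sw, sum_mul_gam hx, sum_cstr_mul_gam hx, r1, r2, ← Finset.mul_sum]
  simp only [sum_kron_mul, sum_kahler_right, cstr_cstr, sum_mul_self, norm_cstr_sq,
    sum_mul_cstr, sum_cstr_mul]
  field_simp
  ring

/-- Since `Γ^k_{kj} = 0`, only `∂_k Γ^k_{ij}` and the trace of `Γ_i Γ_j` survive. By `div_gam` and
`trace_gam_mul_gam` they are equal. -/
lemma ricci_calabi (hn : 0 < n) (hx : x ≠ 0) (i j : Idx n) : ricci (calabi n) x i j = 0 := by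
  have hS := isOpen_puncture (n := n)
  rw [ricci_eq (calabi_nondegenerate hn) hS hx]
  have p1 : ∀ k, pd k (fun y => chMat (calabi n) i y k j) x = pd k (fun y => gam n y i k j) x :=
    fun k => pd_congr_on k hS hx fun y hy => by simp only [chMat_calabi hn hy, Matrix.of_apply]
  have p2 : ∑ k, pd i (fun y => chMat (calabi n) k y k j) x = 0 := by
    rw [← pd_sum i _ fun k _ => diffAt_of_contDiffOn hS
      ((calabi_nondegenerate hn).smooth_chMat hS k k j) hx,
      pd_congr_on i hS hx (g := fun _ => 0) fun y hy => trace_chMat_calabi hn hy j, pd_const]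
  have p3 : ∑ k, ∑ p, gam n x k k p * gam n x i p j = 0 := by
    rw [Finset.sum_comm]
    simp only [← Finset.sum_mul, sum_gam_trace hn hx, zero_mul, Finset.sum_const_zero]
  have p4 : ∑ k, ∑ p, gam n x i k p * gam n x k p j = 2 * n * (n - 1) * (fF n x / ‖x‖ ^ 2) ^ 2 *
      (x i * x j - cstr x i * cstr x j) := by
    rw [← trace_gam_mul_gam hn hx, Finset.sum_comm]
    exact Finset.sum_congr rfl fun p _ => Finset.sum_congr rfl fun k _ => by rw [gam_symm k p j]
  simp only [curvMat, Matrix.sub_apply, Matrix.add_apply, pdMat_apply, Matrix.mul_apply, p1]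
  simp only [chMat_calabi hn hx, Matrix.of_apply, Finset.sum_add_distrib, Finset.sum_sub_distrib,
    p2, p3, p4, div_gam hn hx]
  ring

/-- `o` is an infinitesimal Einstein deformation of the Calabi metric. -/
theorem opP_oTensor (hn : 0 < n) (hx : x ≠ 0) (i j : Idx n) :
    opP (calabi n) (oTensor n) x i j = 0 :=
  opP_eq_zero_of_dilation (calabi_nondegenerate hn) isOpen_puncture (smooth_oTensor hn)
    (oTensor_symm hn) (fun _ hy i j => eul_calabi hn hy i j)
    (fun _ hy i j => ricci_calabi hn hy i j)
    (fun y hy => by rw [inv_mul_oTensor hn hy, trace_oEnd hy])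
    (fun _ hy j => div_oTensor hn hy j) hx i j

end CalabiRicci

/-! ### Pointwise pairings with `o` -/

section CalabiPairing

variable {n : ℕ} {x : Cn n}

open Matrix

lemma raise_oTensor (hn : 0 < n) (hx : x ≠ 0) :
    raise (calabi n) x (tMat (oTensor n) x) = ((aF n x)⁻¹ * fF n x) •
      (-1 + ((n - fF n x) / ((1 - fF n x) * ‖x‖ ^ 2)) • piM x) := by
  have hs := (normSq_pos hx).ne'
  have hf : 1 - fF n x ≠ 0 := (sub_pos.2 (fF_lt_one hx)).ne'
  rw [raise, (calabi_nondegenerate hn).inv_transpose hx, inv_mul_oTensor hn hx, inv_calabi hn hx,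
    oEnd, smul_one_add_piM_mul]
  rw [smul_add, smul_neg, smul_smul, ← neg_smul]
  congr 2
  · ring
  · field_simp; ring

/-- The pairing of a tensor with `o`. -/
lemma tensorInner_oTensor (hn : 0 < n) (hx : x ≠ 0) (h : TwoTensor (Idx n)) :
    tensorInner (calabi n) h (oTensor n) x = (aF n x)⁻¹ * fF n x *
      (-(∑ i, h x i i) + (n - fF n x) / ((1 - fF n x) * ‖x‖ ^ 2) *
        (∑ i, ∑ j, h x i j * x i * x j + ∑ i, ∑ j, h x i j * cstr x i * cstr x j)) := by
  have e : ∀ i j, tMat h x i j * ((((aF n x)⁻¹ * fF n x) •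
      (-1 + ((n - fF n x) / ((1 - fF n x) * ‖x‖ ^ 2)) • piM x) : Matrix (Idx n) (Idx n) ℝ) i j) =
      (aF n x)⁻¹ * fF n x * (-(kron i j * h x i j) + (n - fF n x) / ((1 - fF n x) * ‖x‖ ^ 2) *
        (h x i j * x i * x j + h x i j * cstr x i * cstr x j)) := fun i j => by
    simp only [tMat_apply, Matrix.smul_apply, Matrix.add_apply, Matrix.neg_apply, smul_eq_mul,
      piM, Matrix.of_apply, piF, kron_eq_one_apply]
    ring
  rw [tensorInner_eq_matInner, matInner_eq_sum, raise_oTensor hn hx]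
  simp only [e, ← Finset.mul_sum, Finset.sum_add_distrib, Finset.sum_neg_distrib, sum_kron_mul]

lemma trace_oEnd_mul_oEnd (hx : x ≠ 0) :
    (oEnd n x * oEnd n x).trace = 2 * n * (n - 1) * fF n x ^ 2 := by
  have hs := (normSq_pos hx).ne'
  rw [oEnd, smul_one_add_piM_mul, Matrix.trace_add, Matrix.trace_smul, Matrix.trace_smul,
    trace_one_Idx, trace_piM, smul_eq_mul, smul_eq_mul]
  field_simp; ring

lemma tensorInner_oTensor_self (hn : 0 < n) (hx : x ≠ 0) :
    tensorInner (calabi n) (oTensor n) (oTensor n) x = 2 * n * (n - 1) * fF n x ^ 2 := by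
  have hT : (tMat (oTensor n) x)ᵀ = tMat (oTensor n) x := by
    ext i j; exact oTensor_symm hn x hx j i
  rw [tensorInner_eq, (calabi_nondegenerate hn).inv_transpose hx, hT, inv_mul_oTensor hn hx,
    Matrix.trace_mul_comm, Matrix.mul_assoc, inv_mul_oTensor hn hx, trace_oEnd_mul_oEnd hx]

lemma tensorInner_calabi_oTensor (hn : 0 < n) (hx : x ≠ 0) :
    tensorInner (calabi n) (calabi n) (oTensor n) x = 0 := by
  have hg := calabi_nondegenerate (n := n) hn
  rw [tensorInner_eq, hg.inv_transpose hx, hg.transpose_eq hx, ← Matrix.mul_assoc,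
    ← Matrix.mul_assoc, hg.mul_inv hx, Matrix.one_mul, Matrix.trace_mul_comm,
    inv_mul_oTensor hn hx, trace_oEnd hx]

/-- The position vector is an eigenvector of the metric with eigenvalue `A² = a (1 - f)`. -/
lemma inv_calabi_mul_self (hn : 0 < n) (hx : x ≠ 0) (i : Idx n) :
    ∑ j, (tMat (calabi n) x)⁻¹ i j * x j = (aF n x * (1 - fF n x))⁻¹ * x i := by
  have hs := (normSq_pos hx).ne'
  have hf : 1 - fF n x ≠ 0 := (sub_pos.2 (fF_lt_one hx)).ne'
  have e : ∀ j, (tMat (calabi n) x)⁻¹ i j * x j = (aF n x)⁻¹ * (kron i j * x j) +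
      (aF n x)⁻¹ * (fF n x / (1 - fF n x) / ‖x‖ ^ 2) * (x j * piF x j i) := fun j => by
    rw [inv_calabi hn hx]
    simp only [Matrix.add_apply, Matrix.smul_apply, smul_eq_mul, piM, Matrix.of_apply,
      kron_eq_one_apply, piF_symm i j]
    ring
  simp only [e, Finset.sum_add_distrib, ← Finset.mul_sum, sum_kron_mul, sum_mul_piF]
  field_simp
  ring

lemma norm_dr_calabi (hn : 0 < n) (hx : x ≠ 0) :
    ∑ i, ∑ j, invMetric (calabi n) x i j * drForm x i * drForm x j =
      (aF n x * (1 - fF n x))⁻¹ := by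
  have hs := (normSq_pos hx).ne'
  have e : ∀ i j, invMetric (calabi n) x i j * drForm x i * drForm x j =
      (‖x‖ ^ 2)⁻¹ * (x i * ((tMat (calabi n) x)⁻¹ i j * x j)) := fun i j => by
    simp only [invMetric, drForm, tMat]; field_simp
  have e2 : ∀ i, x i * ((aF n x * (1 - fF n x))⁻¹ * x i) =
    (aF n x * (1 - fF n x))⁻¹ * (x i * x i) := fun i => by ring
  simp only [e, ← Finset.mul_sum, inv_calabi_mul_self hn hx, e2, sum_mul_self]
  field_simp

end CalabiPairing

/-! ### The norm of `o` and the radial profiles at infinity -/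

section NormAndFlux

variable {n : ℕ}

open Set Metric

/-- The profile of `fF`. -/
def fR (n : ℕ) (r : ℝ) : ℝ := 1 / (1 + (r ^ 2) ^ n)

/-- The profile of `aF`. -/
def aR (n : ℕ) (r : ℝ) : ℝ := (1 + (r ^ 2) ^ n) ^ ((1 : ℝ) / n) / r ^ 2

lemma fF_eq (x : Cn n) : fF n x = fR n ‖x‖ := rfl

lemma aF_eq (x : Cn n) : aF n x = aR n ‖x‖ := rfl

lemma fR_pos (r : ℝ) : 0 < fR n r := by unfold fR; positivity

lemma fR_lt_one {r : ℝ} (hr : 0 < r) : fR n r < 1 := by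
  unfold fR
  rw [div_lt_one (by positivity)]
  have : 0 < (r ^ 2) ^ n := by positivity
  linarith

lemma aR_pos {r : ℝ} (hr : 0 < r) : 0 < aR n r := by unfold aR; positivity

lemma continuous_fR : Continuous (fR n) :=
  continuous_const.div (by fun_prop) fun r => by positivity

lemma finrank_Cn : Module.finrank ℝ (Cn n) = 2 * n := by
  rw [finrank_euclideanSpace]; simp [Idx, mul_comm]

lemma nontrivial_Cn (hn : 0 < n) : Nontrivial (Cn n) := by
  apply Module.nontrivial_of_finrank_pos (R := ℝ)
  rw [finrank_Cn]; omega

/-- An explicit primitive of the radial density of `|o|²`. It gives integrability and the value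
`1/(2n)` of the integral. -/
lemma hasDerivAt_fR (hn : 0 < n) (r : ℝ) :
    HasDerivAt (fun r => -(1 / (2 * n)) * fR n r) (r ^ (2 * n - 1) * fR n r ^ 2) r := by
  have hq : 1 + r ^ (2 * n) ≠ 0 := by rw [pow_mul]; positivity
  have h := (((hasDerivAt_pow (2 * n) r).const_add 1).fun_inv hq).const_mul (-(1 / (2 * (n : ℝ))))
  have hn' : (n : ℝ) ≠ 0 := by positivity
  have e : (fun r => -(1 / (2 * n)) * fR n r) =
      fun r => -(1 / (2 * (n : ℝ))) * (1 + r ^ (2 * n))⁻¹ := by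
    funext r; simp only [fR, pow_mul, one_div]
  rw [e]
  refine h.congr_deriv ?_
  rw [fR, ← pow_mul]
  push_cast
  field_simp

lemma tendsto_pow_atTop' (hn : 0 < n) : Tendsto (fun r : ℝ => (r ^ 2) ^ n) atTop atTop :=
  (tendsto_pow_atTop hn.ne').comp (tendsto_pow_atTop two_ne_zero)

lemma tendsto_fR (hn : 0 < n) : Tendsto (fR n) atTop (𝓝 0) := by
  have h : Tendsto (fun r : ℝ => 1 + (r ^ 2) ^ n) atTop atTop :=
    tendsto_atTop_add_const_left _ _ (tendsto_pow_atTop' hn)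
  exact h.inv_tendsto_atTop.congr fun r => by simp [fR]

lemma tendsto_pow_mul_fR (hn : 0 < n) :
    Tendsto (fun r : ℝ => (r ^ 2) ^ n * fR n r) atTop (𝓝 1) := by
  have h : Tendsto (fun r : ℝ => 1 - fR n r) atTop (𝓝 (1 - 0)) :=
    tendsto_const_nhds.sub (tendsto_fR hn)
  rw [sub_zero] at h
  refine h.congr fun r => ?_
  have : 1 + (r ^ 2) ^ n ≠ 0 := by positivity
  unfold fR; field_simp; ring

lemma tendsto_aR (hn : 0 < n) : Tendsto (aR n) atTop (𝓝 1) := by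
  have h := (((tendsto_pow_mul_fR hn).inv₀ one_ne_zero)).rpow_const
    (p := 1 / (n : ℝ)) (Or.inl (by simp))
  rw [inv_one, Real.one_rpow] at h
  refine h.congr' ?_
  filter_upwards [eventually_gt_atTop 0] with r hr
  have h1 : ((r ^ 2) ^ n * fR n r)⁻¹ = (1 + (r ^ 2) ^ n) / (r ^ 2) ^ n := by
    unfold fR; field_simp
  rw [h1, Real.div_rpow (by positivity) (by positivity), aR, ← Real.rpow_natCast (r ^ 2) n,
    ← Real.rpow_mul (by positivity), mul_one_div_cancel (by positivity), Real.rpow_one]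

lemma integrableOn_fR_sq (hn : 0 < n) :
    IntegrableOn (fun r : ℝ => r ^ (2 * n - 1) * fR n r ^ 2) (Ioi 0) :=
  integrableOn_Ioi_deriv_of_nonneg' (fun r _ => hasDerivAt_fR hn r)
    (fun r hr => by have := hr.out; positivity) ((tendsto_fR hn).const_mul _)

lemma integral_fR_sq (hn : 0 < n) :
    ∫ r in Ioi (0 : ℝ), r ^ (2 * n - 1) * fR n r ^ 2 = 1 / (2 * n) := by
  rw [integral_Ioi_of_hasDerivAt_of_nonneg' (fun r _ => hasDerivAt_fR hn r)
    (fun r hr => by have := hr.out; positivity) ((tendsto_fR hn).const_mul _)]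
  simp [fR, hn.ne']

lemma integrable_fF_sq (hn : 0 < n) : Integrable fun x : Cn n => fF n x ^ 2 := by
  have := nontrivial_Cn hn
  have h := (integrable_fun_norm_addHaar (volume : Measure (Cn n)) (f := fun r => fR n r ^ 2)).2
    (by simpa only [finrank_Cn, smul_eq_mul] using integrableOn_fR_sq hn)
  exact h

lemma integral_fF_sq (hn : 0 < n) : ∫ x : Cn n, fF n x ^ 2 = sphereArea n / (2 * n) := by
  have := nontrivial_Cn hn
  rw [integral_polar volume _ (integrable_fF_sq hn), finrank_Cn]
  have : ∀ r ∈ Ioi (0 : ℝ), r ^ (2 * n - 1) * ∫ u : sphere (0 : Cn n) 1, fF n (r • (u : Cn n)) ^ 2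
      ∂(volume : Measure (Cn n)).toSphere =
      sphereArea n * (r ^ (2 * n - 1) * fR n r ^ 2) := fun r hr => by
    have : ∀ u : sphere (0 : Cn n) 1, fF n (r • (u : Cn n)) ^ 2 = fR n r ^ 2 := fun u => by
      rw [fF_eq, norm_smul, norm_eq_of_mem_sphere, mul_one, Real.norm_of_nonneg (le_of_lt hr)]
    simp only [this, integral_const, smul_eq_mul, sphereArea]
    ring
  rw [setIntegral_congr_fun measurableSet_Ioi this, integral_const_mul, integral_fR_sq hn]
  ring

lemma sphereArea_pos (hn : 0 < n) : 0 < sphereArea n := by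
  have : Nonempty (Idx n) := ⟨(⟨0, hn⟩, 0)⟩
  exact sphere_real_pos (ι := Idx n)

lemma ae_ne_zero (hn : 0 < n) : ∀ᵐ x : Cn n, x ≠ 0 := by
  have := nontrivial_Cn hn
  exact Measure.ae_ne volume 0

/-- The density `|o|² = 2n(n-1) f²` is radial and the volume is Euclidean. Positivity of the norm
therefore needs `n > 1`. -/
lemma oNormSq_eq (hn : 0 < n) : oNormSq n = (n - 1) / n * sphereArea n := by
  have h : ∫ x : Cn n, tensorInner (calabi n) (oTensor n) (oTensor n) x * volDensity (calabi n) x =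
      ∫ x : Cn n, 2 * n * (n - 1) * fF n x ^ 2 := by
    refine integral_congr_ae ?_
    filter_upwards [ae_ne_zero hn] with x hx
    rw [tensorInner_oTensor_self hn hx, volDensity_calabi hn hx, mul_one]
  rw [oNormSq, h, integral_const_mul, integral_fF_sq hn]
  field_simp

lemma oNormSq_pos (hn : 2 ≤ n) : 0 < oNormSq n := by
  have h0 : 0 < n := by omega
  have h1 : (1 : ℝ) < n := by exact_mod_cast hn
  rw [oNormSq_eq h0]
  have := sphereArea_pos h0
  have : 0 < (n : ℝ) - 1 := by linarith
  positivity

end NormAndFlux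

/-! ### The flux integrals of `H` -/

section Flux

variable {n : ℕ} {Λ : ℝ} {U : Set (Cn n)} {g₀ : TwoTensor (Idx n)}

open Set Metric

/-- The flux constant of the quadratic tensor `H`. -/
def fluxConst (g₀ : TwoTensor (Idx n)) (Λ : ℝ) : ℝ :=
  sphereArea n / (n + 1) * ((2 - n) / 2 * Λ - 1 / 8 * curvOmega g₀)

lemma smul_sphere_ne_zero {r : ℝ} (hr : 0 < r) (u : sphere (0 : Cn n) 1) : r • (u : Cn n) ≠ 0 :=
  smul_ne_zero hr.ne' (ne_zero_of_mem_unit_sphere u)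

lemma norm_smul_sphere {r : ℝ} (hr : 0 < r) (u : sphere (0 : Cn n) 1) : ‖r • (u : Cn n)‖ = r := by
  rw [norm_smul, norm_eq_of_mem_sphere, mul_one, Real.norm_of_nonneg hr.le]

variable (hU : IsOpen U) (h0U : (0 : Cn n) ∈ U) (hE : IsEinsteinOn U g₀ Λ)
  (hδ : g₀ 0 = euclMetric (0 : Cn n))
include hU h0U hE hδ

lemma tensorInner_hTensor (hn : 0 < n) {r : ℝ} (hr : 0 < r) (u : sphere (0 : Cn n) 1) :
    tensorInner (calabi n) (hTensor g₀ Λ) (oTensor n) (r • (u : Cn n)) =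
      (aR n r)⁻¹ * fR n r * r ^ 2 * (Λ + (n - fR n r) / (1 - fR n r) *
        (-(4 * Λ / (3 * (n + 1))) - 1 / 3 * holSect g₀ u)) := by
  have hn' : (n : ℝ) + 1 ≠ 0 := by positivity
  have hf : 1 - fR n r ≠ 0 := (sub_pos.2 (fR_lt_one hr)).ne'
  rw [tensorInner_oTensor hn (smul_sphere_ne_zero hr u), trace_hTensor hU h0U hE hδ,
    hTensor_radial, hTensor_hopf, holSect_smul, fF_eq, aF_eq,
    norm_smul_sphere hr u]
  field_simp
  ring

lemma integral_tensorInner_hTensor (hn : 0 < n) {r : ℝ} (hr : 0 < r) :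
    ∫ u : sphere (0 : Cn n) 1, tensorInner (calabi n) (hTensor g₀ Λ) (oTensor n) (r • (u : Cn n))
      ∂(volume : Measure (Cn n)).toSphere =
      (aR n r)⁻¹ * fR n r * r ^ 2 * (sphereArea n * Λ + (n - fR n r) / (1 - fR n r) *
        (sphereArea n * -(4 * Λ / (3 * (n + 1))) - (2 * n * Λ + 3 / 2 * curvOmega g₀) *
          sphereArea n / (12 * n * (n + 1)))) := by
  have : Nonempty (Idx n) := ⟨(⟨0, hn⟩, 0)⟩
  have hn0 : (n : ℝ) ≠ 0 := by positivity
  have hn' : (n : ℝ) + 1 ≠ 0 := by positivity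
  have hi : Integrable (fun u : sphere (0 : Cn n) 1 => holSect g₀ u)
      (volume : Measure (Cn n)).toSphere := integrable_sphere continuous_holSect
  have hh : ∫ u : sphere (0 : Cn n) 1, holSect g₀ u ∂(volume : Measure (Cn n)).toSphere =
      (2 * n * Λ + 3 / 2 * curvOmega g₀) * sphereArea n / (4 * n * (n + 1)) := by
    rw [← integral_holSect hn hU h0U hE hδ]; field_simp
  have i1 : Integrable (fun u : sphere (0 : Cn n) 1 =>
      -(4 * Λ / (3 * ((n : ℝ) + 1))) - 1 / 3 * holSect g₀ u)
      (volume : Measure (Cn n)).toSphere := (integrable_const _).sub (hi.const_mul (1 / 3))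
  simp only [tensorInner_hTensor hU h0U hE hδ hn hr]
  rw [integral_const_mul, integral_add (integrable_const _) (i1.const_mul _), integral_const_mul,
    integral_sub (integrable_const _) (hi.const_mul _), integral_const_mul, hh,
    integral_const, integral_const]
  simp only [smul_eq_mul, sphereArea]
  field_simp
  ring

/-- As `r → ∞`, `a → 1`, `f → 0` and `r^{2n} f → 1`. The limit is `ω (Λ - 4nΛ/(3(n+1)))` minus `n/3`
times the integral of the quartic form. -/
lemma tendsto_integral_tensorInner_hTensor (hn : 0 < n) :
    Tendsto (fun r : ℝ => r ^ (2 * n - 2) * ∫ u : sphere (0 : Cn n) 1,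
      tensorInner (calabi n) (hTensor g₀ Λ) (oTensor n) (r • (u : Cn n))
        ∂(volume : Measure (Cn n)).toSphere) atTop (𝓝 (fluxConst g₀ Λ)) := by
  have hn0 : (n : ℝ) ≠ 0 := by positivity
  have hn' : (n : ℝ) + 1 ≠ 0 := by positivity
  have tf := tendsto_fR (n := n) hn
  have ta := (tendsto_aR (n := n) hn).inv₀ one_ne_zero
  have tq : Tendsto (fun r => ((n : ℝ) - fR n r) / (1 - fR n r)) atTop
      (𝓝 (((n : ℝ) - 0) / (1 - 0))) :=
    (tendsto_const_nhds.sub tf).div (tendsto_const_nhds.sub tf) (by norm_num)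
  have t := (ta.mul (tendsto_pow_mul_fR hn)).mul
    (((tq.mul_const (sphereArea n * -(4 * Λ / (3 * (n + 1))) -
      (2 * n * Λ + 3 / 2 * curvOmega g₀) * sphereArea n / (12 * n * (n + 1)))).const_add
      (sphereArea n * Λ)))
  have e : fluxConst g₀ Λ = 1⁻¹ * 1 * (sphereArea n * Λ + ((n : ℝ) - 0) / (1 - 0) *
      (sphereArea n * -(4 * Λ / (3 * (n + 1))) -
      (2 * n * Λ + 3 / 2 * curvOmega g₀) * sphereArea n / (12 * n * (n + 1)))) := by
    rw [fluxConst]; field_simp; ring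
  rw [e]
  refine t.congr' ?_
  filter_upwards [eventually_gt_atTop 0] with r hr
  rw [integral_tensorInner_hTensor hU h0U hE hδ hn hr]
  have : (r ^ 2) ^ n = r ^ (2 * n - 2) * r ^ 2 := by
    rw [← pow_mul, ← pow_add]; congr 1; omega
  rw [this]; ring

/-- The obstruction constant is the limit of the flux integrals. -/
theorem tendsto_flux (hn : 0 < n) :
    Tendsto (fun r : ℝ => -(1 / oNormSq n) * sphereIntegral n
      (fun x => ((n : ℝ) + 1) / r * tensorInner (calabi n) (hTensor g₀ Λ) (oTensor n) x) r) atTop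
      (𝓝 (-(sphereArea n / (n * oNormSq n)) * ((2 - (n : ℝ)) / 2 * Λ - 1 / 8 * curvOmega g₀))) := by
  have hn0 : (n : ℝ) ≠ 0 := by positivity
  have hn' : (n : ℝ) + 1 ≠ 0 := by positivity
  have tA : Tendsto (fun r => Real.sqrt (aR n r * (1 - fR n r))⁻¹) atTop
      (𝓝 (Real.sqrt (1 * (1 - 0))⁻¹)) :=
    (((tendsto_aR hn).mul (tendsto_const_nhds.sub (tendsto_fR hn))).inv₀ (by norm_num)).sqrt
  have t := (((tendsto_integral_tensorInner_hTensor hU h0U hE hδ hn).mul tA).const_mul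
    (((n : ℝ) + 1) / n)).const_mul (-(1 / oNormSq n))
  have e : -(sphereArea n / (n * oNormSq n)) * ((2 - (n : ℝ)) / 2 * Λ - 1 / 8 * curvOmega g₀) =
      -(1 / oNormSq n) * (((n : ℝ) + 1) / n * (fluxConst g₀ Λ * Real.sqrt (1 * (1 - 0))⁻¹)) := by
    rw [fluxConst]
    simp only [sub_zero, mul_one, inv_one, Real.sqrt_one]
    field_simp
  rw [e]
  refine t.congr' ?_
  filter_upwards [eventually_gt_atTop 0] with r hr
  -- The density is `1` and `|dr| = 1/A` tends to `1`, so asymptotically the area element is the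
  -- Euclidean one. The factor `1/r` lowers `r^{2n-1}` to `r^{2n-2}`.
  have hpt : ∀ u : sphere (0 : Cn n) 1, ((n : ℝ) + 1) / r *
      tensorInner (calabi n) (hTensor g₀ Λ) (oTensor n) (r • (u : Cn n)) *
      (volDensity (calabi n) (r • (u : Cn n)) *
        Real.sqrt (∑ i, ∑ j, invMetric (calabi n) (r • (u : Cn n)) i j *
          drForm (r • (u : Cn n)) i * drForm (r • (u : Cn n)) j) * r ^ (2 * n - 1)) =
      tensorInner (calabi n) (hTensor g₀ Λ) (oTensor n) (r • (u : Cn n)) *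
        (((n : ℝ) + 1) * Real.sqrt (aR n r * (1 - fR n r))⁻¹ * r ^ (2 * n - 2)) := fun u => by
    rw [volDensity_calabi hn (smul_sphere_ne_zero hr u),
      norm_dr_calabi hn (smul_sphere_ne_zero hr u), aF_eq, fF_eq, norm_smul_sphere hr u]
    have : r ^ (2 * n - 1) = r ^ (2 * n - 2) * r := by
      rw [← pow_succ]; congr 1; omega
    rw [this]; field_simp
  simp only [sphereIntegral, hpt]
  rw [integral_mul_const]
  field_simp

end Flux

/-! ### Green's identity tested against radial functions -/

section WeakFlux

variable {n : ℕ} {x : Cn n} {Λ lam : ℝ} {h : TwoTensor (Idx n)}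

open Matrix

lemma tMat_roughLaplacian_of_opP {ι : Type} [Fintype ι] [DecidableEq ι] {g h : TwoTensor ι}
    {x : EuclideanSpace ℝ ι} {c : Matrix ι ι ℝ} (hP : ∀ i j, opP g h x i j = c i j) :
    tMat (roughLaplacian g h) x = (-2 : ℝ) • c + (-2 : ℝ) • tMat (curvAction g h) x := by
  ext i j
  have := hP i j
  rw [opP] at this
  simp only [Matrix.add_apply, Matrix.smul_apply, tMat_apply, smul_eq_mul, ← this]
  ring

/-- The curvature terms cancel by self-adjointness and the `Λ g` term by `tr o = 0`. What remains is
`-2 λ' |o|²`. -/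
lemma div_greenField_of_eqn (hn : 0 < n) (hh : SmoothMatOn (puncture n) (tMat h))
    (heq : ∀ x, x ≠ 0 → ∀ i j,
      opP (calabi n) h x i j = Λ * calabi n x i j + lam * oTensor n x i j) (hx : x ≠ 0) :
    ∑ i, pd i (greenField (calabi n) h (oTensor n) i) x =
      -(4 * n * (n - 1) * lam * fF n x ^ 2) := by
  have hg := calabi_nondegenerate (n := n) hn
  have e1 := tMat_roughLaplacian_of_opP (g := calabi n) (h := h) (x := x)
    (c := Λ • tMat (calabi n) x + lam • tMat (oTensor n) x) (heq x hx)
  have e2 := tMat_roughLaplacian_of_opP (g := calabi n) (h := oTensor n) (x := x) (c := 0)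
    (fun i j => opP_oTensor hn hx i j)
  have e3 := hg.curvAction_selfAdjoint isOpen_puncture hx h (oTensor n)
  have e4 := tensorInner_oTensor_self hn hx
  have e5 := tensorInner_calabi_oTensor hn hx
  rw [tensorInner_eq_matInner] at e4 e5
  rw [tensorInner_eq_matInner, tensorInner_eq_matInner] at e3
  rw [hg.div_greenField isOpen_puncture hx hh (smooth_oTensor hn) (trace_chMat_calabi hn hx),
    tensorInner_eq_matInner, tensorInner_eq_matInner, e1, e2]
  simp only [matInner_add_left, matInner_smul_left, smul_zero, zero_add, e3, e4, e5]
  ring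

/-- Rewrite `⟨∇h, o⟩ - ⟨h, ∇o⟩` as `d⟨h, o⟩ - 2 ⟨h, ∇o⟩`. Radially `∇o` is a multiple of `o`, so the
flux depends on `h` only through the function `⟨h, o⟩`. -/
lemma sum_mul_greenField (hn : 0 < n) (hh : SmoothMatOn (puncture n) (tMat h)) (hx : x ≠ 0) :
    ∑ i, x i * greenField (calabi n) h (oTensor n) i x = (aF n x * (1 - fF n x))⁻¹ *
      (eul (tensorInner (calabi n) h (oTensor n)) x +
        4 * n * (1 - fF n x) * tensorInner (calabi n) h (oTensor n) x) := by
  have hg := calabi_nondegenerate (n := n) hn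
  have hu : tensorInner (calabi n) h (oTensor n) =
      fun y => matInner (calabi n) y (tMat h y) (tMat (oTensor n) y) := by
    funext y; exact tensorInner_eq_matInner _ _ _
  have hd : ∀ j, pd j (tensorInner (calabi n) h (oTensor n)) x =
      matInner (calabi n) x (covMat (calabi n) j (tMat h) x) (tMat (oTensor n) x) +
      matInner (calabi n) x (covMat (calabi n) j (tMat (oTensor n)) x) (tMat h x) := fun j => by
    rw [hu]; exact hg.pd_matInner isOpen_puncture hx hh (smooth_oTensor hn) j
  have hr : ∑ j, x j * matInner (calabi n) x (covMat (calabi n) j (tMat (oTensor n)) x) (tMat h x) =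
      -(2 * n * (1 - fF n x)) * tensorInner (calabi n) h (oTensor n) x := by
    simp only [← matInner_smul_left]
    rw [← matInner_sum_left, sum_smul_covMat_oTensor hn hx, matInner_smul_left,
      hg.matInner_comm hx, tensorInner_eq_matInner]
  have hs : ∀ i j, (tMat (calabi n) x)⁻¹ i j = (tMat (calabi n) x)⁻¹ j i := fun i j =>
    congrFun (congrFun (hg.inv_transpose hx) j) i
  have e : ∀ i, x i * greenField (calabi n) h (oTensor n) i x = ∑ j, ((tMat (calabi n) x)⁻¹ j i *
      x i) * (pd j (tensorInner (calabi n) h (oTensor n)) x -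
      2 * matInner (calabi n) x (covMat (calabi n) j (tMat (oTensor n)) x) (tMat h x)) := by
    intro i
    rw [greenField, Finset.mul_sum]
    refine Finset.sum_congr rfl fun j _ => ?_
    rw [hd, hs i j]; ring
  rw [Finset.sum_congr rfl fun i _ => e i, Finset.sum_comm]
  simp only [← Finset.sum_mul, inv_calabi_mul_self hn hx]
  have e2 : ∀ j, (aF n x * (1 - fF n x))⁻¹ * x j *
      (pd j (tensorInner (calabi n) h (oTensor n)) x -
      2 * matInner (calabi n) x (covMat (calabi n) j (tMat (oTensor n)) x) (tMat h x)) =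
      (aF n x * (1 - fF n x))⁻¹ * (x j * pd j (tensorInner (calabi n) h (oTensor n)) x -
      2 * (x j *
        matInner (calabi n) x (covMat (calabi n) j (tMat (oTensor n)) x) (tMat h x))) := fun j => by
    ring
  simp only [e2, ← Finset.mul_sum, Finset.sum_sub_distrib, hr, eul]
  ring

lemma smooth_tensorInner_oTensor (hn : 0 < n) (hh : SmoothMatOn (puncture n) (tMat h)) :
    ContDiffOn ℝ ∞ (tensorInner (calabi n) h (oTensor n)) (puncture n) := by
  have hu : tensorInner (calabi n) h (oTensor n) =
      fun y => matInner (calabi n) y (tMat h y) (tMat (oTensor n) y) := by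
    funext y; exact tensorInner_eq_matInner _ _ _
  rw [hu]
  exact (calabi_nondegenerate hn).smooth_matInner hh (smooth_oTensor hn)

/-! #### Radial cut-off functions -/

lemma pd_log_normSq {φ : ℝ → ℝ} (hφ : ContDiff ℝ ∞ φ) (hx : x ≠ 0) (i : Idx n) :
    pd i (fun y : Cn n => φ (Real.log (‖y‖ ^ 2))) x =
      2 * deriv φ (Real.log (‖x‖ ^ 2)) * (‖x‖ ^ 2)⁻¹ * x i := by
  have hs := (normSq_pos hx).ne'
  rw [pd_radial (φ := fun t => φ (Real.log t))
    ((hφ.differentiable (by simp) _).hasDerivAt.comp _ (Real.hasDerivAt_log hs))]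
  ring

lemma smooth_log_normSq {φ : ℝ → ℝ} (hφ : ContDiff ℝ ∞ φ) :
    ContDiffOn ℝ ∞ (fun y : Cn n => φ (Real.log (‖y‖ ^ 2))) (puncture n) :=
  hφ.comp_contDiffOn ((contDiffOn_normSq _).log fun _ hx => (normSq_pos hx).ne')

/-- The factor `2 φ'(log r²) r⁻² A⁻²`. -/
def zetaF (n : ℕ) (φ : ℝ → ℝ) (x : Cn n) : ℝ :=
  2 * deriv φ (Real.log (‖x‖ ^ 2)) * ((‖x‖ ^ 2)⁻¹ * (aF n x * (1 - fF n x))⁻¹)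

lemma contDiff_deriv {φ : ℝ → ℝ} (hφ : ContDiff ℝ ∞ φ) : ContDiff ℝ ∞ (deriv φ) :=
  (contDiff_infty_iff_deriv.1 hφ).2

lemma smooth_invCoefA : ContDiffOn ℝ ∞ (fun y : Cn n => (aF n y * (1 - fF n y))⁻¹)
    (puncture n) :=
  (contDiffOn_aF.mul (contDiffOn_const.sub contDiffOn_fF)).inv fun _ hx =>
    (mul_pos (aF_pos hx) (sub_pos.2 (fF_lt_one hx))).ne'

lemma smooth_zetaF {φ : ℝ → ℝ} (hφ : ContDiff ℝ ∞ φ) :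
    ContDiffOn ℝ ∞ (zetaF n φ) (puncture n) :=
  (contDiffOn_const.mul (smooth_log_normSq (contDiff_deriv hφ))).mul
    (((contDiffOn_normSq _).inv fun _ hx => (normSq_pos hx).ne').mul smooth_invCoefA)

lemma pd_zetaF (hn : 0 < n) {φ : ℝ → ℝ} (hφ : ContDiff ℝ ∞ φ) (hx : x ≠ 0) (i : Idx n) :
    pd i (zetaF n φ) x = ((‖x‖ ^ 2)⁻¹ * (aF n x * (1 - fF n x))⁻¹) * (‖x‖ ^ 2)⁻¹ *
      (4 * deriv (deriv φ) (Real.log (‖x‖ ^ 2)) - 2 * deriv φ (Real.log (‖x‖ ^ 2)) *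
        (2 + 2 * (n - 1) * fF n x)) * x i := by
  have hs := (normSq_pos hx).ne'
  have ha := (aF_pos (n := n) hx).ne'
  have hf : 1 - fF n x ≠ 0 := (sub_pos.2 (fF_lt_one hx)).ne'
  have hS := isOpen_puncture (n := n)
  have dl := diffAt_of_contDiffOn hS (smooth_log_normSq (n := n) (contDiff_deriv hφ)) hx
  have da := diffAt_of_contDiffOn hS (contDiffOn_aF (n := n)) hx
  have df := diffAt_fF (n := n) hx
  have d1f := df.const_sub 1
  have dA := diffAt_of_contDiffOn hS (smooth_invCoefA (n := n)) hx
  have di := diffAt_inv_normSq hx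
  have pA : pd i (fun y : Cn n => (aF n y * (1 - fF n y))⁻¹) x =
      -(2 * (n - 1) * fF n x) * (aF n x * (1 - fF n x))⁻¹ * (‖x‖ ^ 2)⁻¹ * x i := by
    rw [pd_comp (φ := fun t => t⁻¹) i (differentiableAt_inv (mul_ne_zero ha hf))
      (da.fun_mul d1f), deriv_inv, pd_mul i da d1f, pd_sub i (differentiableAt_const _) df,
      pd_const, pd_aF hn hx, pd_fF hn hx]
    field_simp
    ring
  unfold zetaF
  rw [pd_mul i (dl.const_mul _) (di.fun_mul dA), pd_const_mul i _ dl,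
    pd_log_normSq (contDiff_deriv hφ) hx, pd_mul i di dA, pd_inv_normSq hx, pA]
  field_simp
  ring

/-- The vector field used to test the flux identity. -/
def testField (n : ℕ) (h : TwoTensor (Idx n)) (φ : ℝ → ℝ) (i : Idx n) (x : Cn n) : ℝ :=
  φ (Real.log (‖x‖ ^ 2)) * greenField (calabi n) h (oTensor n) i x -
    tensorInner (calabi n) h (oTensor n) x * zetaF n φ x * x i

lemma smooth_testField (hn : 0 < n) (hh : SmoothMatOn (puncture n) (tMat h)) {φ : ℝ → ℝ}
    (hφ : ContDiff ℝ ∞ φ) (i : Idx n) : ContDiffOn ℝ ∞ (testField n h φ i) (puncture n) :=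
  ((smooth_log_normSq hφ).mul ((calabi_nondegenerate hn).smooth_greenField isOpen_puncture hh
    (smooth_oTensor hn) i)).sub (((smooth_tensorInner_oTensor hn hh).mul (smooth_zetaF hφ)).mul
      (contDiff_coord i).contDiffOn)

/-- With `u = ⟨h, o⟩`, the gradient of the cut-off paired with the Green field contains `ζ E u`.
Subtracting the divergence of `u ζ x` removes it, so no derivative of `h` is left. The coefficient
of `φ'` collapses to `(n+1)(1 - f)`, which vanishes at the zero section. -/
lemma div_testField (hn : 0 < n) (hh : SmoothMatOn (puncture n) (tMat h))
    (heq : ∀ x, x ≠ 0 → ∀ i j,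
      opP (calabi n) h x i j = Λ * calabi n x i j + lam * oTensor n x i j) (hx : x ≠ 0)
    {φ : ℝ → ℝ} (hφ : ContDiff ℝ ∞ φ) :
    ∑ i, pd i (testField n h φ i) x =
      4 * (tensorInner (calabi n) h (oTensor n) x *
        (((‖x‖ ^ 2)⁻¹ * (aF n x * (1 - fF n x))⁻¹) *
          ((n + 1) * (1 - fF n x) * deriv φ (Real.log (‖x‖ ^ 2)) -
            deriv (deriv φ) (Real.log (‖x‖ ^ 2))))) -
      4 * n * (n - 1) * lam * (φ (Real.log (‖x‖ ^ 2)) * fF n x ^ 2) := by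
  have hs := (normSq_pos hx).ne'
  have hS := isOpen_puncture (n := n)
  have dl := diffAt_of_contDiffOn hS (smooth_log_normSq (n := n) hφ) hx
  have dW := fun i => diffAt_of_contDiffOn hS ((calabi_nondegenerate (n := n) hn).smooth_greenField
    hS hh (smooth_oTensor hn) i) hx
  have du := diffAt_of_contDiffOn hS (smooth_tensorInner_oTensor hn hh) hx
  have dz := diffAt_of_contDiffOn hS (smooth_zetaF (n := n) hφ) hx
  have e : ∀ i, pd i (testField n h φ i) x =
      φ (Real.log (‖x‖ ^ 2)) * pd i (greenField (calabi n) h (oTensor n) i) x +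
      2 * deriv φ (Real.log (‖x‖ ^ 2)) * (‖x‖ ^ 2)⁻¹ *
        (x i * greenField (calabi n) h (oTensor n) i x) -
      zetaF n φ x * (x i * pd i (tensorInner (calabi n) h (oTensor n)) x) -
      tensorInner (calabi n) h (oTensor n) x * ((‖x‖ ^ 2)⁻¹ * (aF n x * (1 - fF n x))⁻¹) *
        (‖x‖ ^ 2)⁻¹ * (4 * deriv (deriv φ) (Real.log (‖x‖ ^ 2)) -
        2 * deriv φ (Real.log (‖x‖ ^ 2)) * (2 + 2 * (n - 1) * fF n x)) * (x i * x i) -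
      tensorInner (calabi n) h (oTensor n) x * zetaF n φ x * 1 := fun i => by
    unfold testField
    rw [pd_sub i (dl.fun_mul (dW i)) ((du.fun_mul dz).fun_mul (differentiable_coord i x)),
      pd_mul i dl (dW i), pd_mul i (du.fun_mul dz) (differentiable_coord i x), pd_mul i du dz,
      pd_log_normSq hφ hx, pd_zetaF hn hφ hx, pd_coord, kron_self]
    ring
  simp only [e, Finset.sum_add_distrib, Finset.sum_sub_distrib, ← Finset.mul_sum,
    div_greenField_of_eqn hn hh heq hx, sum_mul_greenField hn hh hx, sum_mul_self,
    Finset.sum_const, Finset.card_univ, nsmul_eq_mul, card_Idx]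
  rw [← eul, zetaF]
  field_simp
  ring

end WeakFlux

/-! ### The tested identity in polar coordinates -/

section WeakFluxPolar

variable {n : ℕ} {Λ lam : ℝ} {h : TwoTensor (Idx n)}

open Set Metric

/-- A smooth function on `ℂⁿ ∖ {0}` supported in an annulus extends smoothly by zero. -/
lemma exists_extension_of_annulus {F : Cn n → ℝ} (hF : ContDiffOn ℝ ∞ F (puncture n)) {a b : ℝ}
    (ha : 0 < a) (h1 : ∀ x, x ≠ 0 → ‖x‖ < a → F x = 0)
    (h2 : ∀ x, x ≠ 0 → b < ‖x‖ → F x = 0) :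
    ∃ G : Cn n → ℝ, ContDiff ℝ ∞ G ∧ HasCompactSupport G ∧ EqOn G F (puncture n) := by
  classical
  refine ⟨fun x => if x = 0 then 0 else F x, ?_, ?_, fun x hx => if_neg hx⟩
  · rw [contDiff_iff_contDiffAt]
    intro x
    by_cases hx : x = 0
    · have : (fun x => if x = 0 then 0 else F x) =ᶠ[𝓝 x] fun _ => (0 : ℝ) := by
        filter_upwards [ball_mem_nhds x ha] with y hy
        split_ifs with hy0
        · rfl
        · exact h1 y hy0 (by simpa [hx] using hy)
      exact contDiffAt_const.congr_of_eventuallyEq this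
    · have : (fun x => if x = 0 then 0 else F x) =ᶠ[𝓝 x] F := by
        filter_upwards [isOpen_puncture.mem_nhds hx] with y hy
        exact if_neg hy
      exact (hF.contDiffAt (isOpen_puncture.mem_nhds hx)).congr_of_eventuallyEq this
  · refine HasCompactSupport.intro (isCompact_closedBall (0 : Cn n) b) fun x hx => ?_
    rw [mem_closedBall_zero_iff, not_le] at hx
    split_ifs with hx0
    · rfl
    · exact h2 x hx0 hx

lemma integrable_of_annulus (hn : 0 < n) {F : Cn n → ℝ} (hF : ContDiffOn ℝ ∞ F (puncture n))
    {a b : ℝ} (ha : 0 < a) (h1 : ∀ x, x ≠ 0 → ‖x‖ < a → F x = 0)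
    (h2 : ∀ x, x ≠ 0 → b < ‖x‖ → F x = 0) : Integrable F := by
  obtain ⟨G, hG, hc, hGF⟩ := exists_extension_of_annulus hF ha h1 h2
  refine (hG.continuous.integrable_of_hasCompactSupport hc).congr ?_
  filter_upwards [ae_ne_zero hn] with x hx using hGF hx

/-- The integral of a derivative of the compactly supported extension vanishes, and the extension
differs from `F` at most at the origin. -/
lemma integral_pd_of_annulus (hn : 0 < n) {F : Cn n → ℝ} (hF : ContDiffOn ℝ ∞ F (puncture n))
    {a b : ℝ} (ha : 0 < a) (h1 : ∀ x, x ≠ 0 → ‖x‖ < a → F x = 0)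
    (h2 : ∀ x, x ≠ 0 → b < ‖x‖ → F x = 0) (i : Idx n) :
    Integrable (pd i F) ∧ ∫ x, pd i F x = 0 := by
  obtain ⟨G, hG, hc, hGF⟩ := exists_extension_of_annulus hF ha h1 h2
  have e : pd i G =ᵐ[volume] pd i F := by
    filter_upwards [ae_ne_zero hn] with x hx using pd_congr_on i isOpen_puncture hx hGF
  have hi : Integrable (pd i G) :=
    ((hG.continuous_fderiv (by simp)).clm_apply continuous_const).integrable_of_hasCompactSupport
      (hc.fderiv_apply ℝ _)
  exact ⟨hi.congr e, (integral_congr_ae e).symm.trans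
    (integral_fderiv_eq_zero volume (hG.of_le (by simp)) hc _)⟩

section Cutoff

variable {φ : ℝ → ℝ} {R : ℝ}

lemma log_normSq_lt {x : Cn n} (hR : 0 ≤ R) (hx : x ≠ 0) (h : ‖x‖ < Real.exp (-R)) :
    R < |Real.log (‖x‖ ^ 2)| := by
  have h0 : 0 < ‖x‖ := norm_pos_iff.2 hx
  have : Real.log ‖x‖ < -R := (Real.log_lt_iff_lt_exp h0).2 h
  rw [Real.log_pow, abs_of_neg (by push_cast; linarith)]
  push_cast; linarith

lemma lt_log_normSq {x : Cn n} (hR : 0 ≤ R) (h : Real.exp R < ‖x‖) :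
    R < |Real.log (‖x‖ ^ 2)| := by
  have h0 : 0 < ‖x‖ := (Real.exp_pos _).trans h
  have : R < Real.log ‖x‖ := (Real.lt_log_iff_exp_lt h0).2 h
  rw [Real.log_pow, abs_of_pos (by push_cast; linarith)]
  push_cast; linarith

lemma deriv_eq_zero_of_support (h : ∀ t, R < |t| → φ t = 0) : ∀ t, R < |t| → deriv φ t = 0 := by
  intro t ht
  have : φ =ᶠ[𝓝 t] fun _ => 0 := by
    filter_upwards [(isOpen_lt continuous_const continuous_abs).mem_nhds ht] with s hs using h s hs
  rw [this.deriv_eq]; simp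

end Cutoff

/-- The integrand of the flux side of the weak identity. -/
def fluxDensity (n : ℕ) (h : TwoTensor (Idx n)) (φ : ℝ → ℝ) (x : Cn n) : ℝ :=
  tensorInner (calabi n) h (oTensor n) x * (((‖x‖ ^ 2)⁻¹ * (aF n x * (1 - fF n x))⁻¹) *
    ((n + 1) * (1 - fF n x) * deriv φ (Real.log (‖x‖ ^ 2)) - deriv (deriv φ) (Real.log (‖x‖ ^ 2))))

/-- The weighted spherical means of `⟨h, o⟩`. -/
def fluxProfile (n : ℕ) (h : TwoTensor (Idx n)) (r : ℝ) : ℝ :=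
  r ^ (2 * n - 2) * (aR n r * (1 - fR n r))⁻¹ * ∫ u : sphere (0 : Cn n) 1,
    tensorInner (calabi n) h (oTensor n) (r • (u : Cn n)) ∂(volume : Measure (Cn n)).toSphere

variable {φ : ℝ → ℝ} {R : ℝ}

lemma smooth_fluxDensity (hn : 0 < n) (hh : SmoothMatOn (puncture n) (tMat h))
    (hφ : ContDiff ℝ ∞ φ) : ContDiffOn ℝ ∞ (fluxDensity n h φ) (puncture n) :=
  (smooth_tensorInner_oTensor hn hh).mul
    ((((contDiffOn_normSq _).inv fun _ hx => (normSq_pos hx).ne').mul smooth_invCoefA).mul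
      (((contDiffOn_const.mul (contDiffOn_const.sub contDiffOn_fF)).mul
        (smooth_log_normSq (contDiff_deriv hφ))).sub
          (smooth_log_normSq (contDiff_deriv (contDiff_deriv hφ)))))

/-- The flux identity tested against a radial function. -/
lemma weak_flux (hn : 0 < n) (hh : SmoothMatOn (puncture n) (tMat h))
    (heq : ∀ x, x ≠ 0 → ∀ i j,
      opP (calabi n) h x i j = Λ * calabi n x i j + lam * oTensor n x i j)
    (hφ : ContDiff ℝ ∞ φ) (hR : 0 ≤ R) (hs : ∀ t, R < |t| → φ t = 0) :
    Integrable (fluxDensity n h φ) ∧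
    Integrable (fun x : Cn n => φ (Real.log (‖x‖ ^ 2)) * fF n x ^ 2) ∧
    ∫ x, fluxDensity n h φ x =
      n * (n - 1) * lam * ∫ x : Cn n, φ (Real.log (‖x‖ ^ 2)) * fF n x ^ 2 := by
  have hs1 := deriv_eq_zero_of_support hs
  have hs2 := deriv_eq_zero_of_support hs1
  have i1 : Integrable (fluxDensity n h φ) := by
    have z : ∀ x : Cn n, R < |Real.log (‖x‖ ^ 2)| → fluxDensity n h φ x = 0 := fun x hx => by
      rw [fluxDensity, hs1 _ hx, hs2 _ hx]; ring
    exact integrable_of_annulus hn (smooth_fluxDensity hn hh hφ) (Real.exp_pos (-R))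
      (fun x hx hxa => z x (log_normSq_lt hR hx hxa)) fun x _ hxb => z x (lt_log_normSq hR hxb)
  have i2 : Integrable (fun x : Cn n => φ (Real.log (‖x‖ ^ 2)) * fF n x ^ 2) := by
    have z : ∀ x : Cn n, R < |Real.log (‖x‖ ^ 2)| →
        φ (Real.log (‖x‖ ^ 2)) * fF n x ^ 2 = 0 := fun x hx => by
      rw [hs _ hx, zero_mul]
    exact integrable_of_annulus hn ((smooth_log_normSq hφ).mul (contDiffOn_fF.pow 2))
      (Real.exp_pos (-R)) (fun x hx hxa => z x (log_normSq_lt hR hx hxa))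
      fun x _ hxb => z x (lt_log_normSq hR hxb)
  -- Bounded support of `φ` in `log r²` keeps the field away from both the origin and infinity, so
  -- there are no boundary terms.
  have i3 : ∀ i, Integrable (pd i (testField n h φ i)) ∧ ∫ x, pd i (testField n h φ i) x = 0 := by
    intro i
    have z : ∀ x : Cn n, R < |Real.log (‖x‖ ^ 2)| → testField n h φ i x = 0 := fun x hx => by
      rw [testField, zetaF, hs _ hx, hs1 _ hx]; ring
    exact integral_pd_of_annulus hn (smooth_testField hn hh hφ i) (Real.exp_pos (-R))
      (fun x hx hxa => z x (log_normSq_lt hR hx hxa)) (fun x _ hxb => z x (lt_log_normSq hR hxb)) i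
  have h0 : ∫ x, ∑ i, pd i (testField n h φ i) x = 0 := by
    rw [integral_finsetSum _ fun i _ => (i3 i).1]
    exact Finset.sum_eq_zero fun i _ => (i3 i).2
  have h1 : ∫ x, ∑ i, pd i (testField n h φ i) x = ∫ x, (4 * fluxDensity n h φ x -
      4 * n * (n - 1) * lam * (φ (Real.log (‖x‖ ^ 2)) * fF n x ^ 2)) := by
    refine integral_congr_ae ?_
    filter_upwards [ae_ne_zero hn] with x hx using div_testField hn hh heq hx hφ
  rw [h1, integral_sub (i1.const_mul _) (i2.const_mul _), integral_const_mul,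
    integral_const_mul] at h0
  refine ⟨i1, i2, ?_⟩
  linarith

lemma weak_flux_polar (hn : 0 < n) (hh : SmoothMatOn (puncture n) (tMat h))
    (heq : ∀ x, x ≠ 0 → ∀ i j,
      opP (calabi n) h x i j = Λ * calabi n x i j + lam * oTensor n x i j)
    (hφ : ContDiff ℝ ∞ φ) (hR : 0 ≤ R) (hs : ∀ t, R < |t| → φ t = 0) :
    ∫ r in Ioi (0 : ℝ), r⁻¹ * (fluxProfile n h r * ((n + 1) * (1 - fR n r) *
      deriv φ (Real.log (r ^ 2)) - deriv (deriv φ) (Real.log (r ^ 2)))) =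
      n * (n - 1) * lam * sphereArea n *
        ∫ r in Ioi (0 : ℝ), φ (Real.log (r ^ 2)) * (r ^ (2 * n - 1) * fR n r ^ 2) := by
  have := nontrivial_Cn hn
  obtain ⟨i1, i2, h0⟩ := weak_flux hn hh heq hφ hR hs
  rw [integral_polar _ _ i1, integral_polar _ _ i2, finrank_Cn] at h0
  have e1 : ∀ r ∈ Ioi (0 : ℝ), r ^ (2 * n - 1) * ∫ u : sphere (0 : Cn n) 1,
      fluxDensity n h φ (r • (u : Cn n)) ∂(volume : Measure (Cn n)).toSphere =
      r⁻¹ * (fluxProfile n h r * ((n + 1) * (1 - fR n r) *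
      deriv φ (Real.log (r ^ 2)) - deriv (deriv φ) (Real.log (r ^ 2)))) := fun r hr => by
    have hr' : r ≠ 0 := ne_of_gt hr
    have : r ^ (2 * n - 1) = r ^ (2 * n - 2) * r := by
      rw [← pow_succ]; congr 1; omega
    simp only [fluxDensity, fF_eq, aF_eq, norm_smul_sphere hr]
    rw [integral_mul_const, fluxProfile, this]
    field_simp
  have e2 : ∀ r ∈ Ioi (0 : ℝ), r ^ (2 * n - 1) * ∫ u : sphere (0 : Cn n) 1,
      φ (Real.log (‖r • (u : Cn n)‖ ^ 2)) * fF n (r • (u : Cn n)) ^ 2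
        ∂(volume : Measure (Cn n)).toSphere =
      sphereArea n * (φ (Real.log (r ^ 2)) * (r ^ (2 * n - 1) * fR n r ^ 2)) := fun r hr => by
    simp only [fF_eq, norm_smul_sphere hr, integral_const, smul_eq_mul, sphereArea]
    ring
  rw [setIntegral_congr_fun measurableSet_Ioi e1, setIntegral_congr_fun measurableSet_Ioi e2,
    integral_const_mul] at h0
  rw [h0]; ring

end WeakFluxPolar

/-! ### Removing the cut-off -/

section FluxLimit

variable {n : ℕ} {Λ lam K : ℝ} {h : TwoTensor (Idx n)}

open Set Metric

lemma integral_inv_mul_comp_exp (F : ℝ → ℝ) {M : ℝ} (hM : 0 < M) :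
    ∫ r in Ioi (0 : ℝ), r⁻¹ * F r = M * ∫ t, F (Real.exp (M * t)) := by
  have himg : (fun t => Real.exp (M * t)) '' univ = Ioi 0 := by
    ext r
    simp only [image_univ, mem_range, mem_Ioi]
    refine ⟨?_, fun hr => ⟨Real.log r / M, ?_⟩⟩
    · rintro ⟨t, rfl⟩; exact Real.exp_pos _
    · rw [mul_div_cancel₀ _ hM.ne', Real.exp_log hr]
  have hd : ∀ t ∈ (univ : Set ℝ), HasDerivWithinAt (fun t => Real.exp (M * t))
      (Real.exp (M * t) * M) univ t := fun t _ => by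
    have := ((hasDerivAt_id t).const_mul M).exp
    simp only [id_eq, mul_one] at this
    exact this.hasDerivWithinAt
  have hinj : InjOn (fun t => Real.exp (M * t)) univ := fun a _ b _ hab =>
    mul_left_cancel₀ hM.ne' (Real.exp_injective hab)
  have := integral_image_eq_integral_abs_deriv_smul MeasurableSet.univ hd hinj
    fun r => r⁻¹ * F r
  rw [himg] at this
  rw [this, Measure.restrict_univ, ← integral_const_mul]
  refine integral_congr_ae (Eventually.of_forall fun t => ?_)
  have h0 := Real.exp_pos (M * t)
  simp only [smul_eq_mul, abs_of_pos (mul_pos h0 hM)]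
  field_simp

/-- A smooth cut-off function on the line. -/
def cutoff : ContDiffBump (0 : ℝ) := ⟨1, 2, one_pos, one_lt_two⟩

lemma contDiff_cutoff : ContDiff ℝ ∞ cutoff := cutoff.contDiff

lemma cutoff_zero : cutoff 0 = 1 := cutoff.one_of_mem_closedBall (by simp [cutoff])

lemma cutoff_eq_zero {t : ℝ} (ht : 2 < |t|) : cutoff t = 0 :=
  cutoff.zero_of_le_dist (by simpa [cutoff] using ht.le)

lemma hasCompactSupport_cutoff : HasCompactSupport cutoff := cutoff.hasCompactSupport

lemma integrable_deriv_cutoff : Integrable (deriv cutoff) :=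
  (contDiff_deriv contDiff_cutoff).continuous.integrable_of_hasCompactSupport
    hasCompactSupport_cutoff.deriv

lemma integrable_deriv_deriv_cutoff : Integrable (deriv (deriv cutoff)) :=
  (contDiff_deriv (contDiff_deriv contDiff_cutoff)).continuous.integrable_of_hasCompactSupport
    hasCompactSupport_cutoff.deriv.deriv

lemma integral_Ioi_deriv_cutoff : ∫ t in Ioi (0 : ℝ), deriv cutoff t = -1 := by
  rw [hasCompactSupport_cutoff.integral_Ioi_deriv_eq (contDiff_cutoff.of_le (by simp)),
    cutoff_zero]

lemma measurable_fluxProfile (hn : 0 < n) (hh : SmoothMatOn (puncture n) (tMat h)) :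
    Measurable (fluxProfile n h) := by
  have hu : Measurable (tensorInner (calabi n) h (oTensor n)) :=
    measurable_of_continuousOn_compl_singleton 0 (smooth_tensorInner_oTensor hn hh).continuousOn
  have hm : StronglyMeasurable fun r : ℝ => ∫ u : sphere (0 : Cn n) 1,
      tensorInner (calabi n) h (oTensor n) (r • (u : Cn n))
        ∂(volume : Measure (Cn n)).toSphere := by
    apply StronglyMeasurable.integral_prod_right
      (f := fun r (u : sphere (0 : Cn n) 1) => tensorInner (calabi n) h (oTensor n) (r • (u : Cn n)))
    exact (hu.comp (measurable_fst.smul (measurable_subtype_coe.comp measurable_snd))).stronglyMeasurable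
  have ha : Measurable (aR n) := by unfold aR; fun_prop
  have hf : Measurable (fR n) := continuous_fR.measurable
  exact ((measurable_id.pow_const _).mul (ha.mul (hf.const_sub 1)).inv).mul hm.measurable

/-- The weak flux identity for the cut-off functions `χ(log r / M)`. -/
lemma flux_cutoff (hn : 0 < n) (hh : SmoothMatOn (puncture n) (tMat h))
    (heq : ∀ x, x ≠ 0 → ∀ i j,
      opP (calabi n) h x i j = Λ * calabi n x i j + lam * oTensor n x i j)
    {M : ℝ} (hM : 0 < M) :
    ∫ t, fluxProfile n h (Real.exp (M * t)) * ((n + 1) / 2 * (1 - fR n (Real.exp (M * t))) *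
      deriv cutoff t - (4 * M)⁻¹ * deriv (deriv cutoff) t) =
      n * (n - 1) * lam * sphereArea n *
        ∫ r in Ioi (0 : ℝ), cutoff ((2 * M)⁻¹ * Real.log (r ^ 2)) *
          (r ^ (2 * n - 1) * fR n r ^ 2) := by
  -- The profile is `φ(t) = χ(t/(2M))` with `t = log r²`, that is `χ(log r / M)`. The substitution
  -- `r = e^{Mt}` then makes the argument of `χ` equal to `t`.
  set c := (2 * M)⁻¹ with hc
  have hc0 : 0 < c := by positivity
  have hφ : ContDiff ℝ ∞ fun t => cutoff (c * t) :=
    contDiff_cutoff.comp (contDiff_const.mul contDiff_id)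
  have d1 : deriv (fun t => cutoff (c * t)) = fun t => c * deriv cutoff (c * t) := by
    funext t; rw [deriv_comp_mul_left, smul_eq_mul]
  have d2 : deriv (deriv fun t => cutoff (c * t)) = fun t => c * (c * deriv (deriv cutoff) (c * t)) := by
    rw [d1]; funext t
    have := (contDiff_deriv contDiff_cutoff).differentiable (by simp)
    rw [deriv_const_mul_field, deriv_comp_mul_left, smul_eq_mul]
  have key := weak_flux_polar hn hh heq hφ (R := 2 / c) (by positivity) fun t ht => by
    refine cutoff_eq_zero ?_
    rw [abs_mul, abs_of_pos hc0]
    rwa [div_lt_iff₀ hc0, mul_comm] at ht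
  rw [← key, integral_inv_mul_comp_exp _ hM, ← integral_const_mul, d2, d1]
  refine integral_congr_ae (Eventually.of_forall fun t => ?_)
  have e : c * Real.log (Real.exp (M * t) ^ 2) = t := by
    rw [Real.log_pow, Real.log_exp, hc]; push_cast; field_simp
  simp only [e]
  rw [hc]; field_simp; ring

/-- For `t < 0` the radius tends to zero, so `1 - f → 0` and a bounded profile suffices. For `t > 0`
the profile tends to `K`. The `χ''` term carries `1/M`. The limit is `K (n+1)/2` times the integral
of `χ'` over the positive half-line, which is `-1`. -/
lemma tendsto_flux_left (hn : 0 < n) (hh : SmoothMatOn (puncture n) (tMat h))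
    (hK : Tendsto (fluxProfile n h) atTop (𝓝 K)) {C : ℝ} (hC : ∀ r, 0 < r → |fluxProfile n h r| ≤ C) :
    Tendsto (fun M : ℝ => ∫ t, fluxProfile n h (Real.exp (M * t)) * ((n + 1) / 2 *
      (1 - fR n (Real.exp (M * t))) * deriv cutoff t - (4 * M)⁻¹ * deriv (deriv cutoff) t))
      atTop (𝓝 (-(K * ((n + 1) / 2)))) := by
  have hC0 : 0 ≤ C := (abs_nonneg _).trans (hC 1 one_pos)
  have hlim : ∫ t, (Ioi (0 : ℝ)).indicator (fun t => K * ((n + 1) / 2) * deriv cutoff t) t =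
      -(K * ((n + 1) / 2)) := by
    rw [integral_indicator measurableSet_Ioi, integral_const_mul, integral_Ioi_deriv_cutoff]; ring
  rw [← hlim]
  refine tendsto_integral_filter_of_dominated_convergence
    (fun t => C * (((n : ℝ) + 1) / 2 * |deriv cutoff t| + |deriv (deriv cutoff) t|)) ?_ ?_ ?_ ?_
  · refine Eventually.of_forall fun M => ?_
    have hexp : Measurable fun t : ℝ => Real.exp (M * t) := by fun_prop
    have m1 := (measurable_fluxProfile hn hh).comp hexp
    have m2 := (continuous_fR (n := n)).measurable.comp hexp
    have m3 : Measurable (deriv cutoff) := measurable_deriv _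
    have m4 : Measurable (deriv (deriv cutoff)) := measurable_deriv _
    exact (m1.mul (((m2.const_sub 1).const_mul _ |>.mul m3).sub (m4.const_mul _))).aestronglyMeasurable
  -- For `M ≥ 1` the factor `1/(4M)` is at most one, which makes the dominating function independent
  -- of `M`.
  · filter_upwards [eventually_ge_atTop (1 : ℝ)] with M hM
    refine Eventually.of_forall fun t => ?_
    have h0 := Real.exp_pos (M * t)
    have hf0 := fR_pos (n := n) (Real.exp (M * t))
    have hf1 := fR_lt_one (n := n) h0
    have hMi : (4 * M)⁻¹ ≤ 1 := inv_le_one_of_one_le₀ (by linarith)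
    have hMi0 : 0 ≤ (4 * M)⁻¹ := by positivity
    rw [Real.norm_eq_abs, abs_mul]
    refine mul_le_mul (hC _ h0) ((abs_sub _ _).trans (add_le_add ?_ ?_)) (abs_nonneg _) hC0
    · rw [abs_mul, abs_mul, abs_of_nonneg (show (0 : ℝ) ≤ (n + 1) / 2 by positivity),
        abs_of_nonneg (sub_nonneg.2 hf1.le)]
      refine mul_le_mul_of_nonneg_right ?_ (abs_nonneg _)
      exact mul_le_of_le_one_right (by positivity) (by linarith)
    · rw [abs_mul, abs_of_nonneg hMi0]
      exact mul_le_of_le_one_left (abs_nonneg _) hMi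
  · exact ((integrable_deriv_cutoff.abs.const_mul _).add integrable_deriv_deriv_cutoff.abs).const_mul _
  · have h0 : ∀ᵐ t : ℝ, t ≠ 0 := Measure.ae_ne volume 0
    filter_upwards [h0] with t ht
    have tM : Tendsto (fun M : ℝ => (4 * M)⁻¹ * deriv (deriv cutoff) t) atTop (𝓝 0) := by
      simpa using ((tendsto_id.const_mul_atTop (show (0 : ℝ) < 4 by norm_num)).inv_tendsto_atTop).mul_const
        (deriv (deriv cutoff) t)
    rcases lt_or_gt_of_ne ht with ht | ht
    · rw [indicator_of_notMem (by simpa using ht.le)]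
      have te : Tendsto (fun M : ℝ => Real.exp (M * t)) atTop (𝓝 0) :=
        Real.tendsto_exp_atBot.comp (tendsto_id.atTop_mul_const_of_neg ht)
      have tf : Tendsto (fun M : ℝ => fR n (Real.exp (M * t))) atTop (𝓝 1) := by
        have h1 : fR n 0 = 1 := by simp [fR, hn.ne']
        exact h1 ▸ ((continuous_fR (n := n)).tendsto 0).comp te
      have tb : Tendsto (fun M : ℝ => ((n : ℝ) + 1) / 2 *
          (1 - fR n (Real.exp (M * t))) * deriv cutoff t - (4 * M)⁻¹ * deriv (deriv cutoff) t)
          atTop (𝓝 0) := by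
        simpa using ((((tf.const_sub 1).const_mul (((n : ℝ) + 1) / 2)).mul_const (deriv cutoff t)).sub tM)
      refine squeeze_zero_norm (a := fun M : ℝ => C * |((n : ℝ) + 1) / 2 *
        (1 - fR n (Real.exp (M * t))) * deriv cutoff t - (4 * M)⁻¹ * deriv (deriv cutoff) t|)
        (fun M => ?_) ?_
      · rw [Real.norm_eq_abs, abs_mul]
        exact mul_le_mul_of_nonneg_right (hC _ (Real.exp_pos _)) (abs_nonneg _)
      · simpa using tb.abs.const_mul C
    · rw [indicator_of_mem (by simpa using ht)]
      have te : Tendsto (fun M : ℝ => Real.exp (M * t)) atTop atTop :=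
        Real.tendsto_exp_atTop.comp (tendsto_id.atTop_mul_const ht)
      have := (hK.comp te).mul
        ((((((tendsto_fR hn).comp te).const_sub 1).const_mul (((n : ℝ) + 1) / 2)).mul_const
          (deriv cutoff t)).sub tM)
      simpa [mul_assoc] using this

lemma tendsto_flux_right (hn : 0 < n) :
    Tendsto (fun M : ℝ => ∫ r in Ioi (0 : ℝ), cutoff ((2 * M)⁻¹ * Real.log (r ^ 2)) *
      (r ^ (2 * n - 1) * fR n r ^ 2)) atTop (𝓝 (1 / (2 * n))) := by
  rw [← integral_fR_sq hn]
  refine tendsto_integral_filter_of_dominated_convergence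
    (fun r => r ^ (2 * n - 1) * fR n r ^ 2) ?_ ?_ (integrableOn_fR_sq hn) ?_
  · refine Eventually.of_forall fun M => Measurable.aestronglyMeasurable ?_
    have m1 : Measurable fun r : ℝ => (2 * M)⁻¹ * Real.log (r ^ 2) := by fun_prop
    exact (contDiff_cutoff.continuous.measurable.comp m1).mul
      ((measurable_id.pow_const _).mul ((continuous_fR (n := n)).measurable.pow_const 2))
  · refine Eventually.of_forall fun M => ?_
    filter_upwards [ae_restrict_mem measurableSet_Ioi] with r hr
    have hr0 : (0 : ℝ) < r := hr
    rw [Real.norm_of_nonneg (mul_nonneg cutoff.nonneg (by positivity))]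
    exact mul_le_of_le_one_left (by positivity) cutoff.le_one
  · refine Eventually.of_forall fun r => ?_
    have tM : Tendsto (fun M : ℝ => (2 * M)⁻¹ * Real.log (r ^ 2)) atTop (𝓝 0) := by
      have := ((tendsto_id.const_mul_atTop
        (show (0 : ℝ) < 2 by norm_num)).inv_tendsto_atTop).mul_const (Real.log (r ^ 2))
      rwa [zero_mul] at this
    have := ((contDiff_cutoff.continuous.tendsto 0).comp tM).mul_const
      (r ^ (2 * n - 1) * fR n r ^ 2)
    rw [cutoff_zero, one_mul] at this
    exact this

/-- The obstruction constant of a solution with bounded and convergent flux profile. -/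
theorem lam_eq_of_tendsto_fluxProfile (hn : 0 < n) (hh : SmoothMatOn (puncture n) (tMat h))
    (heq : ∀ x, x ≠ 0 → ∀ i j,
      opP (calabi n) h x i j = Λ * calabi n x i j + lam * oTensor n x i j)
    (hK : Tendsto (fluxProfile n h) atTop (𝓝 K))
    {C : ℝ} (hC : ∀ r, 0 < r → |fluxProfile n h r| ≤ C) :
    (n - 1) * sphereArea n * lam = -((n + 1) * K) := by
  have hn0 : (n : ℝ) ≠ 0 := by positivity
  have t1 := tendsto_flux_left hn hh hK hC
  have t2 := (tendsto_flux_right hn).const_mul (n * (n - 1) * lam * sphereArea n)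
  -- Both sides of the cut-off identity converge: `-K (n+1)/2 = n (n-1) λ' ω / (2n)`.
  have := tendsto_nhds_unique (t1.congr' (by
    filter_upwards [eventually_gt_atTop 0] with M hM using flux_cutoff hn hh heq hM)) t2
  field_simp at this
  linarith

end FluxLimit

/-! ### Smooth tensors on `X` near the zero section -/

section Charts

variable {n : ℕ} {x : Cn n} {a : Fin n} {h : TwoTensor (Idx n)}

open Set Metric

lemma zc_eq (x : Cn n) (b : Fin n) : zc x b = x (b, 0) + x (b, 1) * Complex.I := by
  apply Complex.ext <;> simp [zc]

lemma contDiff_zc (b : Fin n) : ContDiff ℝ ∞ fun x : Cn n => zc x b := by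
  simp only [zc_eq]
  exact (Complex.ofRealCLM.contDiff.comp (contDiff_coord _)).add
    ((Complex.ofRealCLM.contDiff.comp (contDiff_coord _)).mul contDiff_const)

lemma isOpen_zc_ne (a : Fin n) : IsOpen {x : Cn n | zc x a ≠ 0} :=
  isOpen_ne.preimage (contDiff_zc a).continuous

/-- The complex components of the chart. -/
def chartC (a b : Fin n) (x : Cn n) : ℂ := if b = a then zc x a ^ n else zc x b / zc x a

lemma chart_zero (a b : Fin n) (x : Cn n) : chart a x (b, 0) = (chartC a b x).re := by
  simp [chart, ofZ, chartC]

lemma chart_one (a b : Fin n) (x : Cn n) : chart a x (b, 1) = (chartC a b x).im := by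
  simp [chart, ofZ, chartC]

lemma contDiffOn_chartC (a b : Fin n) : ContDiffOn ℝ ∞ (chartC a b) {x : Cn n | zc x a ≠ 0} := by
  unfold chartC
  split_ifs
  · exact ((contDiff_zc a).pow n).contDiffOn
  · simp only [div_eq_mul_inv]
    exact (contDiff_zc b).contDiffOn.mul ((contDiff_zc a).contDiffOn.inv fun x hx => hx)

lemma contDiffOn_chart (a : Fin n) (p : Idx n) :
    ContDiffOn ℝ ∞ (fun x => chart a x p) {x : Cn n | zc x a ≠ 0} := by
  obtain ⟨b, c⟩ := p
  fin_cases c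
  · simp only [Fin.zero_eta, chart_zero]
    exact Complex.reCLM.contDiff.comp_contDiffOn (contDiffOn_chartC a b)
  · simp only [Fin.mk_one, chart_one]
    exact Complex.imCLM.contDiff.comp_contDiffOn (contDiffOn_chartC a b)

lemma contDiffOn_chart_map (a : Fin n) : ContDiffOn ℝ ∞ (chart a) {x : Cn n | zc x a ≠ 0} :=
  contDiffOn_euclidean.2 fun p => contDiffOn_chart a p

lemma exists_zc_ne_zero (hx : x ≠ 0) : ∃ a, zc x a ≠ 0 := by
  by_contra! hc
  apply hx
  ext ⟨a, c⟩
  have h0 := congrArg Complex.re (hc a)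
  have h1 := congrArg Complex.im (hc a)
  fin_cases c
  · exact h0
  · exact h1

lemma smooth_of_isSmoothSymmetricOnX (hX : IsSmoothSymmetricOnX n h) :
    SmoothMatOn (puncture n) (tMat h) := by
  intro i j x hx
  obtain ⟨a, ha⟩ := exists_zc_ne_zero hx
  obtain ⟨k, hk, hhk⟩ := hX.smooth a
  have hS := isOpen_zc_ne (n := n) a
  have h1 : ContDiffOn ℝ ∞ (fun y => pullback (chart a) k y i j) {x : Cn n | zc x a ≠ 0} :=
    ContDiffOn.sum fun p _ => ContDiffOn.sum fun q _ =>
      ((contDiffOn_pd i hS (contDiffOn_chart a p)).mul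
        (contDiffOn_pd j hS (contDiffOn_chart a q))).mul
        ((hk p q).comp_contDiffOn (contDiffOn_chart_map a))
  refine (ContDiffAt.congr_of_eventuallyEq (h1.contDiffAt (hS.mem_nhds ha)) ?_).contDiffWithinAt
  filter_upwards [hS.mem_nhds ha] with y hy
  rw [tMat_apply, hhk y hy]

/-- The derivative of the complex components of the chart. -/
def chartD (a b : Fin n) (x v : Cn n) : ℂ :=
  if b = a then n * zc x a ^ (n - 1) * zc v a
  else (zc v b * zc x a - zc x b * zc v a) / zc x a ^ 2

/-- The real derivative is computed along the line `x + t v`, where the coordinates are affine in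
`t`. -/
lemma fderiv_chartC (b : Fin n) (ha : zc x a ≠ 0) (v : Cn n) :
    fderiv ℝ (chartC a b) x v = chartD a b x v := by
  have hd : DifferentiableAt ℝ (chartC a b) x :=
    ((contDiffOn_chartC a b).contDiffAt ((isOpen_zc_ne a).mem_nhds ha)).differentiableAt (by simp)
  have hl : ∀ b, HasDerivAt (fun t : ℝ => zc (x + t • v) b) (zc v b) 0 := fun b => by
    have e : (fun t : ℝ => zc (x + t • v) b) = fun t : ℝ => zc x b + t * zc v b := by
      funext t
      simp only [zc_eq, PiLp.add_apply, PiLp.smul_apply, smul_eq_mul]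
      push_cast; ring
    rw [e]
    simpa using (((hasDerivAt_id (0 : ℝ)).ofReal_comp).mul_const (zc v b)).const_add (zc x b)
  rw [← hd.lineDeriv_eq_fderiv, lineDeriv, chartD]
  unfold chartC
  split_ifs
  · simpa using ((hl a).fun_pow n).deriv
  · have := ((hl b).fun_div (hl a) (by simpa using ha)).deriv
    simpa using this

lemma abs_fderiv_chart_le (ha : zc x a ≠ 0) (v : Cn n) {D : ℝ}
    (hD : ∀ b, ‖chartD a b x v‖ ≤ D) (p : Idx n) :
    |∑ i, v i * pd i (fun y => chart a y p) x| ≤ D := by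
  obtain ⟨b, c⟩ := p
  have hd : DifferentiableAt ℝ (chartC a b) x :=
    ((contDiffOn_chartC a b).contDiffAt ((isOpen_zc_ne a).mem_nhds ha)).differentiableAt (by simp)
  rw [← fderiv_eq_sum_pd]
  refine le_trans ?_ (hD b)
  fin_cases c
  · simp only [Fin.zero_eta, chart_zero]
    have : HasFDerivAt (fun y => (chartC a b y).re) (Complex.reCLM.comp (fderiv ℝ (chartC a b) x)) x :=
      Complex.reCLM.hasFDerivAt.comp x hd.hasFDerivAt
    rw [this.fderiv, ContinuousLinearMap.comp_apply, fderiv_chartC b ha]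
    exact Complex.abs_re_le_norm _
  · simp only [Fin.mk_one, chart_one]
    have : HasFDerivAt (fun y => (chartC a b y).im) (Complex.imCLM.comp (fderiv ℝ (chartC a b) x)) x :=
      Complex.imCLM.hasFDerivAt.comp x hd.hasFDerivAt
    rw [this.fderiv, ContinuousLinearMap.comp_apply, fderiv_chartC b ha]
    exact Complex.abs_im_le_norm _

/-- The quadratic form of a pull-back is that of `k` on the pushed-forward vector. The double sum
has `(2n)²` terms. -/
lemma abs_pullback_le {φ : Cn n → Cn n} {k : TwoTensor (Idx n)} {v : Cn n} {C D : ℝ}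
    (hD : ∀ p, |∑ i, v i * pd i (fun y => φ y p) x| ≤ D) (hC : ∀ p q, |k (φ x) p q| ≤ C) :
    |∑ i, ∑ j, pullback φ k x i j * v i * v j| ≤ (2 * n) ^ 2 * C * D ^ 2 := by
  have e : ∑ i, ∑ j, pullback φ k x i j * v i * v j = ∑ p, ∑ q,
      (∑ i, v i * pd i (fun y => φ y p) x) * (∑ j, v j * pd j (fun y => φ y q) x) *
        k (φ x) p q := by
    simp only [pullback, Finset.sum_mul, Finset.mul_sum]
    simp only [fun i => Finset.sum_comm (s := (Finset.univ : Finset (Idx n)))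
      (t := Finset.univ) (f := fun j p => ∑ q, pd i (fun y => φ y p) x * pd j (fun y => φ y q) x *
        k (φ x) p q * v i * v j)]
    rw [Finset.sum_comm]
    refine Finset.sum_congr rfl fun p _ => ?_
    simp only [fun i => Finset.sum_comm (s := (Finset.univ : Finset (Idx n)))
      (t := Finset.univ) (f := fun j q => pd i (fun y => φ y p) x * pd j (fun y => φ y q) x *
        k (φ x) p q * v i * v j)]
    rw [Finset.sum_comm]
    refine Finset.sum_congr rfl fun q _ => ?_
    rw [Finset.sum_comm]
    refine Finset.sum_congr rfl fun i _ => Finset.sum_congr rfl fun j _ => ?_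
    ring
  rw [e]
  have hb : ∀ p q, |(∑ i, v i * pd i (fun y => φ y p) x) * (∑ j, v j * pd j (fun y => φ y q) x) *
      k (φ x) p q| ≤ D * D * C := fun p q => by
    have hD0 : 0 ≤ D := (abs_nonneg _).trans (hD p)
    rw [abs_mul, abs_mul]
    exact mul_le_mul (mul_le_mul (hD p) (hD q) (abs_nonneg _) hD0) (hC p q) (abs_nonneg _)
      (mul_nonneg hD0 hD0)
  calc _ ≤ ∑ p : Idx n, ∑ q : Idx n, D * D * C :=
        (Finset.abs_sum_le_sum_abs _ _).trans (Finset.sum_le_sum fun p _ =>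
          (Finset.abs_sum_le_sum_abs _ _).trans (Finset.sum_le_sum fun q _ => hb p q))
    _ = _ := by
        simp only [Finset.sum_const, Finset.card_univ, nsmul_eq_mul, card_Idx]; ring

lemma norm_zc_sq (x : Cn n) (b : Fin n) : ‖zc x b‖ ^ 2 = x (b, 0) ^ 2 + x (b, 1) ^ 2 := by
  rw [← Complex.normSq_eq_norm_sq, Complex.normSq_apply]; simp only [zc]; ring

lemma normSq_eq_sum_zc (x : Cn n) : ‖x‖ ^ 2 = ∑ b, ‖zc x b‖ ^ 2 := by
  rw [← sum_mul_self, sum_Idx]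
  exact Finset.sum_congr rfl fun b _ => by rw [norm_zc_sq]; ring

lemma norm_zc_le (x : Cn n) (b : Fin n) : ‖zc x b‖ ≤ ‖x‖ := by
  refine le_of_sq_le_sq ?_ (norm_nonneg _)
  rw [normSq_eq_sum_zc]
  exact Finset.single_le_sum (f := fun b => ‖zc x b‖ ^ 2) (fun _ _ => sq_nonneg _)
    (Finset.mem_univ b)

lemma zc_cstr (x : Cn n) (b : Fin n) : zc (cstr x) b = Complex.I * zc x b := by
  apply Complex.ext <;> simp [zc, cstr, ofZ]

/-- A smooth tensor on `X` is controlled near the zero section in a suitable chart. -/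
lemma exists_bound_near_zeroSection (hn : 0 < n) (hX : IsSmoothSymmetricOnX n h) :
    ∃ C, 0 ≤ C ∧ ∀ x : Cn n, x ≠ 0 → ‖x‖ ≤ 1 → ∃ a, zc x a ≠ 0 ∧ (∀ b, ‖zc x b‖ ≤ ‖zc x a‖) ∧
      ∀ v D, (∀ b, ‖chartD a b x v‖ ≤ D) → |∑ i, ∑ j, h x i j * v i * v j| ≤ C * D ^ 2 := by
  choose k hk hhk using hX.smooth
  have hb : ∀ a p q, ∃ C, ∀ y ∈ closedBall (0 : Cn n) (2 * n), ‖k a y p q‖ ≤ C := fun a p q =>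
    (isCompact_closedBall _ _).exists_bound_of_continuousOn (hk a p q).continuous.continuousOn
  choose C hC using hb
  have hS : 0 ≤ ∑ a, ∑ p, ∑ q, |C a p q| := by positivity
  refine ⟨(2 * n) ^ 2 * ∑ a, ∑ p, ∑ q, |C a p q|, by positivity, fun x hx hx1 => ?_⟩
  have : Nonempty (Fin n) := ⟨⟨0, hn⟩⟩
  -- In the chart of a largest coordinate all quotients `z^b/z^a` have modulus at most one, and so
  -- has the fibre coordinate for `|x| ≤ 1`. The image thus stays in a fixed compact ball, on which
  -- the smooth tensors `k a` are bounded.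
  obtain ⟨a, -, ha⟩ := Finset.exists_max_image Finset.univ (fun b => ‖zc x b‖) Finset.univ_nonempty
  have hmax : ∀ b, ‖zc x b‖ ≤ ‖zc x a‖ := fun b => ha b (Finset.mem_univ b)
  have ha0 : zc x a ≠ 0 := by
    obtain ⟨b, hb⟩ := exists_zc_ne_zero hx
    exact norm_pos_iff.1 ((norm_pos_iff.2 hb).trans_le (hmax b))
  refine ⟨a, ha0, hmax, fun v D hD => ?_⟩
  have hcC : ∀ b, ‖chartC a b x‖ ≤ 1 := fun b => by
    unfold chartC
    split_ifs
    · rw [norm_pow]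
      exact pow_le_one₀ (norm_nonneg _) ((norm_zc_le x a).trans hx1)
    · rw [norm_div]
      exact div_le_one_of_le₀ (hmax b) (norm_nonneg _)
  have hmem : chart a x ∈ closedBall (0 : Cn n) (2 * n) := by
    have h1 : (1 : ℝ) ≤ n := by exact_mod_cast hn
    rw [mem_closedBall_zero_iff]
    refine le_of_sq_le_sq ?_ (by positivity)
    rw [normSq_eq_sum_zc]
    have : ∀ b, ‖zc (chart a x) b‖ ^ 2 ≤ 1 := fun b => by
      have : zc (chart a x) b = chartC a b x := by
        apply Complex.ext
        · exact chart_zero a b x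
        · exact chart_one a b x
      rw [this]
      exact pow_le_one₀ (norm_nonneg _) (hcC b)
    refine (Finset.sum_le_sum fun b _ => this b).trans ?_
    simp only [Finset.sum_const, Finset.card_univ, Fintype.card_fin, nsmul_eq_mul, mul_one]
    nlinarith
  rw [hhk a x ha0]
  refine abs_pullback_le (abs_fderiv_chart_le ha0 v hD) fun p q => ?_
  calc |k a (chart a x) p q| ≤ C a p q := hC a p q _ hmem
    _ ≤ |C a p q| := le_abs_self _
    _ ≤ ∑ q, |C a p q| := Finset.single_le_sum (f := fun q => |C a p q|)
        (fun _ _ => abs_nonneg _) (Finset.mem_univ q)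
    _ ≤ ∑ p, ∑ q, |C a p q| := Finset.single_le_sum (f := fun p => ∑ q, |C a p q|)
        (fun _ _ => by positivity) (Finset.mem_univ p)
    _ ≤ _ := Finset.single_le_sum (f := fun a => ∑ p, ∑ q, |C a p q|)
        (fun _ _ => by positivity) (Finset.mem_univ a)

/-- A complex multiple of `x` is tangent to the fibre: the base components of its image vanish and
the fibre component is `n c ξ` with `ξ = (z^a)^n`. This extra smallness `r^n` is what `x` and `Jx`
enjoy. -/
lemma norm_chartD_of_zc (ha : zc x a ≠ 0) {c : ℂ} (hc : ‖c‖ = 1) {v : Cn n}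
    (hv : ∀ b, zc v b = c * zc x b) (b : Fin n) : ‖chartD a b x v‖ ≤ n * ‖x‖ ^ n := by
  unfold chartD
  split_ifs
  · obtain ⟨m, rfl⟩ : ∃ m, n = m + 1 := ⟨n - 1, by have := a.pos; omega⟩
    have e : ((m + 1 : ℕ) : ℂ) * zc x a ^ (m + 1 - 1) * (c * zc x a) =
        ((m + 1 : ℕ) : ℂ) * (c * zc x a ^ (m + 1)) := by
      rw [Nat.add_sub_cancel]; ring
    rw [hv, e, norm_mul, norm_mul, hc, one_mul, norm_pow, Complex.norm_natCast]
    exact mul_le_mul_of_nonneg_left (pow_le_pow_left₀ (norm_nonneg _) (norm_zc_le x a) _)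
      (by positivity)
  · rw [hv, hv]
    have : (c * zc x b * zc x a - zc x b * (c * zc x a)) / zc x a ^ 2 = 0 := by
      rw [div_eq_zero_iff]; left; ring
    rw [this, norm_zero]; positivity

/-- A general unit vector is stretched by at most order `1/|z^a|`. In the numerator, `n` covers the
fibre component and `2` the quotient components. -/
lemma norm_chartD_le (ha : zc x a ≠ 0) (hx1 : ‖x‖ ≤ 1) (hmax : ∀ b, ‖zc x b‖ ≤ ‖zc x a‖)
    {v : Cn n} (hv : ‖v‖ ≤ 1) (b : Fin n) : ‖chartD a b x v‖ ≤ (n + 2) / ‖zc x a‖ := by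
  have h0 : 0 < ‖zc x a‖ := norm_pos_iff.2 ha
  have h1 : ‖zc x a‖ ≤ 1 := (norm_zc_le x a).trans hx1
  have hv1 : ∀ b, ‖zc v b‖ ≤ 1 := fun b => (norm_zc_le v b).trans hv
  rw [le_div_iff₀ h0]
  unfold chartD
  split_ifs
  · rw [norm_mul, norm_mul, norm_pow, Complex.norm_natCast]
    have p1 : ‖zc x a‖ ^ (n - 1) ≤ 1 := pow_le_one₀ h0.le h1
    calc (n : ℝ) * ‖zc x a‖ ^ (n - 1) * ‖zc v a‖ * ‖zc x a‖ ≤ n * 1 * 1 * 1 := by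
          gcongr
          exact hv1 a
      _ ≤ n + 2 := by linarith
  · rw [norm_div, norm_pow]
    have : ‖zc v b * zc x a - zc x b * zc v a‖ ≤ 2 * ‖zc x a‖ := by
      refine (norm_sub_le _ _).trans ?_
      rw [norm_mul, norm_mul]
      nlinarith [hv1 a, hv1 b, hmax b, norm_nonneg (zc v a), norm_nonneg (zc v b),
        norm_nonneg (zc x b)]
    have hn0 : (0 : ℝ) ≤ n := by positivity
    calc ‖zc v b * zc x a - zc x b * zc v a‖ / ‖zc x a‖ ^ 2 * ‖zc x a‖ ≤
        2 * ‖zc x a‖ / ‖zc x a‖ ^ 2 * ‖zc x a‖ := by gcongr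
      _ = 2 := by field_simp
      _ ≤ n + 2 := by linarith

end Charts

/-! ### Bounds for `⟨h, o⟩` and for the flux profile -/

section FluxBounds

variable {n : ℕ} {x : Cn n} {h : TwoTensor (Idx n)}

open Set Metric

lemma inv_aR_le {r : ℝ} : (aR n r)⁻¹ ≤ r ^ 2 := by
  have h1 : (1 : ℝ) ≤ (1 + (r ^ 2) ^ n) ^ ((1 : ℝ) / n) :=
    Real.one_le_rpow (le_add_of_nonneg_right (by positivity)) (by positivity)
  rw [aR, inv_div]
  exact div_le_self (sq_nonneg r) h1

lemma one_sub_fR (r : ℝ) : 1 - fR n r = (r ^ 2) ^ n * fR n r := by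
  have : 1 + (r ^ 2) ^ n ≠ 0 := by positivity
  unfold fR; field_simp; ring

lemma flux_factor_nonneg {r : ℝ} (hr : 0 < r) : 0 ≤ r ^ (2 * n - 2) * (aR n r * (1 - fR n r))⁻¹ :=
  mul_nonneg (by positivity)
    (inv_nonneg.2 (mul_nonneg (aR_pos hr).le (sub_nonneg.2 (fR_lt_one hr).le)))

/-- By `a⁻¹ ≤ r²` and `1 - f = r^{2n} f`, the apparent singularity of the weight at `r = 0` cancels.
-/
lemma flux_factor_le (hn : 0 < n) {r : ℝ} (hr : 0 < r) :
    r ^ (2 * n - 2) * (aR n r * (1 - fR n r))⁻¹ ≤ 1 + (r ^ 2) ^ n := by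
  have hf := fR_pos (n := n) r
  have e : (r ^ 2) ^ n = r ^ (2 * n - 2) * r ^ 2 := by
    rw [← pow_mul, ← pow_add]; congr 1; omega
  have hi : 1 + (r ^ 2) ^ n = (fR n r)⁻¹ := by unfold fR; rw [one_div, inv_inv]
  rw [hi, mul_inv, one_sub_fR]
  calc r ^ (2 * n - 2) * ((aR n r)⁻¹ * ((r ^ 2) ^ n * fR n r)⁻¹) ≤
      r ^ (2 * n - 2) * (r ^ 2 * ((r ^ 2) ^ n * fR n r)⁻¹) := by
        gcongr
        exact inv_aR_le
    _ = (fR n r)⁻¹ := by rw [e]; field_simp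

lemma continuous_tensorInner_sphere (hn : 0 < n) (hh : SmoothMatOn (puncture n) (tMat h)) {r : ℝ}
    (hr : 0 < r) : Continuous fun u : sphere (0 : Cn n) 1 =>
      tensorInner (calabi n) h (oTensor n) (r • (u : Cn n)) :=
  (smooth_tensorInner_oTensor hn hh).continuousOn.comp_continuous
    (continuous_subtype_val.const_smul r) fun u => smul_sphere_ne_zero hr u

lemma integrable_tensorInner_sphere (hn : 0 < n) (hh : SmoothMatOn (puncture n) (tMat h)) {r : ℝ}
    (hr : 0 < r) : Integrable (fun u : sphere (0 : Cn n) 1 =>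
      tensorInner (calabi n) h (oTensor n) (r • (u : Cn n)))
      (volume : Measure (Cn n)).toSphere :=
  have : Nonempty (Idx n) := ⟨(⟨0, hn⟩, 0)⟩
  (continuous_tensorInner_sphere hn hh hr).integrable_of_hasCompactSupport
    (HasCompactSupport.of_compactSpace _)

lemma abs_integral_sphere_le (hn : 0 < n) {F : sphere (0 : Cn n) 1 → ℝ} {B : ℝ}
    (hB : ∀ u, |F u| ≤ B) :
    |∫ u, F u ∂(volume : Measure (Cn n)).toSphere| ≤ B * sphereArea n := by
  have : Nonempty (Idx n) := ⟨(⟨0, hn⟩, 0)⟩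
  exact norm_integral_le_of_norm_le_const (μ := (volume : Measure (Cn n)).toSphere) (f := F)
    (Eventually.of_forall hB)

/-- `⟨h, o⟩` is bounded near the zero section. -/
lemma bounded_tensorInner_near_zeroSection (hn : 0 < n) (hX : IsSmoothSymmetricOnX n h) :
    ∃ B, ∀ x : Cn n, x ≠ 0 → ‖x‖ ≤ 1 → |tensorInner (calabi n) h (oTensor n) x| ≤ B := by
  obtain ⟨C, hC, hb⟩ := exists_bound_near_zeroSection hn hX
  refine ⟨2 * n * (C * (n + 2) ^ 2 * n) + n * (C * n ^ 2 + C * n ^ 2), fun x hx hx1 => ?_⟩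
  obtain ⟨a, ha, hmax, hbound⟩ := hb x hx hx1
  have hs := normSq_pos hx
  have hn0 : (0 : ℝ) < n := by positivity
  have h0 : 0 < ‖zc x a‖ := norm_pos_iff.2 ha
  -- The order `r^{2n}` here compensates the factor `1/(1 - f)` in the pairing with `o`.
  have hrad : |∑ i, ∑ j, h x i j * x i * x j| ≤ C * n ^ 2 * (‖x‖ ^ 2) ^ n := by
    refine (hbound x _ (norm_chartD_of_zc ha (c := 1) (by simp) fun b => by simp)).trans_eq ?_
    ring
  have hhopf : |∑ i, ∑ j, h x i j * cstr x i * cstr x j| ≤ C * n ^ 2 * (‖x‖ ^ 2) ^ n := by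
    refine (hbound (cstr x) _ (norm_chartD_of_zc ha (c := Complex.I) (by simp)
      fun b => zc_cstr x b)).trans_eq ?_
    ring
  have hmaxsq : ‖x‖ ^ 2 ≤ n * ‖zc x a‖ ^ 2 := by
    rw [normSq_eq_sum_zc]
    refine (Finset.sum_le_sum fun b _ => pow_le_pow_left₀ (norm_nonneg _) (hmax b) 2).trans_eq ?_
    simp
  -- Cartesian components may grow like `r⁻²` at the zero section. The factor `a⁻¹ ≤ r²` in the
  -- pairing absorbs this.
  have hdiag : ∀ i, |h x i i| ≤ C * (n + 2) ^ 2 * n / ‖x‖ ^ 2 := fun i => by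
    have e : ∑ j, ∑ k, h x j k * (EuclideanSpace.single i (1 : ℝ) : Cn n) j *
        (EuclideanSpace.single i (1 : ℝ) : Cn n) k = h x i i := by
      have : ∀ j, (EuclideanSpace.single i (1 : ℝ) : Cn n) j = kron j i := fun j => by
        simp [kron]
      simp only [this, sum_mul_kron']
    have := hbound (EuclideanSpace.single i (1 : ℝ)) _ (norm_chartD_le ha hx1 hmax (by simp))
    rw [e] at this
    refine this.trans ?_
    rw [div_pow, ← mul_div_assoc, div_le_div_iff₀ (by positivity) hs]
    calc C * (n + 2) ^ 2 * ‖x‖ ^ 2 ≤ C * (n + 2) ^ 2 * (n * ‖zc x a‖ ^ 2) := by gcongr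
      _ = _ := by ring
  have htr : |∑ i, h x i i| ≤ 2 * n * (C * (n + 2) ^ 2 * n) / ‖x‖ ^ 2 := by
    refine (Finset.abs_sum_le_sum_abs _ _).trans ((Finset.sum_le_sum fun i _ => hdiag i).trans_eq ?_)
    rw [Finset.sum_const, Finset.card_univ, nsmul_eq_mul, card_Idx]; ring
  have hf0 := fF_pos (n := n) x
  have hf1 := fF_lt_one (n := n) hx
  have ha0 := aF_pos (n := n) hx
  have hai : (aF n x)⁻¹ ≤ ‖x‖ ^ 2 := inv_aR_le
  rw [tensorInner_oTensor hn hx, mul_add, one_sub_fF]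
  refine (abs_add_le _ _).trans (add_le_add ?_ ?_)
  · rw [abs_mul, abs_neg, abs_of_pos (mul_pos (inv_pos.2 ha0) hf0)]
    calc (aF n x)⁻¹ * fF n x * |∑ i, h x i i| ≤
        ‖x‖ ^ 2 * 1 * (2 * n * (C * (n + 2) ^ 2 * n) / ‖x‖ ^ 2) := by gcongr
      _ = _ := by field_simp
  · have hnf : 0 ≤ (n : ℝ) - fF n x := by
      have : (1 : ℝ) ≤ n := by exact_mod_cast hn
      linarith
    rw [abs_mul ((aF n x)⁻¹ * fF n x), abs_of_pos (mul_pos (inv_pos.2 ha0) hf0), abs_mul,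
      abs_of_nonneg (div_nonneg hnf (by positivity))]
    calc (aF n x)⁻¹ * fF n x * (((n : ℝ) - fF n x) / ((‖x‖ ^ 2) ^ n * fF n x * ‖x‖ ^ 2) *
          |∑ i, ∑ j, h x i j * x i * x j + ∑ i, ∑ j, h x i j * cstr x i * cstr x j|) ≤
        ‖x‖ ^ 2 * fF n x * (n / ((‖x‖ ^ 2) ^ n * fF n x * ‖x‖ ^ 2) *
          (C * n ^ 2 * (‖x‖ ^ 2) ^ n + C * n ^ 2 * (‖x‖ ^ 2) ^ n)) := by
          gcongr
          · linarith
          · exact (abs_add_le _ _).trans (add_le_add hrad hhopf)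
      _ = _ := by field_simp

/-- Three regions are treated: near infinity convergence bounds the profile, on the compact annulus
`1 ≤ r ≤ R` continuity bounds `⟨h, o⟩`, and near the zero section the charts do. -/
lemma bounded_fluxProfile {K : ℝ} (hn : 0 < n) (hX : IsSmoothSymmetricOnX n h)
    (hK : Tendsto (fluxProfile n h) atTop (𝓝 K)) :
    ∃ C, ∀ r, 0 < r → |fluxProfile n h r| ≤ C := by
  have hh := smooth_of_isSmoothSymmetricOnX hX
  obtain ⟨B, hB⟩ := bounded_tensorInner_near_zeroSection hn hX
  obtain ⟨R, hR⟩ := eventually_atTop.1 (hK.abs.eventually (gt_mem_nhds (lt_add_one |K|)))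
  have hcpt : IsCompact (closedBall (0 : Cn n) R \ ball 0 1) := (isCompact_closedBall _ _).diff isOpen_ball
  obtain ⟨B', hB'⟩ := hcpt.exists_bound_of_continuousOn
    ((smooth_tensorInner_oTensor hn hh).continuousOn.mono fun x hx => by
      rintro rfl; exact hx.2 (mem_ball_self one_pos))
  refine ⟨max (|K| + 1) ((1 + (R ^ 2) ^ n) * (max B B' ⊔ 0) * sphereArea n), fun r hr => ?_⟩
  rcases le_or_gt R r with hRr | hRr
  · exact (hR r hRr).le.trans (le_max_left _ _)
  refine le_trans ?_ (le_max_right _ _)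
  rw [fluxProfile, abs_mul, abs_of_nonneg (flux_factor_nonneg hr), mul_assoc (1 + (R ^ 2) ^ n)]
  refine mul_le_mul ((flux_factor_le hn hr).trans ?_) ?_ (abs_nonneg _) (by positivity)
  · have : (r ^ 2) ^ n ≤ (R ^ 2) ^ n := by gcongr
    linarith
  · refine abs_integral_sphere_le hn fun u => ?_
    refine le_trans ?_ (le_max_left _ _)
    rcases le_or_gt r 1 with h1 | h1
    · exact (hB _ (smul_sphere_ne_zero hr u) (by rwa [norm_smul_sphere hr])).trans (le_max_left _ _)
    · refine (hB' _ ⟨?_, ?_⟩).trans (le_max_right _ _)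
      · rw [mem_closedBall_zero_iff, norm_smul_sphere hr]; exact hRr.le
      · rw [mem_ball_zero_iff, norm_smul_sphere hr]; exact not_lt.2 h1.le

/-! #### Asymptotics -/

lemma abs_quadratic_le {d : Idx n → Idx n → ℝ} {B : ℝ} (hd : ∀ i j, |d i j| ≤ B) (v : Cn n) :
    |∑ i, ∑ j, d i j * v i * v j| ≤ (2 * n) ^ 2 * B * ‖v‖ ^ 2 := by
  have hv : ∀ i, |v i| ≤ ‖v‖ := fun i => PiLp.norm_apply_le v i
  have hb : ∀ i j, |d i j * v i * v j| ≤ B * ‖v‖ * ‖v‖ := fun i j => by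
    have hB : 0 ≤ B := (abs_nonneg _).trans (hd i j)
    rw [abs_mul, abs_mul]
    exact mul_le_mul (mul_le_mul (hd i j) (hv i) (abs_nonneg _) hB) (hv j) (abs_nonneg _)
      (by positivity)
  calc _ ≤ ∑ i : Idx n, ∑ j : Idx n, B * ‖v‖ * ‖v‖ :=
        (Finset.abs_sum_le_sum_abs _ _).trans (Finset.sum_le_sum fun p _ =>
          (Finset.abs_sum_le_sum_abs _ _).trans (Finset.sum_le_sum fun q _ => hb p q))
    _ = _ := by
        simp only [Finset.sum_const, Finset.card_univ, nsmul_eq_mul, card_Idx]; ring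

/-- A bound for Cartesian components passes to the pairing with `o` at the cost of a factor of order
`f`. The constant `8n³` is `n · 2 · (2n)²`, from the two quadratic forms in `x` and `Jx`. -/
lemma abs_tensorInner_oTensor_le (hn : 0 < n) (hx : x ≠ 0) {d : TwoTensor (Idx n)} {B : ℝ}
    (hd : ∀ i j, |d x i j| ≤ B) : |tensorInner (calabi n) d (oTensor n) x| ≤
      (aF n x)⁻¹ * fF n x * B * (2 * n + 8 * n ^ 3 / (1 - fF n x)) := by
  have hs := normSq_pos hx
  have hf0 := fF_pos (n := n) x
  have hf1 := sub_pos.2 (fF_lt_one (n := n) hx)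
  have ha0 := aF_pos (n := n) hx
  have h1 : (1 : ℝ) ≤ n := by exact_mod_cast hn
  have htr : |∑ i, d x i i| ≤ 2 * n * B := by
    refine (Finset.abs_sum_le_sum_abs _ _).trans ((Finset.sum_le_sum fun i _ => hd i i).trans_eq ?_)
    rw [Finset.sum_const, Finset.card_univ, nsmul_eq_mul, card_Idx]
  have hrad := abs_quadratic_le hd x
  have hhopf := abs_quadratic_le hd (cstr x)
  rw [norm_cstr_sq] at hhopf
  have hnf : 0 ≤ ((n : ℝ) - fF n x) / ((1 - fF n x) * ‖x‖ ^ 2) :=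
    div_nonneg (by linarith) (by positivity)
  rw [tensorInner_oTensor hn hx, abs_mul, abs_of_pos (mul_pos (inv_pos.2 ha0) hf0), mul_assoc _ B]
  refine mul_le_mul_of_nonneg_left ?_ (by positivity)
  refine (abs_add_le _ _).trans ?_
  rw [abs_neg, abs_mul, abs_of_nonneg hnf]
  calc _ ≤ 2 * n * B + n / ((1 - fF n x) * ‖x‖ ^ 2) *
        ((2 * n) ^ 2 * B * ‖x‖ ^ 2 + (2 * n) ^ 2 * B * ‖x‖ ^ 2) := by
        gcongr
        · linarith
        · exact (abs_add_le _ _).trans (add_le_add hrad hhopf)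
    _ = _ := by field_simp; ring

end FluxBounds

/-! ### Solutions of the linearised problem -/

section Solutions

variable {n : ℕ} {Λ ε lam : ℝ} {U : Set (Cn n)} {g₀ h H : TwoTensor (Idx n)}

open Set Metric

lemma exists_asymptotic_bound {e : ℝ}
    (hO : ∀ i j, (fun x => h x i j - H x i j) =O[Bornology.cobounded (Cn n)] fun x => ‖x‖ ^ e) :
    ∃ C, 0 ≤ C ∧ ∀ᶠ r : ℝ in atTop, ∀ x : Cn n, ‖x‖ = r → ∀ i j,
      |h x i j - H x i j| ≤ C * r ^ e := by
  choose C hC0 hC using fun i j => (hO i j).exists_pos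
  refine ⟨∑ i, ∑ j, C i j, Finset.sum_nonneg fun i _ => Finset.sum_nonneg fun j _ => (hC0 i j).le, ?_⟩
  have hev : ∀ᶠ x in Bornology.cobounded (Cn n), ∀ i j,
      ‖h x i j - H x i j‖ ≤ C i j * ‖‖x‖ ^ e‖ :=
    eventually_all.2 fun i => eventually_all.2 fun j => (hC i j).bound
  rw [← comap_norm_atTop, eventually_comap] at hev
  filter_upwards [hev] with r hr x hx i j
  have hp : 0 ≤ r ^ e := Real.rpow_nonneg (hx ▸ norm_nonneg x) e
  refine (hr x hx i j).trans ?_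
  rw [hx, Real.norm_of_nonneg hp]
  refine mul_le_mul_of_nonneg_right ?_ hp
  exact (Finset.single_le_sum (f := fun j => C i j) (fun j _ => (hC0 i j).le)
    (Finset.mem_univ j)).trans (Finset.single_le_sum (f := fun i => ∑ j, C i j)
      (fun i _ => Finset.sum_nonneg fun j _ => (hC0 i j).le) (Finset.mem_univ i))

/-- The powers combine to `r^ε ≤ r`, and the crude bound `f ≤ r⁻²` is already enough for decay. -/
lemma pow_mul_fR_mul_rpow_le (hn : 0 < n) (hε : ε < 1) {r : ℝ} (hr : 1 ≤ r) :
    r ^ (2 * n - 2) * (fR n r * r ^ (-2 * (n : ℝ) + 2 + ε)) ≤ r⁻¹ := by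
  have hr0 : 0 < r := by linarith
  have e1 : r ^ (2 * n - 2) * r ^ (-2 * (n : ℝ) + 2 + ε) = r ^ ε := by
    rw [← Real.rpow_natCast, ← Real.rpow_add hr0, Nat.cast_sub (by omega)]
    congr 1; push_cast; ring
  have e2 : r ^ ε ≤ r := by
    simpa using Real.rpow_le_rpow_of_exponent_le hr hε.le
  have e3 : fR n r ≤ (r ^ 2)⁻¹ := by
    rw [fR, one_div]
    refine inv_anti₀ (by positivity) ?_
    have : r ^ 2 ≤ (r ^ 2) ^ n := le_self_pow₀ (one_le_pow₀ hr) hn.ne'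
    linarith
  calc _ = fR n r * r ^ ε := by rw [← e1]; ring
    _ ≤ (r ^ 2)⁻¹ * r := by
      have := Real.rpow_nonneg hr0.le ε
      gcongr
    _ = r⁻¹ := by field_simp

/-- The error `h - H` does not contribute to the limiting spherical mean, so `h` and `H` have the
same flux constant. Only pointwise decay of the components is used, never of derivatives. -/
lemma tendsto_integral_sub (hn : 0 < n) (hε : ε < 1) (hh : SmoothMatOn (puncture n) (tMat h))
    (hH : SmoothMatOn (puncture n) (tMat H))
    (hO : ∀ i j, (fun x => h x i j - H x i j) =O[Bornology.cobounded (Cn n)]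
      fun x => ‖x‖ ^ (-2 * (n : ℝ) + 2 + ε)) :
    Tendsto (fun r : ℝ => r ^ (2 * n - 2) *
      (∫ u : sphere (0 : Cn n) 1, tensorInner (calabi n) h (oTensor n) (r • (u : Cn n))
        ∂(volume : Measure (Cn n)).toSphere -
      ∫ u : sphere (0 : Cn n) 1, tensorInner (calabi n) H (oTensor n) (r • (u : Cn n))
        ∂(volume : Measure (Cn n)).toSphere)) atTop (𝓝 0) := by
  obtain ⟨C, hC0, hC⟩ := exists_asymptotic_bound hO
  have t : Tendsto (fun r : ℝ => (aR n r)⁻¹ * C * (2 * n + 8 * n ^ 3 / (1 - fR n r)) *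
      sphereArea n * r⁻¹) atTop
      (𝓝 (1⁻¹ * C * (2 * n + 8 * n ^ 3 / (1 - 0)) * sphereArea n * 0)) :=
    (((((tendsto_aR hn).inv₀ one_ne_zero).mul_const C).mul
      ((tendsto_const_nhds.div ((tendsto_fR hn).const_sub 1) (by norm_num)).const_add _)).mul_const
      _).mul tendsto_inv_atTop_zero
  rw [mul_zero] at t
  refine squeeze_zero_norm' ?_ t
  filter_upwards [hC, eventually_ge_atTop 1] with r hr h1
  have hr0 : 0 < r := by linarith
  have ha := aR_pos (n := n) hr0
  have hf := fR_pos (n := n) r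
  have hf1 := sub_pos.2 (fR_lt_one (n := n) hr0)
  have hS := sphereArea_pos hn
  have hsub : ∀ x : Cn n, tensorInner (calabi n) h (oTensor n) x -
      tensorInner (calabi n) H (oTensor n) x =
      tensorInner (calabi n) (fun x i j => h x i j - H x i j) (oTensor n) x := fun x => by
    rw [tensorInner_eq_matInner, tensorInner_eq_matInner, tensorInner_eq_matInner,
      ← matInner_sub_left]
    rfl
  rw [← integral_sub (integrable_tensorInner_sphere hn hh hr0)
    (integrable_tensorInner_sphere hn hH hr0), Real.norm_eq_abs, abs_mul,
    abs_of_nonneg (by positivity)]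
  simp only [hsub]
  have hb := abs_integral_sphere_le hn (F := fun u : sphere (0 : Cn n) 1 =>
    tensorInner (calabi n) (fun x i j => h x i j - H x i j) (oTensor n) (r • (u : Cn n)))
    (B := (aR n r)⁻¹ * fR n r * (C * r ^ (-2 * (n : ℝ) + 2 + ε)) *
      (2 * n + 8 * n ^ 3 / (1 - fR n r))) fun u => by
    have := abs_tensorInner_oTensor_le hn (smul_sphere_ne_zero hr0 u)
      (d := fun x i j => h x i j - H x i j) (hr _ (norm_smul_sphere hr0 u))
    rwa [aF_eq, fF_eq, norm_smul_sphere hr0] at this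
  calc _ ≤ r ^ (2 * n - 2) * ((aR n r)⁻¹ * fR n r * (C * r ^ (-2 * (n : ℝ) + 2 + ε)) *
      (2 * n + 8 * n ^ 3 / (1 - fR n r)) * sphereArea n) :=
        mul_le_mul_of_nonneg_left hb (by positivity)
    _ = (aR n r)⁻¹ * C * (2 * n + 8 * n ^ 3 / (1 - fR n r)) * sphereArea n *
        (r ^ (2 * n - 2) * (fR n r * r ^ (-2 * (n : ℝ) + 2 + ε))) := by ring
    _ ≤ _ := mul_le_mul_of_nonneg_left (pow_mul_fR_mul_rpow_le hn hε h1) (by positivity)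

lemma smooth_hTensor : SmoothMatOn (puncture n) (tMat (hTensor g₀ Λ)) := fun _ _ =>
  ContDiffOn.sum fun i _ => ContDiffOn.sum fun j _ =>
    ((contDiff_const.mul (contDiff_coord i)).mul (contDiff_coord j)).contDiffOn

variable (hU : IsOpen U) (h0U : (0 : Cn n) ∈ U) (hE : IsEinsteinOn U g₀ Λ)
  (hδ : g₀ 0 = euclMetric (0 : Cn n))
include hU h0U hE hδ

lemma tendsto_fluxProfile (hn : 0 < n) (hε : ε < 1)
    (hsol : IsSolution n (hTensor g₀ Λ) Λ ε h lam) :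
    Tendsto (fluxProfile n h) atTop (𝓝 (fluxConst g₀ Λ)) := by
  have hh := smooth_of_isSmoothSymmetricOnX hsol.smooth
  have t := ((((tendsto_aR hn).mul ((tendsto_fR hn).const_sub 1)).inv₀ (by norm_num)).mul
    ((tendsto_integral_tensorInner_hTensor hU h0U hE hδ hn).add
      (tendsto_integral_sub hn hε hh smooth_hTensor hsol.asymp)))
  have e : ((1 : ℝ) * (1 - 0))⁻¹ * (fluxConst g₀ Λ + 0) = fluxConst g₀ Λ := by norm_num
  rw [e] at t
  refine t.congr fun r => ?_
  rw [fluxProfile]; ring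

/-- The constant of every solution is the obstruction constant. -/
theorem lam_eq_of_isSolution (hn : 2 ≤ n) (hε : ε < 1)
    (hsol : IsSolution n (hTensor g₀ Λ) Λ ε h lam) :
    lam = -(sphereArea n / (n * oNormSq n)) *
      ((2 - (n : ℝ)) / 2 * Λ - 1 / 8 * curvOmega g₀) := by
  have h0 : 0 < n := by omega
  have h1 : (1 : ℝ) < n := by exact_mod_cast hn
  have hn0 : (n : ℝ) ≠ 0 := by positivity
  have hn1 : (n : ℝ) - 1 ≠ 0 := by linarith
  have hn2 : (n : ℝ) + 1 ≠ 0 := by linarith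
  have hS := (sphereArea_pos h0).ne'
  have hK := tendsto_fluxProfile hU h0U hE hδ h0 hε hsol
  obtain ⟨C, hC⟩ := bounded_fluxProfile h0 hsol.smooth hK
  have key := lam_eq_of_tendsto_fluxProfile h0 (smooth_of_isSmoothSymmetricOnX hsol.smooth)
    hsol.eqn hK hC
  have e : ((n : ℝ) + 1) * fluxConst g₀ Λ =
      sphereArea n * ((2 - (n : ℝ)) / 2 * Λ - 1 / 8 * curvOmega g₀) := by
    rw [fluxConst]; field_simp
  rw [e] at key
  -- Solving for `λ'` divides by `(n-1) ω`, which equals `n ‖o‖²` and is nonzero because `n ≥ 2`.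
  have hne : ((n : ℝ) - 1) * sphereArea n ≠ 0 := mul_ne_zero hn1 hS
  have hl : lam = -(sphereArea n * ((2 - (n : ℝ)) / 2 * Λ - 1 / 8 * curvOmega g₀)) /
      ((n - 1) * sphereArea n) := by
    rw [eq_div_iff hne, ← key]; ring
  have hd : (n : ℝ) * oNormSq n = (n - 1) * sphereArea n := by
    rw [oNormSq_eq h0]; field_simp
  rw [hl, hd]; ring

end Solutions

end CalabiObstruction

end

theorem mainTheorem8 (n : ℕ) (hn : 2 ≤ n) (Λ : ℝ)
    (U : Set (Cn n)) (hU : IsOpen U) (h0U : (0 : Cn n) ∈ U)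
    (g₀ : TwoTensor (Idx n)) (hE : IsEinsteinOn U g₀ Λ)
    (hΓ : IsGammaInvariantOn U g₀) (hδ : g₀ 0 = euclMetric (0 : Cn n)) :
    -- `H` satisfies `-½ Δ_euc H = Λ g_euc` and is in Bianchi gauge
    ((∀ x i j, -(1 / 2) * roughLaplacian euclMetric (hTensor g₀ Λ) x i j = Λ * euclMetric x i j) ∧
      ∀ x i, opB euclMetric (hTensor g₀ Λ) x i = 0) ∧
    0 < oNormSq n ∧
    -- the obstruction constant given by the limit of the flux integrals
    Tendsto
      (fun r : ℝ => -(1 / oNormSq n) *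
        sphereIntegral n
          (fun x => ((n : ℝ) + 1) / r *
            tensorInner (calabi n) (hTensor g₀ Λ) (oTensor n) x) r)
      atTop
      (𝓝 (-(sphereArea n / (n * oNormSq n)) *
        ((2 - (n : ℝ)) / 2 * Λ - 1 / 8 * curvOmega g₀))) ∧
    -- it is the constant of every solution of the linearized problem with leading term `H`
    (∀ (ε : ℝ), 0 < ε → ε < 1 → ∀ (h : TwoTensor (Idx n)) (lam : ℝ),
      IsSolution n (hTensor g₀ Λ) Λ ε h lam →
      lam = -(sphereArea n / (n * oNormSq n)) *
        ((2 - (n : ℝ)) / 2 * Λ - 1 / 8 * curvOmega g₀)) ∧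
    -- and it is a positive multiple of `n ⟨R(ω), ω⟩ + 2 (n - 2) R(p₀)`
    0 < sphereArea n / (8 * (n : ℝ) ^ 2 * oNormSq n) ∧
    -(sphereArea n / (n * oNormSq n)) *
        ((2 - (n : ℝ)) / 2 * Λ - 1 / 8 * curvOmega g₀) =
      sphereArea n / (8 * (n : ℝ) ^ 2 * oNormSq n) *
        ((n : ℝ) * curvOmega g₀ + 2 * ((n : ℝ) - 2) * scalarCurv g₀ 0) := by
  have h0 : 0 < n := by omega
  have hn0 : (n : ℝ) ≠ 0 := by positivity
  have hN := oNormSq_pos hn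
  have hS := sphereArea_pos h0
  refine ⟨⟨laplacian_hTensor hU h0U hE hδ, opB_hTensor hU h0U hE hδ⟩, hN,
    tendsto_flux hU h0U hE hδ h0, fun ε _ hε h lam hsol =>
      lam_eq_of_isSolution hU h0U hE hδ hn hε hsol, by positivity, ?_⟩
  -- Substituting `R(p₀) = 2nΛ` turns the term `(2-n)Λ/2` into the multiple `2(n-2) R(p₀)` of the
  -- final form.
  rw [scalarCurv_origin hU h0U hE hδ]
  field_simp
  ring
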